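/- **Setting.** Let $\mathsf M=(\mathsf E,\mathsf G,\tau,\mu)$ be a crossed module of (finite dimensional, Hausdorff, second countable) real Lie groups, with Lie algebras $\mathfrak e,\mathfrak g$. Write $\dot\tau:\mathfrak e\to\mathfrak g$ for the derivative of $\tau$, $\mu^{\cdot}(g,\cdot)$ for the induced action of $\mathsf G$ on $\mathfrak e$ and ${}^{\cdot}\mu^{\cdot}(x,\cdot)$ for that of $\mathfrak g$ on $\mathfrak e$. Let $\mathrm D\mathsf M=\mathfrak e[1]\rtimes\mathsf G$ and $\mathrm D\mathfrak m=\mathfrak e[1]\oplus\mathfrak g$ be the derived Lie group and the derived Lie algebra. Let $\mathcal F=\bigoplus_{p\in\mathbb Z}\mathcal F^p$ be a graded commutative real algebra of functions of a graded space $N$, for example the algebra of internal functions on $N=T[1]P$, where $P$ is the synthetic total space of a principal 2-bundle with its right $\mathrm D\mathsf M$-action. For an ordinary manifold $X$, the $X$-valued functions on $N$ are the algebra homomorphisms $C^\infty(X)\to\mathcal F^0$. "Algebra of functions" means that an $(X\times Y)$-valued function is the same as a pair of an $X$-valued and a $Y$-valued one, and that a degree $p$ vector field along an $(X\times Y)$-valued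 function (a derivation $C^\infty(X\times Y)\to\mathcal F^p$ along it) is the same as a pair of vector fields along its two components. In particular $\mathsf G$-valued functions form a group. Let an operation of $\mathrm D\mathsf M$ on $\mathcal F$ be given: a subalgebra of constants $\mathcal C\subset\mathcal F$, and graded derivations $d,\,j_Z,\,l_Z$ of $\mathcal F$ of degrees $1,-1,0$, vanishing on $\mathcal C$, linear in $Z=(x,X)$, where $x\in\mathfrak g\otimes\mathcal C^0$ and $X\in\mathfrak e\otimes\mathcal C^1$ (the degree $0$ elements of $\mathrm D\mathfrak m$ with constant coefficients), such that for graded commutators $$[d,d]=0,\quad [d,j_Z]=l_Z,\quad [d,l_Z]=0,\quad [j_Z,j_W]=0,\quad [l_Z,j_W]=j_{[Z,W]},\quad [l_Z,l_W]=l_{[Z,W]} .$$ *Functions with values in $\mathrm D\mathfrak m$ and $\mathrm D\mathsf M$.* Let $\alpha$ be a formal variable of degree $-1$, with $\alpha^2=0$. A $\mathrm D\mathfrak m[p]$-valued function is $S=s+(-1)^p\alpha\,S_1$ with $s\in\mathfrak g\otimes\mathcal F^p$, $S_1\in\mathfrak e\otimes\mathcal F^{p+1}$; briefly $S=(s,S_1)$.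 For $S=(s,S_1)$, $T=(t,T_1)$ of degrees $p,q$, $$[S,T]=\bigl([s,t],\ {}^{\cdot}\mu^{\cdot}(s,T_1)-(-1)^{pq}\,{}^{\cdot}\mu^{\cdot}(t,S_1)\bigr),\qquad d_{\dot\tau}S=\bigl((-1)^p\dot\tau(S_1),0\bigr),$$ and a derivation $D$ of $\mathcal F$ acts by $DS=(Ds,DS_1)$. A $\mathrm D\mathsf M$-valued function is $\Psi=e^{\alpha J}g$ with $g$ a $\mathsf G$-valued function and $J\in\mathfrak e\otimes\mathcal F^1$; the product is $e^{\alpha J}g\cdot e^{\alpha J'}g'=e^{\alpha(J+\mu^{\cdot}(g,J'))}gg'$. Moreover $$\mathrm{Ad}\,\Psi(S)=\bigl(\mathrm{Ad}\,g(s),\ \mu^{\cdot}(g,S_1)-{}^{\cdot}\mu^{\cdot}(\mathrm{Ad}\,g(s),J)\bigr),$$ $$D\Psi\,\Psi^{-1}=\bigl(Dgg^{-1},\ DJ-{}^{\cdot}\mu^{\cdot}(Dgg^{-1},J)\bigr),\qquad d_{\dot\tau}\Psi\,\Psi^{-1}=\bigl(\dot\tau(J),-\tfrac12[J,J]\bigr),$$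 where $Dgg^{-1}$ is the right logarithmic derivative of $g$. A *2-connection* is a pair $A$, $B$ of $\mathrm D\mathfrak m[1]$- and $\mathrm D\mathfrak m[2]$-valued functions such that for all $Z$ $$dA=-\tfrac12[A,A]-d_{\dot\tau}A+B,\qquad dB=-[A,B]-d_{\dot\tau}B,$$ $$j_ZA=Z,\qquad j_ZB=0,\qquad l_ZA=-[Z,A]+d_{\dot\tau}Z,\qquad l_ZB=-[Z,B].$$ It is *flat* if $B=0$. A *1-gauge transformation* is a pair of a $\mathrm D\mathsf M$-valued function $\Psi$ and a $\mathrm D\mathfrak m[1]$-valued function $\Upsilon$ such that for all $Z$ $$d\Psi\Psi^{-1}=-d_{\dot\tau}\Psi\Psi^{-1}-\Upsilon,\qquad d\Upsilon=-\tfrac12[\Upsilon,\Upsilon]-d_{\dot\tau}\Upsilon,$$ $$j_Z\Psi\Psi^{-1}=0,\quad j_Z\Upsilon=Z-\mathrm{Ad}\,\Psi(Z),\quad l_Z\Psi\Psi^{-1}=-Z+\mathrm{Ad}\,\Psi(Z),\quad l_Z\Upsilon=-[Z,\Upsilon]+d_{\dot\tau}Z-\mathrm{Ad}\,\Psi(d_{\dot\tau}Z).$$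 **Proposition.** (1) If $A,B$ are the components of a 2-connection and $\Psi,\Upsilon$ those of a 1-gauge transformation, then $$A'=\mathrm{Ad}\,\Psi(A)+\Upsilon,\qquad B'=\mathrm{Ad}\,\Psi(B)$$ are the components of a 2-connection. (2) The 1-gauge transformations form a group, with product $(\Phi,\Xi)(\Psi,\Upsilon)=(\Phi\Psi,\ \Xi+\mathrm{Ad}\,\Phi(\Upsilon))$; unit and inverse have as transformation components the unit and the inverse of the $\mathrm D\mathsf M$-valued functions, and a 1-gauge transformation is determined by its component $\Psi$, so that the 1-gauge group is a subgroup of the group of $\mathrm D\mathsf M$-valued functions. The assignment $(A,B)\mapsto(A',B')$ of (1) is a left action of this group on the set of 2-connections, and a 2-connection is flat if and only if its transform by a given 1-gauge transformation is flat. -/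

import Mathlib

open scoped Manifold ContDiff TensorProduct

universe u v

noncomputable section

namespace TwoGauge

/-! ### Vector valued functions over a graded algebra

For a real vector space `V` and a graded algebra `A`, the elements of `V ⊗ A` are the `V`-valued
functions; those with coefficients in the piece of degree `p` are the `V[p]`-valued ones. -/

section Coefficients

variable {V W U : Type u} [AddCommGroup V] [Module ℝ V] [AddCommGroup W] [Module ℝ W]
  [AddCommGroup U] [Module ℝ U] {A : Type v} [Ring A] [Algebra ℝ A]

/-- The elements of `V ⊗ A` with coefficients in the subspace `S` of `A`. -/
def valued (V : Type u) [AddCommGroup V] [Module ℝ V] (S : Submodule ℝ A) :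
    Submodule ℝ (V ⊗[ℝ] A) :=
  LinearMap.range (TensorProduct.map (LinearMap.id : V →ₗ[ℝ] V) S.subtype)

/-- The extension of a bilinear map to coefficients in `A`:
`β (x ⊗ a) (y ⊗ b) = β x y ⊗ (a * b)`. -/
def extend (A : Type v) [Ring A] [Algebra ℝ A] (β : V →ₗ[ℝ] W →ₗ[ℝ] U) :
    V ⊗[ℝ] A →ₗ[ℝ] W ⊗[ℝ] A →ₗ[ℝ] U ⊗[ℝ] A :=
  TensorProduct.map₂ β (LinearMap.mul ℝ A)

/-- A linear map of coefficients, applied to the values of `V`-valued functions. -/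
def onValues (V : Type u) [AddCommGroup V] [Module ℝ V] (D : A →ₗ[ℝ] A) :
    V ⊗[ℝ] A →ₗ[ℝ] V ⊗[ℝ] A :=
  TensorProduct.map LinearMap.id D

theorem extend_tmul (β : V →ₗ[ℝ] W →ₗ[ℝ] U) (x : V) (a : A) (y : W) (b : A) :
    extend A β (x ⊗ₜ a) (y ⊗ₜ b) = β x y ⊗ₜ (a * b) := rfl

theorem tmul_mem_valued {S : Submodule ℝ A} (x : V) {a : A} (ha : a ∈ S) :
    x ⊗ₜ[ℝ] a ∈ valued V S :=
  ⟨x ⊗ₜ ⟨a, ha⟩, rfl⟩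

theorem valued_induction {S : Submodule ℝ A} {P : V ⊗[ℝ] A → Prop}
    (h0 : P 0) (ht : ∀ x a, a ∈ S → P (x ⊗ₜ a)) (hadd : ∀ s t, P s → P t → P (s + t))
    {s : V ⊗[ℝ] A} (hs : s ∈ valued V S) : P s := by
  obtain ⟨s, rfl⟩ := hs
  induction s using TensorProduct.induction_on with
  | zero => simpa using h0
  | tmul x a => exact ht x a a.2
  | add s t hs ht' => rw [map_add]; exact hadd _ _ hs ht'

theorem extend_mem_valued (β : V →ₗ[ℝ] W →ₗ[ℝ] U) {S T R : Submodule ℝ A}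
    (h : ∀ a ∈ S, ∀ b ∈ T, a * b ∈ R) {s : V ⊗[ℝ] A} {t : W ⊗[ℝ] A}
    (hs : s ∈ valued V S) (ht : t ∈ valued W T) : extend A β s t ∈ valued U R := by
  refine valued_induction (P := fun s => extend A β s t ∈ valued U R) ?_ ?_ ?_ hs
  · simp
  · intro x a ha
    refine valued_induction (P := fun t => extend A β (x ⊗ₜ a) t ∈ valued U R) ?_ ?_ ?_ ht
    · simp
    · intro y b hb
      rw [extend_tmul]
      exact tmul_mem_valued _ (h a ha b hb)
    · intro t t' h1 h2
      rw [map_add]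
      exact add_mem h1 h2
  · intro s s' h1 h2
    rw [map_add, LinearMap.add_apply]
    exact add_mem h1 h2

end Coefficients

/-! ### Smooth functions and partial derivatives -/

section Smooth

variable {VX HX X VY HY Y VZ HZ Z : Type*}
  [NormedAddCommGroup VX] [NormedSpace ℝ VX] [TopologicalSpace HX] [TopologicalSpace X]
  [ChartedSpace HX X]
  [NormedAddCommGroup VY] [NormedSpace ℝ VY] [TopologicalSpace HY] [TopologicalSpace Y]
  [ChartedSpace HY Y]
  [NormedAddCommGroup VZ] [NormedSpace ℝ VZ] [TopologicalSpace HZ] [TopologicalSpace Z]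
  [ChartedSpace HZ Z]
  {I : ModelWithCorners ℝ VX HX} {J : ModelWithCorners ℝ VY HY} {K : ModelWithCorners ℝ VZ HZ}

/-- Pull-back of smooth functions along a smooth map. -/
def pull (φ : C^∞⟮I, X; J, Y⟯) : C^∞⟮J, Y; ℝ⟯ →ₐ[ℝ] C^∞⟮I, X; ℝ⟯ where
  toFun f := f.comp φ
  map_one' := rfl
  map_mul' _ _ := rfl
  map_zero' := rfl
  map_add' _ _ := rfl
  commutes' _ := rfl

/-- If `φ x y₀` does not depend on `x`, then the derivative of `φ x` at `y₀` in a fixed direction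
is a smooth function of `x`. -/
theorem contMDiff_partial_of_const [IsManifold I ∞ X] [IsManifold J ∞ Y] [IsManifold K ∞ Z]
    (φ : X → Y → Z)
    (hφ : ContMDiff (I.prod J) K ∞ (Function.uncurry φ)) (y₀ : Y) (z₀ : Z)
    (h₀ : ∀ x, φ x y₀ = z₀) (v : VY) :
    ContMDiff I 𝓘(ℝ, VZ) ∞ (fun x => (mfderiv J K (φ x) y₀ v : VZ)) := by
  have : IsManifold I 1 X := IsManifold.of_le (n := ∞) (by simp)
  have : IsManifold J 1 Y := IsManifold.of_le (n := ∞) (by simp)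
  have : IsManifold K 1 Z := IsManifold.of_le (n := ∞) (by simp)
  intro x₀
  have key := ContMDiffAt.mfderiv_apply (m := ∞) (n := ∞) (I := J) (I' := K) (J := I) (J' := I)
    (x₀ := x₀) φ (fun _ => y₀) id (fun _ => v) (hφ.contMDiffAt) contMDiffAt_const contMDiffAt_id
    contMDiffAt_const (by simp)
  refine key.congr_of_eventuallyEq (Filter.Eventually.of_forall fun x => ?_)
  have hz : ∀ z z' : Z, z = z₀ → z' = z₀ → ∀ w : VZ,
      (tangentBundleCore K Z).coordChange (achart HZ z) (achart HZ z') z w = w := by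
    rintro z z' rfl rfl w
    exact (tangentBundleCore K Z).coordChange_self _ _ (mem_chart_source HZ _) w
  have hv : (tangentBundleCore J Y).coordChange (achart HY y₀) (achart HY y₀) y₀ v = v :=
    (tangentBundleCore J Y).coordChange_self _ _ (mem_chart_source HY _) v
  have e := inTangentCoordinates_eq (I := J) (I' := K) (fun _ : X => y₀) (fun x => φ x y₀)
    (fun x => (mfderiv J K (φ x) y₀ : VY →L[ℝ] VZ)) (x₀ := x₀) (x := x)
    (mem_chart_source HY y₀) (by rw [h₀ x, h₀ x₀]; exact mem_chart_source HZ z₀)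
  refine Eq.trans ?_ (congrArg (fun L : VY →L[ℝ] VZ => L v) e).symm
  refine Eq.trans ?_ (hz _ _ (h₀ x) (h₀ x₀) _).symm
  exact congrArg (mfderiv J K (φ x) y₀ : VY →L[ℝ] VZ) hv.symm

/-- Partial derivatives of smooth vector valued functions are smooth. -/
theorem contMDiff_partial [IsManifold I ∞ X] [IsManifold J ∞ Y] (φ : X → Y → VZ)
    (hφ : ContMDiff (I.prod J) 𝓘(ℝ, VZ) ∞ (Function.uncurry φ)) (y₀ : Y) (v : VY) :
    ContMDiff I 𝓘(ℝ, VZ) ∞ (fun x => (mfderiv J 𝓘(ℝ, VZ) (φ x) y₀ v : VZ)) := by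
  have : IsManifold I 1 X := IsManifold.of_le (n := ∞) (by simp)
  have : IsManifold J 1 Y := IsManifold.of_le (n := ∞) (by simp)
  intro x₀
  have key := ContMDiffAt.mfderiv_apply (m := ∞) (n := ∞) (I := J) (I' := 𝓘(ℝ, VZ)) (J := I)
    (J' := I)
    (x₀ := x₀) φ (fun _ => y₀) id (fun _ => v) (hφ.contMDiffAt) contMDiffAt_const contMDiffAt_id
    contMDiffAt_const (by simp)
  refine key.congr_of_eventuallyEq (Filter.Eventually.of_forall fun x => ?_)
  have hv : (tangentBundleCore J Y).coordChange (achart HY y₀) (achart HY y₀) y₀ v = v :=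
    (tangentBundleCore J Y).coordChange_self _ _ (mem_chart_source HY _) v
  have e := inTangentCoordinates_eq (I := J) (I' := 𝓘(ℝ, VZ)) (fun _ : X => y₀)
    (fun x => φ x y₀)
    (fun x => (mfderiv J 𝓘(ℝ, VZ) (φ x) y₀ : VY →L[ℝ] VZ)) (x₀ := x₀) (x := x)
    (mem_chart_source HY y₀) (by rw [chartAt_self_eq]; trivial)
  refine Eq.trans ?_ (congrArg (fun L : VY →L[ℝ] VZ => L v) e).symm
  rw [tangentBundleCore_coordChange_model_space]
  exact congrArg (mfderiv J 𝓘(ℝ, VZ) (φ x) y₀ : VY →L[ℝ] VZ) hv.symm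

end Smooth

/-! ### Lie groups and their Lie algebras -/

section LieGroups

variable (V : Type u) [NormedAddCommGroup V] [NormedSpace ℝ V]
  (G : Type u) [TopologicalSpace G] [ChartedSpace V G] [Group G]

/-- The Lie algebra of a Lie group `G` modelled on `V`. -/
abbrev LieAlg : Type u := GroupLieAlgebra 𝓘(ℝ, V) G

instance [FiniteDimensional ℝ V] : FiniteDimensional ℝ (LieAlg V G) :=
  inferInstanceAs (FiniteDimensional ℝ V)

instance [LieGroup 𝓘(ℝ, V) ∞ G] : LieGroup 𝓘(ℝ, V) (minSmoothness ℝ 3) G :=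
  LieGroup.of_le (n := ∞) (by
    rw [minSmoothness_of_isRCLikeNormedField]
    exact ENat.LEInfty.out)

variable {V G} in
/-- The derivative at `1` of a map between Lie groups which sends `1` to `1`. -/
def derivOne {V' : Type u} [NormedAddCommGroup V'] [NormedSpace ℝ V']
    {G' : Type u} [TopologicalSpace G'] [ChartedSpace V' G'] [Group G'] (f : G → G') :
    LieAlg V G →ₗ[ℝ] LieAlg V' G' :=
  ContinuousLinearMap.toLinearMap (M := V) (M₂ := V') (mfderiv 𝓘(ℝ, V) 𝓘(ℝ, V') f 1)

/-- A linear form on a finite dimensional Lie algebra is smooth. -/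
theorem contMDiff_linearForm [FiniteDimensional ℝ V] (ℓ : LieAlg V G →ₗ[ℝ] ℝ) :
    ContMDiff 𝓘(ℝ, V) 𝓘(ℝ, ℝ) ∞ (fun v : V => ℓ v) :=
  have key : ∀ l : V →ₗ[ℝ] ℝ, ContMDiff 𝓘(ℝ, V) 𝓘(ℝ, ℝ) ∞ (fun v : V => l v) :=
    fun l => (LinearMap.toContinuousLinearMap l).contMDiff
  key ℓ

/-- The Lie bracket of the Lie algebra of `G` as a bilinear map. -/
def lieBracket [FiniteDimensional ℝ V] [LieGroup 𝓘(ℝ, V) ∞ G] :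
    LieAlg V G →ₗ[ℝ] LieAlg V G →ₗ[ℝ] LieAlg V G :=
  have : CompleteSpace V := FiniteDimensional.complete ℝ V
  LinearMap.mk₂ ℝ (fun x y => ⁅x, y⁆) (fun x y z => add_lie x y z) (fun c x y => smul_lie c x y)
    (fun x y z => lie_add x y z) (fun c x y => lie_smul c x y)

/-- A smooth map from `G` to the endomorphisms of a vector space `W`. -/
structure EndMap (W : Type u) [AddCommGroup W] [Module ℝ W] where
  toFun : G → W →ₗ[ℝ] W
  smooth : ∀ (ℓ : W →ₗ[ℝ] ℝ) (w : W),
    ContMDiff 𝓘(ℝ, V) 𝓘(ℝ, ℝ) ∞ (fun g => ℓ (toFun g w))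

variable {V G}

/-- The matrix coefficient `g ↦ ℓ (ρ g w)`. -/
def EndMap.coeff {W : Type u} [AddCommGroup W] [Module ℝ W] (ρ : EndMap V G W)
    (ℓ : W →ₗ[ℝ] ℝ) (w : W) : C^∞⟮𝓘(ℝ, V), G; ℝ⟯ :=
  ⟨fun g => ℓ (ρ.toFun g w), ρ.smooth ℓ w⟩

/-- The adjoint action: `Ad g` is the derivative at `1` of the conjugation by `g`. -/
def adjoint [FiniteDimensional ℝ V] [LieGroup 𝓘(ℝ, V) ∞ G] : EndMap V G (LieAlg V G) where
  toFun g := derivOne (fun h : G => g * h * g⁻¹)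
  smooth ℓ w := by
    have h := contMDiff_partial_of_const (I := 𝓘(ℝ, V)) (J := 𝓘(ℝ, V)) (K := 𝓘(ℝ, V))
      (fun g h : G => g * h * g⁻¹)
      ((contMDiff_fst.mul contMDiff_snd).mul contMDiff_fst.inv) 1 1 (by simp) w
    exact (contMDiff_linearForm V G ℓ).comp h

/-- The derivative of a smooth function along the right invariant vector field with value `x` at
`1`; its value at `g` is the derivative of `h ↦ f (h * g)` at `1` in the direction `x`. -/
def rightDeriv [LieGroup 𝓘(ℝ, V) ∞ G] (f : C^∞⟮𝓘(ℝ, V), G; ℝ⟯) :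
    LieAlg V G →ₗ[ℝ] C^∞⟮𝓘(ℝ, V), G; ℝ⟯ where
  toFun x := ⟨fun g => (mfderiv 𝓘(ℝ, V) 𝓘(ℝ, ℝ) (fun h : G => f (h * g)) 1 : V →L[ℝ] ℝ) x, by
    exact contMDiff_partial (I := 𝓘(ℝ, V)) (J := 𝓘(ℝ, V)) (VZ := ℝ) (fun g h : G => f (h * g))
      (f.contMDiff.comp (contMDiff_snd.mul contMDiff_fst)) 1 x⟩
  map_add' x y := by
    ext g
    exact map_add (mfderiv 𝓘(ℝ, V) 𝓘(ℝ, ℝ) (fun h : G => f (h * g)) 1 : V →L[ℝ] ℝ) x y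
  map_smul' c x := by
    ext g
    exact map_smul (mfderiv 𝓘(ℝ, V) 𝓘(ℝ, ℝ) (fun h : G => f (h * g)) 1 : V →L[ℝ] ℝ) c x

variable (V G)

/-- The multiplication of a Lie group as a smooth map. -/
def mulMap [LieGroup 𝓘(ℝ, V) ∞ G] : C^∞⟮𝓘(ℝ, V).prod 𝓘(ℝ, V), G × G; 𝓘(ℝ, V), G⟯ :=
  ⟨fun p => p.1 * p.2, contMDiff_mul 𝓘(ℝ, V) ∞⟩

/-- The inversion of a Lie group as a smooth map. -/
def invMap [LieGroup 𝓘(ℝ, V) ∞ G] : C^∞⟮𝓘(ℝ, V), G; 𝓘(ℝ, V), G⟯ :=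
  ⟨fun g => g⁻¹, contMDiff_inv 𝓘(ℝ, V) ∞⟩

end LieGroups

/-! ### Lie group crossed modules -/

/-- A crossed module of Lie groups: a target homomorphism `τ : E → G` and an action `μ` of `G` on
`E` by automorphisms, both smooth, which satisfy equivariance and the Peiffer identity. -/
structure LieCrossedModule
    (VE : Type u) [NormedAddCommGroup VE] [NormedSpace ℝ VE]
    (E : Type u) [TopologicalSpace E] [ChartedSpace VE E] [Group E]
    (VG : Type u) [NormedAddCommGroup VG] [NormedSpace ℝ VG]
    (G : Type u) [TopologicalSpace G] [ChartedSpace VG G] [Group G] where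
  τ : E →* G
  smooth_τ : ContMDiff 𝓘(ℝ, VE) 𝓘(ℝ, VG) ∞ τ
  μ : G →* MulAut E
  smooth_μ : ContMDiff (𝓘(ℝ, VG).prod 𝓘(ℝ, VE)) 𝓘(ℝ, VE) ∞ (fun p : G × E => μ p.1 p.2)
  equivariant : ∀ g e, τ (μ g e) = g * τ e * g⁻¹
  peiffer : ∀ e e', μ (τ e) e' = e * e' * e⁻¹

namespace LieCrossedModule

variable {VE : Type u} [NormedAddCommGroup VE] [NormedSpace ℝ VE]
  {E : Type u} [TopologicalSpace E] [ChartedSpace VE E] [Group E] [LieGroup 𝓘(ℝ, VE) ∞ E]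
  {VG : Type u} [NormedAddCommGroup VG] [NormedSpace ℝ VG]
  {G : Type u} [TopologicalSpace G] [ChartedSpace VG G] [Group G] [LieGroup 𝓘(ℝ, VG) ∞ G]
  (M : LieCrossedModule VE E VG G)

/-- The derivative of `τ` at `1`. -/
def dτ : LieAlg VE E →ₗ[ℝ] LieAlg VG G :=
  derivOne M.τ

theorem contMDiff_dμ (X : LieAlg VE E) :
    ContMDiff 𝓘(ℝ, VG) 𝓘(ℝ, VE) ∞
      (fun g : G => (mfderiv 𝓘(ℝ, VE) 𝓘(ℝ, VE) (fun e : E => M.μ g e) 1 : VE →L[ℝ] VE) X) :=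
  contMDiff_partial_of_const (I := 𝓘(ℝ, VG)) (J := 𝓘(ℝ, VE)) (K := 𝓘(ℝ, VE))
    (fun (g : G) (e : E) => M.μ g e) M.smooth_μ 1 1 (by simp) X

variable [FiniteDimensional ℝ VE]

/-- The action of `G` on the Lie algebra of `E`: the derivative at `1` of `μ g`. -/
def dμ : EndMap VG G (LieAlg VE E) where
  toFun g := derivOne (fun e : E => M.μ g e)
  smooth ℓ X :=
    (contMDiff_linearForm VE E ℓ).comp (M.contMDiff_dμ X)

/-- The smooth function `g ↦ dμ g X`. -/
def dμAt (X : LieAlg VE E) : G → VE := fun g => M.dμ.toFun g X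

theorem mdifferentiableAt_dμAt (X : LieAlg VE E) (g : G) :
    MDifferentiableAt 𝓘(ℝ, VG) 𝓘(ℝ, VE) (M.dμAt X) g :=
  (M.contMDiff_dμ X).mdifferentiable (by simp) g

/-- The action of the Lie algebra of `G` on the Lie algebra of `E`: the derivative at `1`, in the
direction `x`, of `g ↦ dμ g X`. -/
def ddμ : LieAlg VG G →ₗ[ℝ] LieAlg VE E →ₗ[ℝ] LieAlg VE E :=
  LinearMap.mk₂ ℝ
    (fun x X => (mfderiv 𝓘(ℝ, VG) 𝓘(ℝ, VE) (M.dμAt X) 1 : VG →L[ℝ] VE) x)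
    (fun x y X => map_add (mfderiv 𝓘(ℝ, VG) 𝓘(ℝ, VE) (M.dμAt X) 1 : VG →L[ℝ] VE) x y)
    (fun c x X => map_smul (mfderiv 𝓘(ℝ, VG) 𝓘(ℝ, VE) (M.dμAt X) 1 : VG →L[ℝ] VE) c x)
    (fun x X Y => by
      have e : M.dμAt (X + Y) = M.dμAt X + M.dμAt Y := by
        funext g
        exact map_add (M.dμ.toFun g) X Y
      rw [e]
      exact congrArg (fun L : VG →L[ℝ] VE => L x) ((M.mdifferentiableAt_dμAt X 1).hasMFDerivAt.add
        (M.mdifferentiableAt_dμAt Y 1).hasMFDerivAt).mfderiv)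
    (fun c x X => by
      have e : M.dμAt (c • X) = c • M.dμAt X := by
        funext g
        exact map_smul (M.dμ.toFun g) c X
      rw [e]
      exact congrArg (fun L : VG →L[ℝ] VE => L x)
        ((M.mdifferentiableAt_dμAt X 1).hasMFDerivAt.const_smul c).mfderiv)

end LieCrossedModule

/-! ### Points of a graded algebra and algebras of functions -/

section Points

variable {VX HX X VY HY Y : Type u}
  [NormedAddCommGroup VX] [NormedSpace ℝ VX] [TopologicalSpace HX] [TopologicalSpace X]
  [ChartedSpace HX X]
  [NormedAddCommGroup VY] [NormedSpace ℝ VY] [TopologicalSpace HY] [TopologicalSpace Y]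
  [ChartedSpace HY Y]
  {A : Type v} [Ring A] [Algebra ℝ A] (𝒜 : ℤ → Submodule ℝ A)

/-- The `X`-valued functions on the graded space with algebra of functions `A`, for an ordinary
manifold `X`: such a function is the algebra homomorphism by which it pulls back the smooth
functions on `X` to functions of degree `0`. -/
def Point (I : ModelWithCorners ℝ VX HX) (X : Type u) [TopologicalSpace X] [ChartedSpace HX X] :
    Type (max u v) :=
  {Ψ : C^∞⟮I, X; ℝ⟯ →ₐ[ℝ] A // ∀ f, Ψ f ∈ 𝒜 0}

variable {𝒜} {I : ModelWithCorners ℝ VX HX} {J : ModelWithCorners ℝ VY HY}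

/-- The composition of an `X`-valued function with a smooth map `X → Y`. -/
def Point.map (φ : C^∞⟮I, X; J, Y⟯) (Ψ : Point 𝒜 I X) : Point 𝒜 J Y :=
  ⟨Ψ.1.comp (pull φ), fun f => Ψ.2 (pull φ f)⟩

/-- The constant function with value `x`. -/
def Point.const [GradedAlgebra 𝒜] (x : X) : Point 𝒜 I X :=
  ⟨{ toFun := fun f => algebraMap ℝ A (f x)
     map_one' := map_one _
     map_mul' := fun f g => map_mul (algebraMap ℝ A) (f x) (g x)
     map_zero' := map_zero _
     map_add' := fun f g => map_add (algebraMap ℝ A) (f x) (g x)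
     commutes' := fun _ => rfl },
    fun f => SetLike.algebraMap_mem_graded 𝒜 (f x)⟩

/-- A vector field of degree `p` along the `X`-valued function `Ψ`: a derivation along `Ψ` of the
smooth functions on `X` with values in the functions of degree `p`. -/
structure IsFieldAlong (Ψ : Point 𝒜 I X) (p : ℤ) (δ : C^∞⟮I, X; ℝ⟯ →ₗ[ℝ] A) : Prop where
  mem : ∀ f, δ f ∈ 𝒜 p
  leibniz : ∀ f g, δ (f * g) = Ψ.1 f * δ g + Ψ.1 g * δ f

end Points

/-- The graded algebra `A` is graded commutative and behaves as the algebra of functions on a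
graded space `N` as far as maps from `N` to ordinary manifolds are concerned: a map from `N` to a
product `X × Y` is the same as a pair of maps to `X` and to `Y`, and a vector field along a map
from `N` to `X × Y` is the same as a pair of vector fields along its two components. -/
structure IsFunctionAlgebra {A : Type v} [Ring A] [Algebra ℝ A] (𝒜 : ℤ → Submodule ℝ A) :
    Prop where
  graded_comm : ∀ {p q : ℤ} {a b : A}, a ∈ 𝒜 p → b ∈ 𝒜 q →
    a * b = (p * q).negOnePow • (b * a)
  point_prod : ∀ {VX HX X VY HY Y : Type u}
    [NormedAddCommGroup VX] [NormedSpace ℝ VX] [FiniteDimensional ℝ VX] [TopologicalSpace HX]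
    [TopologicalSpace X] [ChartedSpace HX X] [T2Space X] [SecondCountableTopology X]
    [NormedAddCommGroup VY] [NormedSpace ℝ VY] [FiniteDimensional ℝ VY] [TopologicalSpace HY]
    [TopologicalSpace Y] [ChartedSpace HY Y] [T2Space Y] [SecondCountableTopology Y]
    (I : ModelWithCorners ℝ VX HX) (J : ModelWithCorners ℝ VY HY)
    [I.Boundaryless] [J.Boundaryless] [IsManifold I ∞ X] [IsManifold J ∞ Y]
    (Ψ : Point 𝒜 I X) (Φ : Point 𝒜 J Y),
    ∃! χ : Point 𝒜 (I.prod J) (X × Y),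
      χ.map ContMDiffMap.fst = Ψ ∧ χ.map ContMDiffMap.snd = Φ
  field_prod : ∀ {VX HX X VY HY Y : Type u}
    [NormedAddCommGroup VX] [NormedSpace ℝ VX] [FiniteDimensional ℝ VX] [TopologicalSpace HX]
    [TopologicalSpace X] [ChartedSpace HX X] [T2Space X] [SecondCountableTopology X]
    [NormedAddCommGroup VY] [NormedSpace ℝ VY] [FiniteDimensional ℝ VY] [TopologicalSpace HY]
    [TopologicalSpace Y] [ChartedSpace HY Y] [T2Space Y] [SecondCountableTopology Y]
    (I : ModelWithCorners ℝ VX HX) (J : ModelWithCorners ℝ VY HY)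
    [I.Boundaryless] [J.Boundaryless] [IsManifold I ∞ X] [IsManifold J ∞ Y]
    (χ : Point 𝒜 (I.prod J) (X × Y)) (p : ℤ)
    (δ₁ : C^∞⟮I, X; ℝ⟯ →ₗ[ℝ] A) (δ₂ : C^∞⟮J, Y; ℝ⟯ →ₗ[ℝ] A),
    IsFieldAlong (χ.map ContMDiffMap.fst) p δ₁ → IsFieldAlong (χ.map ContMDiffMap.snd) p δ₂ →
    ∃! δ : C^∞⟮I.prod J, X × Y; ℝ⟯ →ₗ[ℝ] A, IsFieldAlong χ p δ ∧
      (∀ f, δ (pull ContMDiffMap.fst f) = δ₁ f) ∧ (∀ f, δ (pull ContMDiffMap.snd f) = δ₂ f)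

/-- A derivation of degree `p` of a graded algebra. -/
structure IsGradedDerivation {A : Type v} [Ring A] [Algebra ℝ A] (𝒜 : ℤ → Submodule ℝ A)
    (p : ℤ) (D : A →ₗ[ℝ] A) : Prop where
  mem : ∀ {q : ℤ} {a : A}, a ∈ 𝒜 q → D a ∈ 𝒜 (q + p)
  leibniz : ∀ {q : ℤ} {a : A} (b : A), a ∈ 𝒜 q →
    D (a * b) = D a * b + (p * q).negOnePow • (a * D b)

section GroupPoints

variable {V : Type u} [NormedAddCommGroup V] [NormedSpace ℝ V]
  {G : Type u} [TopologicalSpace G] [ChartedSpace V G]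
  {A : Type v} [Ring A] [Algebra ℝ A] {𝒜 : ℤ → Submodule ℝ A}

/-- The pointwise product of two `G`-valued functions. -/
def Point.mul [Group G] [FiniteDimensional ℝ V] [LieGroup 𝓘(ℝ, V) ∞ G] [T2Space G]
    [SecondCountableTopology G] (h𝒜 : IsFunctionAlgebra.{u, v} 𝒜) (Ψ Φ : Point 𝒜 𝓘(ℝ, V) G) :
    Point 𝒜 𝓘(ℝ, V) G :=
  (h𝒜.point_prod 𝓘(ℝ, V) 𝓘(ℝ, V) Ψ Φ).choose.map (mulMap V G)

/-- The pointwise inverse of a `G`-valued function. -/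
def Point.inv [Group G] [LieGroup 𝓘(ℝ, V) ∞ G] (Ψ : Point 𝒜 𝓘(ℝ, V) G) :
    Point 𝒜 𝓘(ℝ, V) G :=
  Ψ.map (invMap V G)

variable {W : Type u} [AddCommGroup W] [Module ℝ W] [FiniteDimensional ℝ W]

/-- The action of a `G`-valued function `g` on the `W`-valued functions through a smooth map `ρ`
from `G` to `End W`, that is, `s ↦ ρ(g) s`, computed by means of the matrix coefficients of `ρ`. -/
def Point.act (Ψ : Point 𝒜 𝓘(ℝ, V) G) (ρ : EndMap V G W) : W ⊗[ℝ] A →ₗ[ℝ] W ⊗[ℝ] A :=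
  TensorProduct.lift (LinearMap.mk₂ ℝ
    (fun w a => ∑ i, Module.finBasis ℝ W i ⊗ₜ[ℝ]
      (Ψ.1 (ρ.coeff ((Module.finBasis ℝ W).coord i) w) * a))
    (fun w w' a => by
      have h : ∀ ℓ : W →ₗ[ℝ] ℝ, ρ.coeff ℓ (w + w') = ρ.coeff ℓ w + ρ.coeff ℓ w' := by
        intro ℓ
        ext g
        exact (congrArg ℓ (map_add (ρ.toFun g) w w')).trans (map_add ℓ _ _)
      simp [h, add_mul, TensorProduct.tmul_add, Finset.sum_add_distrib])
    (fun c w a => by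
      have h : ∀ ℓ : W →ₗ[ℝ] ℝ, ρ.coeff ℓ (c • w) = c • ρ.coeff ℓ w := by
        intro ℓ
        ext g
        exact (congrArg ℓ (map_smul (ρ.toFun g) c w)).trans (map_smul ℓ _ _)
      simp [h, Finset.smul_sum])
    (fun w a a' => by
      simp [mul_add, TensorProduct.tmul_add, Finset.sum_add_distrib])
    (fun c w a => by simp [Finset.smul_sum]))

theorem Point.act_tmul (Ψ : Point 𝒜 𝓘(ℝ, V) G) (ρ : EndMap V G W) (w : W) (a : A) :
    Ψ.act ρ (w ⊗ₜ a) = ∑ i, Module.finBasis ℝ W i ⊗ₜ[ℝ]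
      (Ψ.1 (ρ.coeff ((Module.finBasis ℝ W).coord i) w) * a) := rfl

theorem Point.act_mem_valued [GradedAlgebra 𝒜] (Ψ : Point 𝒜 𝓘(ℝ, V) G) (ρ : EndMap V G W) {p : ℤ}
    {s : W ⊗[ℝ] A} (hs : s ∈ valued W (𝒜 p)) : Ψ.act ρ s ∈ valued W (𝒜 p) := by
  refine valued_induction (P := fun s => Ψ.act ρ s ∈ valued W (𝒜 p)) ?_ ?_ ?_ hs
  · simp
  · intro w a ha
    have h : ∀ f, Ψ.1 f * a ∈ 𝒜 p := fun f => by
      simpa using SetLike.mul_mem_graded (A := 𝒜) (Ψ.2 f) ha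
    rw [Point.act_tmul]
    exact Submodule.sum_mem _ fun i _ => tmul_mem_valued (Module.finBasis ℝ W i)
      (h (ρ.coeff ((Module.finBasis ℝ W).coord i) w))
  · intro s t h1 h2
    rw [map_add]
    exact add_mem h1 h2

/-- The action on `f` of the vector field along `Ψ` which has the right trivialisation `θ`: for
`θ = x ⊗ a`, it is the product of `Ψ (rightDeriv f x)` and `a`. -/
def Point.fieldOf [Group G] [LieGroup 𝓘(ℝ, V) ∞ G] (Ψ : Point 𝒜 𝓘(ℝ, V) G)
    (θ : LieAlg V G ⊗[ℝ] A) (f : C^∞⟮𝓘(ℝ, V), G; ℝ⟯) : A :=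
  TensorProduct.lift
    ((LinearMap.mul ℝ A).comp (Ψ.1.toLinearMap.comp (rightDeriv f))) θ

end GroupPoints

/-! ### Functions with values in the derived Lie algebra and the derived Lie group

The derived Lie algebra of the crossed module is `𝔢[1] ⊕ 𝔤` and its derived Lie group is
`𝔢[1] ⋊ G`. A function of degree `p` with values in the derived Lie algebra is
`s + (-1) ^ p α S`, where `α` is a formal variable of degree `-1` with `α ^ 2 = 0`, which
anticommutes with the elements and derivations of odd degree, `s` is `𝔤`-valued of degree `p` and
`S` is `𝔢`-valued of degree `p + 1`. It is represented by the pair `(s, S)`. A function with values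
in the derived Lie group is `exp (α J) g`, where `g` is `G`-valued and `J` is `𝔢`-valued of degree
`1`. It is represented by `g` and `J`. All the operations below are those which these expressions
dictate. -/

namespace LieCrossedModule

variable {VE : Type u} [NormedAddCommGroup VE] [NormedSpace ℝ VE] [FiniteDimensional ℝ VE]
  {E : Type u} [TopologicalSpace E] [ChartedSpace VE E] [Group E] [LieGroup 𝓘(ℝ, VE) ∞ E]
  {VG : Type u} [NormedAddCommGroup VG] [NormedSpace ℝ VG] [FiniteDimensional ℝ VG]
  {G : Type u} [TopologicalSpace G] [ChartedSpace VG G] [Group G] [LieGroup 𝓘(ℝ, VG) ∞ G]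
  (M : LieCrossedModule VE E VG G)
  {A : Type v} [Ring A] [Algebra ℝ A] (𝒜 : ℤ → Submodule ℝ A)

/-- The functions with values in the derived Lie algebra. -/
abbrev DFun (_M : LieCrossedModule VE E VG G) (A : Type v) [Ring A] [Algebra ℝ A] :
    Type (max u v) :=
  (LieAlg VG G ⊗[ℝ] A) × (LieAlg VE E ⊗[ℝ] A)

/-- The functions of degree `p` with values in the derived Lie algebra. -/
def degreePart (p : ℤ) : Submodule ℝ (M.DFun A) :=
  (valued (LieAlg VG G) (𝒜 p)).prod (valued (LieAlg VE E) (𝒜 (p + 1)))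

/-- The graded Lie bracket of functions of degrees `p` and `q`. -/
def bracket (p q : ℤ) (S T : M.DFun A) : M.DFun A :=
  (extend A (lieBracket VG G) S.1 T.1,
    extend A M.ddμ S.1 T.2 - (p * q).negOnePow • extend A M.ddμ T.1 S.2)

/-- The derivative of `τ` on the values of `𝔢`-valued functions. -/
def onTau : LieAlg VE E ⊗[ℝ] A →ₗ[ℝ] LieAlg VG G ⊗[ℝ] A :=
  TensorProduct.map M.dτ LinearMap.id

/-- The coboundary of functions of degree `p`, namely `τ` composed with the derivative with respect
to the variable `α`. -/
def cobd (p : ℤ) (S : M.DFun A) : M.DFun A := (p.negOnePow • M.onTau S.2, 0)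

/-- A linear map of coefficients applied to a function with values in the derived Lie algebra. -/
def onDFun (D : A →ₗ[ℝ] A) (S : M.DFun A) : M.DFun A :=
  (onValues (LieAlg VG G) D S.1, onValues (LieAlg VE E) D S.2)

/-- The elements of degree `0` of the derived Lie algebra with coefficients in a subalgebra `C`. -/
def constants (C : Subalgebra ℝ A) : Submodule ℝ (M.DFun A) :=
  (valued (LieAlg VG G) (Subalgebra.toSubmodule C ⊓ 𝒜 0)).prod
    (valued (LieAlg VE E) (Subalgebra.toSubmodule C ⊓ 𝒜 1))

variable {𝒜}

theorem bracket_mem_constants [GradedAlgebra 𝒜] {C : Subalgebra ℝ A} {Z W : M.DFun A}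
    (hZ : Z ∈ M.constants 𝒜 C) (hW : W ∈ M.constants 𝒜 C) :
    M.bracket 0 0 Z W ∈ M.constants 𝒜 C := by
  have h0 : ∀ p : ℤ, ∀ a ∈ Subalgebra.toSubmodule C ⊓ 𝒜 0, ∀ b ∈ Subalgebra.toSubmodule C ⊓ 𝒜 p,
      a * b ∈ Subalgebra.toSubmodule C ⊓ 𝒜 p := fun p a ha b hb =>
    ⟨C.mul_mem ha.1 hb.1, by simpa using SetLike.mul_mem_graded (A := 𝒜) ha.2 hb.2⟩
  refine ⟨extend_mem_valued _ (h0 0) hZ.1 hW.1, ?_⟩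
  have h1 := extend_mem_valued M.ddμ (h0 1) hZ.1 hW.2
  have h2 := extend_mem_valued M.ddμ (h0 1) hW.1 hZ.2
  simpa [bracket] using sub_mem h1 h2

/-- The Lie bracket of constant elements of degree `0` of the derived Lie algebra. -/
def constBracket [GradedAlgebra 𝒜] {C : Subalgebra ℝ A} (Z W : M.constants 𝒜 C) :
    M.constants 𝒜 C :=
  ⟨M.bracket 0 0 Z W, M.bracket_mem_constants Z.2 W.2⟩

variable (𝒜) in
/-- The functions `exp (α J) g` with values in the derived Lie group. -/
@[ext]
structure DPoint (M : LieCrossedModule VE E VG G) where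
  g : Point 𝒜 𝓘(ℝ, VG) G
  J : LieAlg VE E ⊗[ℝ] A
  J_mem : J ∈ valued (LieAlg VE E) (𝒜 1)

namespace DPoint

variable {M}

/-- The product in the derived Lie group:
`exp (α J) g · exp (α J') g' = exp (α (J + dμ(g) J')) (g g')`. -/
def mul [GradedAlgebra 𝒜] [T2Space G] [SecondCountableTopology G]
    (h𝒜 : IsFunctionAlgebra.{u, v} 𝒜) (Ψ Φ : DPoint 𝒜 M) : DPoint 𝒜 M where
  g := Ψ.g.mul h𝒜 Φ.g
  J := Ψ.J + Ψ.g.act M.dμ Φ.J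
  J_mem := add_mem Ψ.J_mem (Ψ.g.act_mem_valued M.dμ Φ.J_mem)

variable (𝒜 M) in
/-- The constant function with value the unit of the derived Lie group. -/
def one [GradedAlgebra 𝒜] : DPoint 𝒜 M where
  g := Point.const 1
  J := 0
  J_mem := zero_mem _

/-- The inverse in the derived Lie group. -/
def inv [GradedAlgebra 𝒜] (Ψ : DPoint 𝒜 M) : DPoint 𝒜 M where
  g := Ψ.g.inv
  J := -Ψ.g.inv.act M.dμ Ψ.J
  J_mem := neg_mem (Ψ.g.inv.act_mem_valued M.dμ Ψ.J_mem)

/-- The adjoint action of the derived Lie group on functions with values in the derived Lie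
algebra. -/
def Ad (Ψ : DPoint 𝒜 M) (S : M.DFun A) : M.DFun A :=
  (Ψ.g.act adjoint S.1,
    Ψ.g.act M.dμ S.2 - extend A M.ddμ (Ψ.g.act adjoint S.1) Ψ.J)

/-- `Ψ.HasLogDeriv D S` says that `D Ψ Ψ⁻¹ = S` for a graded derivation `D`: the right logarithmic
derivative `D g g⁻¹` is the first component `s` of `S`, which means that
`D (f ∘ g)` is the contraction of `s` with the derivatives of `f` along the right invariant vector
fields, and `D J - ddμ(s, J)` is the second one. -/
def HasLogDeriv (Ψ : DPoint 𝒜 M) (D : A →ₗ[ℝ] A) (S : M.DFun A) : Prop :=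
  (∀ f, D (Ψ.g.1 f) = Ψ.g.fieldOf S.1 f) ∧
    S.2 = onValues (LieAlg VE E) D Ψ.J - extend A M.ddμ S.1 Ψ.J

/-- The logarithmic derivative of `Ψ` with respect to the coboundary, a function of degree `1`. In
terms of `α` it is `τ J + α [J, J] / 2`. -/
def cobdLog (Ψ : DPoint 𝒜 M) : M.DFun A :=
  (M.onTau Ψ.J, -((1 / 2 : ℝ) • extend A (lieBracket VE E) Ψ.J Ψ.J))

end DPoint

end LieCrossedModule

/-! ### Operations, 2-connections and 1-gauge transformations -/

section Operations

variable {VE : Type u} [NormedAddCommGroup VE] [NormedSpace ℝ VE] [FiniteDimensional ℝ VE]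
  {E : Type u} [TopologicalSpace E] [ChartedSpace VE E] [Group E] [LieGroup 𝓘(ℝ, VE) ∞ E]
  {VG : Type u} [NormedAddCommGroup VG] [NormedSpace ℝ VG] [FiniteDimensional ℝ VG]
  {G : Type u} [TopologicalSpace G] [ChartedSpace VG G] [Group G] [LieGroup 𝓘(ℝ, VG) ∞ G]
  {A : Type v} [Ring A] [Algebra ℝ A]

/-- An operation of the derived Lie group of the crossed module `M` with function algebra `A`, such
as the operation with the internal functions on `T[1]P` as function algebra, for a space `P` with
a right action of the derived Lie group.

It consists of the subalgebra `const` of the internal constants, of the de Rham differential `d`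
and of the contractions `j Z` and the Lie derivatives `l Z` along the vertical vector fields, where
`Z` runs through the constant functions with values in the derived Lie algebra. They are graded
derivations of degrees `1`, `-1`, `0`, vanish on constants, and obey the six Cartan relations. -/
structure Operation (M : LieCrossedModule VE E VG G) (𝒜 : ℤ → Submodule ℝ A)
    [GradedAlgebra 𝒜] where
  isFunctionAlgebra : IsFunctionAlgebra.{u, v} 𝒜
  const : Subalgebra ℝ A
  d : A →ₗ[ℝ] A
  j : M.constants 𝒜 const →ₗ[ℝ] A →ₗ[ℝ] A
  l : M.constants 𝒜 const →ₗ[ℝ] A →ₗ[ℝ] A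
  derivation_d : IsGradedDerivation 𝒜 1 d
  derivation_j : ∀ Z, IsGradedDerivation 𝒜 (-1) (j Z)
  derivation_l : ∀ Z, IsGradedDerivation 𝒜 0 (l Z)
  d_const : ∀ c ∈ const, d c = 0
  j_const : ∀ Z, ∀ c ∈ const, j Z c = 0
  l_const : ∀ Z, ∀ c ∈ const, l Z c = 0
  d_d : ∀ a, d (d a) = 0
  d_j : ∀ Z a, d (j Z a) + j Z (d a) = l Z a
  d_l : ∀ Z a, d (l Z a) - l Z (d a) = 0
  j_j : ∀ Z W a, j Z (j W a) + j W (j Z a) = 0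
  l_j : ∀ Z W a, l Z (j W a) - j W (l Z a) = j (M.constBracket Z W) a
  l_l : ∀ Z W a, l Z (l W a) - l W (l Z a) = l (M.constBracket Z W) a

variable {M : LieCrossedModule VE E VG G} {𝒜 : ℤ → Submodule ℝ A} [GradedAlgebra 𝒜]

/-- `B₁` and `B₂` are the connection and the curvature component of a 2-connection. -/
structure IsTwoConnection (O : Operation M 𝒜) (B₁ B₂ : M.DFun A) : Prop where
  conn_mem : B₁ ∈ M.degreePart 𝒜 1
  curv_mem : B₂ ∈ M.degreePart 𝒜 2
  d_conn : M.onDFun O.d B₁ = -((1 / 2 : ℝ) • M.bracket 1 1 B₁ B₁) - M.cobd 1 B₁ + B₂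
  d_curv : M.onDFun O.d B₂ = -M.bracket 1 2 B₁ B₂ - M.cobd 2 B₂
  j_conn : ∀ Z, M.onDFun (O.j Z) B₁ = Z
  j_curv : ∀ Z, M.onDFun (O.j Z) B₂ = 0
  l_conn : ∀ Z, M.onDFun (O.l Z) B₁ = -M.bracket 0 1 Z B₁ + M.cobd 0 Z
  l_curv : ∀ Z, M.onDFun (O.l Z) B₂ = -M.bracket 0 2 Z B₂

/-- `Ψ` and `Υ` are the transformation and the shift component of a 1-gauge transformation. -/
structure IsOneGauge (O : Operation M 𝒜) (Ψ : M.DPoint 𝒜) (Υ : M.DFun A) : Prop where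
  shift_mem : Υ ∈ M.degreePart 𝒜 1
  d_trans : Ψ.HasLogDeriv O.d (-Ψ.cobdLog - Υ)
  d_shift : M.onDFun O.d Υ = -((1 / 2 : ℝ) • M.bracket 1 1 Υ Υ) - M.cobd 1 Υ
  j_trans : ∀ Z, Ψ.HasLogDeriv (O.j Z) 0
  j_shift : ∀ Z, M.onDFun (O.j Z) Υ = Z - Ψ.Ad Z
  l_trans : ∀ Z : M.constants 𝒜 O.const, Ψ.HasLogDeriv (O.l Z) (-Z + Ψ.Ad Z)
  l_shift : ∀ Z, M.onDFun (O.l Z) Υ = -M.bracket 0 1 Z Υ + M.cobd 0 Z - Ψ.Ad (M.cobd 0 Z)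

/-- The 2-connections of an operation. -/
structure TwoConnection (O : Operation M 𝒜) where
  conn : M.DFun A
  curv : M.DFun A
  isTwoConnection : IsTwoConnection O conn curv

/-- A 2-connection is flat if its curvature component vanishes. -/
def TwoConnection.IsFlat {O : Operation M 𝒜} (B : TwoConnection O) : Prop := B.curv = 0

/-- The 1-gauge transformations of an operation. -/
structure OneGauge (O : Operation M 𝒜) where
  trans : M.DPoint 𝒜
  shift : M.DFun A
  isOneGauge : IsOneGauge O trans shift

end Operations

end TwoGauge

end

/-!
The proof has two layers: identities for functions with values in the derived Lie algebra `𝔢[1] ⊕ 𝔤`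
and the derived Lie group `𝔢[1] ⋊ G`, and a formal computation in which only these identities enter.

The formal layer rests on four facts about `Ad Ψ`, for a function `Ψ` with values in the derived
Lie group. It is a morphism of graded Lie brackets (`DPoint.Ad_bracket`). A derivation `D` obeys
`D (Ad Ψ S) = Ad Ψ (D S) + [D Ψ Ψ⁻¹, Ad Ψ S]` (`DPoint.onDFun_Ad`), and so does the coboundary
(`DPoint.cobd_Ad`). Finally, logarithmic derivatives form a cocycle,
`D (Ψ Φ) (Ψ Φ)⁻¹ = D Ψ Ψ⁻¹ + Ad Ψ (D Φ Φ⁻¹)`, and the same holds for the coboundary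
(`DPoint.HasLogDeriv.mul`, `DPoint.cobdLog_mul`). The structure equations say that `Υ` is minus the
logarithmic derivative of `Ψ` with respect to `d + d_τ`, so that `A ↦ Ad Ψ A + Υ` is the usual gauge
transformation for this differential; `IsOneGauge.d_transform` is the computation which shows that
the first structure equation is preserved. With `B = 0` it gives also the equation for the shift
component of a product. The contraction and Lie derivative equations follow in the same way.

The logarithmic derivative of a `G`-valued function determines its right trivialisation
(`Point.eq_zero_of_fieldOf_eq_zero`). Thus `Ψ` determines `Υ`, and the group laws for 1-gauge
transformations reduce to those of the derived Lie group.

A `G`-valued function is an algebra homomorphism `C^∞(G) → A` without points at which to evaluate,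
so each identity of the first layer is first proved on `G` and then carried over. Identities between
matrix coefficients on `G` or `G × G` are carried over by applying the homomorphism
(`Point.act_extend`, `Point.act_map`, `Point.act_mul`). The cocycle rule for logarithmic derivatives
compares two vector fields along a `G × G`-valued function; these agree since they have the same
components, and the fields are built from the two left translations of `G × G`
(`Point.logDeriv_mul`). On `G` itself the necessary input is that the derivative at `1` of the
adjoint action is the Lie bracket defined by invariant vector fields (`der_Ad`), which in a chart is
a statement about mixed second derivatives (`fderiv_fderiv_conj`). From it and from equivariance and
the Peiffer identity, differentiation gives all the identities of the crossed module of Lie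
algebras.
-/

set_option linter.unusedSectionVars false

noncomputable section

namespace TwoGauge

/-! ### Mixed second derivatives of a product and of its conjugation -/

section Calculus

variable {V W : Type*} [NormedAddCommGroup V] [NormedSpace ℝ V] [NormedAddCommGroup W]
  [NormedSpace ℝ W]

open Topology

/-- Iterated partial derivatives are values of the second derivative. -/
theorem fderiv_fderiv_partial {f : V × V → W} {e : V} (hf : ContDiffAt ℝ 2 f (e, e)) (x y : V) :
    fderiv ℝ (fun a => fderiv ℝ (fun b => f (a, b)) e y) e x =
      fderiv ℝ (fderiv ℝ f) (e, e) (x, 0) (0, y) := by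
  have h1 : ∀ᶠ p in 𝓝 (e, e), ContDiffAt ℝ 2 f p := hf.eventually (by simp)
  have hc : Filter.Tendsto (fun a : V => (a, e)) (𝓝 e) (𝓝 (e, e)) :=
    (Continuous.prodMk_left e).tendsto e
  have h2 : (fun a => fderiv ℝ (fun b => f (a, b)) e y) =ᶠ[𝓝 e]
      fun a => fderiv ℝ f (a, e) (0, y) := by
    filter_upwards [hc.eventually h1] with a ha
    have h : HasFDerivAt (fun b => f (a, b)) ((fderiv ℝ f (a, e)).comp
        (ContinuousLinearMap.inr ℝ V V)) e :=
      (ha.differentiableAt (by simp)).hasFDerivAt.comp e (hasFDerivAt_prodMk_right a e)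
    rw [h.fderiv]; simp
  have h3 : DifferentiableAt ℝ (fderiv ℝ f) (e, e) :=
    (hf.fderiv_right (m := 1) (by norm_num)).differentiableAt (by simp)
  have h4 : HasFDerivAt (fun a => fderiv ℝ f (a, e)) ((fderiv ℝ (fderiv ℝ f) (e, e)).comp
      (ContinuousLinearMap.inl ℝ V V)) e :=
    h3.hasFDerivAt.comp (f := fun a : V => (a, e)) e
      (hasFDerivAt_prodMk_left e e)
  rw [h2.fderiv_eq, (h4.clm_apply (hasFDerivAt_const (0, y) e)).fderiv]
  simp

/-- If `m` is a product with unit `e` and `c` is the conjugation, both in coordinates, then the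
mixed derivative of `c` is the antisymmetrisation of the one of `m`. This comes from
differentiating `m (c (a, b), a) = m (a, b)` twice. -/
theorem fderiv_fderiv_conj {m c : V × V → V} {e : V} (hm : ContDiffAt ℝ 2 m (e, e))
    (hc : ContDiffAt ℝ 2 c (e, e)) (hmc : ∀ᶠ p in 𝓝 (e, e), m (c p, p.1) = m p)
    (hmr : ∀ᶠ a in 𝓝 e, m (a, e) = a) (hcr : ∀ᶠ a in 𝓝 e, c (a, e) = e)
    (hcl : ∀ᶠ b in 𝓝 e, c (e, b) = b) (x y : V) :
    fderiv ℝ (fun a => fderiv ℝ (fun b => c (a, b)) e y) e x =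
      fderiv ℝ (fun a => fderiv ℝ (fun b => m (a, b)) e y) e x -
        fderiv ℝ (fun a => fderiv ℝ (fun b => m (a, b)) e x) e y := by
  rw [fderiv_fderiv_partial hm, fderiv_fderiv_partial hm, fderiv_fderiv_partial hc]
  have hsymm : IsSymmSndFDerivAt ℝ m (e, e) := hm.isSymmSndFDerivAt (by simp)
  have hcee : c (e, e) = e := hcr.self_of_nhds
  let ψ : V × V → V × V := fun p => (c p, p.1)
  have hψe : ψ (e, e) = (e, e) := by simp [ψ, hcee]
  have hψ : ContDiffAt ℝ 2 ψ (e, e) := hc.prodMk contDiffAt_fst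
  have hψm : ContDiffAt ℝ 2 m (ψ (e, e)) := by rw [hψe]; exact hm
  have e1 : fderiv ℝ m =ᶠ[𝓝 (e, e)] fun p => (fderiv ℝ m (ψ p)).comp (fderiv ℝ ψ p) := by
    have h1 : ∀ᶠ p in 𝓝 (e, e), ContDiffAt ℝ 2 m (ψ p) :=
      hψ.continuousAt.eventually (hψm.eventually (by simp))
    have h2 : ∀ᶠ p in 𝓝 (e, e), ContDiffAt ℝ 2 ψ p := hψ.eventually (by simp)
    filter_upwards [h1, h2, hmc.eventually_nhds] with p hp1 hp2 hp3
    have : fderiv ℝ m p = fderiv ℝ (m ∘ ψ) p :=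
      Filter.EventuallyEq.fderiv_eq (hp3.mono fun q hq => hq.symm)
    rw [this, fderiv_comp p (hp1.differentiableAt (by simp)) (hp2.differentiableAt (by simp))]
  have dm : DifferentiableAt ℝ (fderiv ℝ m) (ψ (e, e)) :=
    (hψm.fderiv_right (m := 1) (by norm_num)).differentiableAt (by simp)
  have dψ : DifferentiableAt ℝ (fderiv ℝ ψ) (e, e) :=
    (hψ.fderiv_right (m := 1) (by norm_num)).differentiableAt (by simp)
  have dc : DifferentiableAt ℝ (fderiv ℝ c) (e, e) :=
    (hc.fderiv_right (m := 1) (by norm_num)).differentiableAt (by simp)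
  have hD := (dm.hasFDerivAt.comp (e, e) (hψ.differentiableAt (by simp)).hasFDerivAt).clm_comp
    dψ.hasFDerivAt
  have e2 := (e1.fderiv_eq).trans hD.fderiv
  have ψ1 : ∀ p, ContDiffAt ℝ 2 c p →
      fderiv ℝ ψ p = (fderiv ℝ c p).prod (ContinuousLinearMap.fst ℝ V V) := fun p hp =>
    ((hp.differentiableAt (by simp)).hasFDerivAt.prodMk hasFDerivAt_fst).fderiv
  have ψ2 : fderiv ℝ (fderiv ℝ ψ) (e, e) (x, 0) (0, y) =
      (fderiv ℝ (fderiv ℝ c) (e, e) (x, 0) (0, y), 0) := by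
    have h1 : (fun p => fderiv ℝ ψ p (0, y)) =ᶠ[𝓝 (e, e)] fun p => (fderiv ℝ c p (0, y), 0) := by
      filter_upwards [hc.eventually (by simp)] with p hp
      rw [ψ1 p hp]; simp
    have h2 := (dψ.hasFDerivAt.clm_apply (hasFDerivAt_const (0, y) (e, e))).fderiv
    have h3 := ((dc.hasFDerivAt.clm_apply (hasFDerivAt_const (0, y) (e, e))).prodMk
      (hasFDerivAt_const (0 : V) (e, e))).fderiv
    have h4 := congrArg (fun L => L (x, 0)) ((h2.symm.trans h1.fderiv_eq).trans h3)
    simpa using h4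
  have c1 : fderiv ℝ c (e, e) (x, 0) = 0 := by
    have h : HasFDerivAt (fun a => c (a, e)) ((fderiv ℝ c (e, e)).comp
        (ContinuousLinearMap.inl ℝ V V)) e :=
      (hc.differentiableAt (by simp)).hasFDerivAt.comp (f := fun a : V => (a, e)) e
      (hasFDerivAt_prodMk_left e e)
    have h' := h.fderiv.symm.trans
      (Filter.EventuallyEq.fderiv_eq (f₁ := fun a => c (a, e)) (f := fun _ => e) hcr)
    simpa using congrArg (fun L => L x) h'
  have c2 : fderiv ℝ c (e, e) (0, y) = y := by
    have h : HasFDerivAt (fun b => c (e, b)) ((fderiv ℝ c (e, e)).comp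
        (ContinuousLinearMap.inr ℝ V V)) e :=
      (hc.differentiableAt (by simp)).hasFDerivAt.comp e (hasFDerivAt_prodMk_right e e)
    have h' := h.fderiv.symm.trans
      (Filter.EventuallyEq.fderiv_eq (f₁ := fun b => c (e, b)) (f := fun b => b) hcl)
    simpa using congrArg (fun L => L y) h'
  have m1 : ∀ w, fderiv ℝ m (e, e) (w, 0) = w := by
    intro w
    have h : HasFDerivAt (fun a => m (a, e)) ((fderiv ℝ m (e, e)).comp
        (ContinuousLinearMap.inl ℝ V V)) e :=
      (hm.differentiableAt (by simp)).hasFDerivAt.comp (f := fun a : V => (a, e)) e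
      (hasFDerivAt_prodMk_left e e)
    have h' := h.fderiv.symm.trans
      (Filter.EventuallyEq.fderiv_eq (f₁ := fun a => m (a, e)) (f := fun a => a) hmr)
    simpa using congrArg (fun L => L w) h'
  have e3 := congrArg (fun L => L (x, 0) (0, y)) e2
  simp only [add_apply, Function.comp_apply, ContinuousLinearMap.comp_apply,
    ContinuousLinearMap.compL_apply, ContinuousLinearMap.flip_apply, hψe, ψ2, m1,
    ψ1 _ hc, ContinuousLinearMap.prod_apply, c1, c2, ContinuousLinearMap.coe_fst'] at e3
  have e4 : fderiv ℝ (fderiv ℝ m) (e, e) (y, 0) (0, x) =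
      fderiv ℝ (fderiv ℝ m) (e, e) (0, x) (y, 0) := hsymm _ _
  rw [e3, e4]
  abel

end Calculus

/-! ### Derivatives of maps between manifolds -/

section Derivative

open Topology

variable {VX HX X VY HY Y VZ HZ Z : Type*}
  [NormedAddCommGroup VX] [NormedSpace ℝ VX] [TopologicalSpace HX] [TopologicalSpace X]
  [ChartedSpace HX X]
  [NormedAddCommGroup VY] [NormedSpace ℝ VY] [TopologicalSpace HY] [TopologicalSpace Y]
  [ChartedSpace HY Y]
  [NormedAddCommGroup VZ] [NormedSpace ℝ VZ] [TopologicalSpace HZ] [TopologicalSpace Z]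
  [ChartedSpace HZ Z]
  (I : ModelWithCorners ℝ VX HX) (J : ModelWithCorners ℝ VY HY) (K : ModelWithCorners ℝ VZ HZ)

/-- The derivative of a map between manifolds, with the tangent spaces identified with the model
vector spaces by the preferred charts. -/
def der (f : X → Y) (x : X) : VX →L[ℝ] VY := mfderiv I J f x

variable {I J K}

theorem der_comp {g : Y → Z} {f : X → Y} {x : X} (hg : MDifferentiableAt J K g (f x))
    (hf : MDifferentiableAt I J f x) (v : VX) :
    der I K (fun x => g (f x)) x v = der J K g (f x) (der I J f x v) :=
  congrArg (fun L : VX →L[ℝ] VZ => L v) (mfderiv_comp x hg hf)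

theorem der_comp_of_eq {g : Y → Z} {f : X → Y} {x : X} {y : Y} (hy : f x = y)
    (hg : MDifferentiableAt J K g y) (hf : MDifferentiableAt I J f x) (v : VX) :
    der I K (fun x => g (f x)) x v = der J K g y (der I J f x v) := by
  subst hy
  exact der_comp hg hf v

theorem der_const (y : Y) (x : X) (v : VX) : der I J (fun _ => y) x v = 0 :=
  congrArg (fun L : VX →L[ℝ] VY => L v) (mfderiv_const (I := I) (I' := J) (c := y) (x := x))

theorem der_id (x : X) (v : VX) : der I I (fun x => x) x v = v :=
  congrArg (fun L : VX →L[ℝ] VX => L v) (mfderiv_id (I := I) (x := x))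

theorem der_congr {f g : X → Y} {x : X} (h : f =ᶠ[𝓝 x] g) (v : VX) :
    der I J f x v = der I J g x v :=
  congrArg (fun L : VX →L[ℝ] VY => L v) h.mfderiv_eq

theorem der_clm (L : VY →L[ℝ] VZ) (y v : VY) : der 𝓘(ℝ, VY) 𝓘(ℝ, VZ) L y v = L v :=
  congrArg (fun L : VY →L[ℝ] VZ => L v) L.mfderiv_eq

theorem der_clm_comp (L : VY →L[ℝ] VZ) {f : X → VY} {x : X}
    (hf : MDifferentiableAt I 𝓘(ℝ, VY) f x) (v : VX) :
    der I 𝓘(ℝ, VZ) (fun x => L (f x)) x v = L (der I 𝓘(ℝ, VY) f x v) :=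
  (der_comp (J := 𝓘(ℝ, VY)) L.mdifferentiableAt hf v).trans (der_clm L _ _)

variable {V G W : Type*} [NormedAddCommGroup V] [NormedSpace ℝ V] [TopologicalSpace G]
  [ChartedSpace V G] [NormedAddCommGroup W] [NormedSpace ℝ W]

/-- `der` is the derivative in the preferred charts, where `y` is a name for `f x` which makes it
possible to keep the chart in the target fixed. -/
theorem der_eq_fderiv_chart {V' G' : Type*} [NormedAddCommGroup V'] [NormedSpace ℝ V']
    [TopologicalSpace G'] [ChartedSpace V' G'] {f : G → G'} {x : G} {y : G'} (hy : f x = y)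
    (hf : MDifferentiableAt 𝓘(ℝ, V) 𝓘(ℝ, V') f x) :
    der 𝓘(ℝ, V) 𝓘(ℝ, V') f x = fderiv ℝ (fun a => extChartAt 𝓘(ℝ, V') y
      (f ((extChartAt 𝓘(ℝ, V) x).symm a))) (extChartAt 𝓘(ℝ, V) x x) := by
  subst hy
  have h : der 𝓘(ℝ, V) 𝓘(ℝ, V') f x = fderivWithin ℝ (writtenInExtChartAt 𝓘(ℝ, V) 𝓘(ℝ, V') x f)
      (Set.range 𝓘(ℝ, V)) (extChartAt 𝓘(ℝ, V) x x) := if_pos hf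
  rw [h, ModelWithCorners.range_eq_univ, fderivWithin_univ]
  rfl

theorem hasFDerivAt_der {f : G → W} {x : G} (hf : MDifferentiableAt 𝓘(ℝ, V) 𝓘(ℝ, W) f x) :
    HasFDerivAt (fun a => f ((extChartAt 𝓘(ℝ, V) x).symm a)) (der 𝓘(ℝ, V) 𝓘(ℝ, W) f x)
      (extChartAt 𝓘(ℝ, V) x x) := by
  have h : HasFDerivWithinAt (writtenInExtChartAt 𝓘(ℝ, V) 𝓘(ℝ, W) x f)
      (der 𝓘(ℝ, V) 𝓘(ℝ, W) f x) (Set.range 𝓘(ℝ, V)) (extChartAt 𝓘(ℝ, V) x x) :=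
    hf.hasMFDerivAt.2
  rw [ModelWithCorners.range_eq_univ, hasFDerivWithinAt_univ] at h
  exact h

/-- The Leibniz rule for a bilinear map. -/
theorem der_bilin {W₁ W₂ : Type*} [NormedAddCommGroup W₁] [NormedSpace ℝ W₁]
    [NormedAddCommGroup W₂] [NormedSpace ℝ W₂] (B : W₁ →L[ℝ] W₂ →L[ℝ] W) {f : G → W₁} {g : G → W₂}
    {x : G} (hf : MDifferentiableAt 𝓘(ℝ, V) 𝓘(ℝ, W₁) f x)
    (hg : MDifferentiableAt 𝓘(ℝ, V) 𝓘(ℝ, W₂) g x) (v : V) :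
    der 𝓘(ℝ, V) 𝓘(ℝ, W) (fun x => B (f x) (g x)) x v =
      B (der 𝓘(ℝ, V) 𝓘(ℝ, W₁) f x v) (g x) + B (f x) (der 𝓘(ℝ, V) 𝓘(ℝ, W₂) g x v) := by
  have hB : MDifferentiableAt 𝓘(ℝ, V) 𝓘(ℝ, W) (fun x => B (f x) (g x)) x :=
    (B.mdifferentiableAt.comp x hf).clm_apply hg
  have h1 := (hasFDerivAt_der hB).unique (B.hasFDerivAt_of_bilinear (hasFDerivAt_der hf)
    (hasFDerivAt_der hg))
  rw [h1]
  simp [add_comm]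

end Derivative

/-! ### The Lie bracket as the derivative of the adjoint action -/

section Bracket

open Topology

variable {V : Type u} [NormedAddCommGroup V] [NormedSpace ℝ V]
  {G : Type u} [TopologicalSpace G] [ChartedSpace V G] [Group G] [LieGroup 𝓘(ℝ, V) ∞ G]

instance instIsManifoldOne : IsManifold 𝓘(ℝ, V) 1 G := IsManifold.of_le (n := ∞) (by simp)

theorem mdifferentiableAt_conj (g h : G) :
    MDifferentiableAt 𝓘(ℝ, V) 𝓘(ℝ, V) (fun h : G => g * h * g⁻¹) h :=
  (((contMDiff_const.mul contMDiff_id).mul contMDiff_const :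
    ContMDiff 𝓘(ℝ, V) 𝓘(ℝ, V) ∞ (fun h : G => g * h * g⁻¹)).mdifferentiable (by simp)) h

theorem mdifferentiableAt_mul_left (g h : G) :
    MDifferentiableAt 𝓘(ℝ, V) 𝓘(ℝ, V) (fun h : G => g * h) h :=
  ((contMDiff_const.mul contMDiff_id :
    ContMDiff 𝓘(ℝ, V) 𝓘(ℝ, V) ∞ (fun h : G => g * h)).mdifferentiable (by simp)) h

theorem mdifferentiableAt_mul_right (g h : G) :
    MDifferentiableAt 𝓘(ℝ, V) 𝓘(ℝ, V) (fun h : G => h * g) h :=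
  ((contMDiff_id.mul contMDiff_const :
    ContMDiff 𝓘(ℝ, V) 𝓘(ℝ, V) ∞ (fun h : G => h * g)).mdifferentiable (by simp)) h

/-- The adjoint action on the model vector space. -/
def Ad (g : G) : V →L[ℝ] V := der 𝓘(ℝ, V) 𝓘(ℝ, V) (fun h : G => g * h * g⁻¹) 1

theorem mdifferentiableAt_Ad (y : V) (g : G) :
    MDifferentiableAt 𝓘(ℝ, V) 𝓘(ℝ, V) (fun g : G => Ad g y) g :=
  (contMDiff_partial_of_const (I := 𝓘(ℝ, V)) (J := 𝓘(ℝ, V)) (K := 𝓘(ℝ, V))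
      (fun g h : G => g * h * g⁻¹)
      ((contMDiff_fst.mul contMDiff_snd).mul contMDiff_fst.inv) 1 1 (by simp) y).mdifferentiable
    (by simp) g

/-- The derivative of the adjoint action at `1` is the Lie bracket, which is defined by the Lie
bracket of left invariant vector fields. In the preferred chart at `1`, both sides are expressed by
mixed second derivatives at the unit, of the conjugation on the left and of the product on the
right. -/
theorem der_Ad [FiniteDimensional ℝ V] (x y : V) :
    der 𝓘(ℝ, V) 𝓘(ℝ, V) (fun g : G => Ad g y) 1 x = lieBracket V G x y := by
  have : CompleteSpace V := FiniteDimensional.complete ℝ V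
  set φ := extChartAt 𝓘(ℝ, V) (1 : G) with hφ
  set e : V := φ 1 with he
  let m : V × V → V := fun p => φ (φ.symm p.1 * φ.symm p.2)
  let c : V × V → V := fun p => φ (φ.symm p.1 * φ.symm p.2 * (φ.symm p.1)⁻¹)
  have hSe : φ.symm e = 1 := extChartAt_to_inv 1
  have hS : ContMDiffAt 𝓘(ℝ, V) 𝓘(ℝ, V) ∞ φ.symm e :=
    (contMDiffOn_extChartAt_symm (1 : G)).contMDiffAt (extChartAt_target_mem_nhds 1)
  have hS1 : ContMDiffAt 𝓘(ℝ, V × V) 𝓘(ℝ, V) ∞ (fun p : V × V => φ.symm p.1) (e, e) :=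
    ContMDiffAt.comp (I' := 𝓘(ℝ, V)) (f := Prod.fst) (e, e) hS contDiff_fst.contMDiff.contMDiffAt
  have hS2 : ContMDiffAt 𝓘(ℝ, V × V) 𝓘(ℝ, V) ∞ (fun p : V × V => φ.symm p.2) (e, e) :=
    ContMDiffAt.comp (I' := 𝓘(ℝ, V)) (f := Prod.snd) (e, e) hS contDiff_snd.contMDiff.contMDiffAt
  have hφ1 : ContMDiffAt 𝓘(ℝ, V) 𝓘(ℝ, V) ∞ φ 1 := contMDiffAt_extChartAt
  have hmul := hS1.mul hS2
  have hconj := hmul.mul hS1.inv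
  have hm : ContDiffAt ℝ 2 m (e, e) := by
    refine (contMDiffAt_iff_contDiffAt.1 (ContMDiffAt.comp (I' := 𝓘(ℝ, V)) (e, e) (g := φ) ?_
      hmul)).of_le (by exact ENat.LEInfty.out)
    simpa [hSe] using hφ1
  have hc : ContDiffAt ℝ 2 c (e, e) := by
    refine (contMDiffAt_iff_contDiffAt.1 (ContMDiffAt.comp (I' := 𝓘(ℝ, V)) (e, e) (g := φ) ?_
      hconj)).of_le (by exact ENat.LEInfty.out)
    simpa [hSe] using hφ1
  have hright : ∀ᶠ a in 𝓝 e, φ (φ.symm a) = a := by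
    filter_upwards [extChartAt_target_mem_nhds (I := 𝓘(ℝ, V)) (1 : G)] with a ha
    exact φ.right_inv ha
  -- In coordinates, `c (a, b) a = a b` since conjugation by `a` sends `b` to `a b a⁻¹`.
  have key := fderiv_fderiv_conj (m := m) (c := c) hm hc (by
    have h : ∀ᶠ p in 𝓝 (e, e), φ.symm p.1 * φ.symm p.2 * (φ.symm p.1)⁻¹ ∈ φ.source :=
      hconj.continuousAt.eventually (by
        simpa only [Pi.mul_apply, hSe, one_mul, inv_one] using!
          extChartAt_source_mem_nhds (I := 𝓘(ℝ, V)) (1 : G))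
    filter_upwards [h] with p hp
    simp only [m, c, φ.left_inv hp, inv_mul_cancel_right])
    (by simpa [m, hSe] using hright) (by simp [c, ← he, hSe]) (by simpa [c, hSe] using hright) x y
  have hmr : ∀ y : V, fderiv ℝ (fun b => m (e, b)) e y = y := by
    intro y
    have h : (fun b => m (e, b)) =ᶠ[𝓝 e] fun b => b := by
      filter_upwards [hright] with b hb
      simpa [m, hSe] using hb
    rw [h.fderiv_eq]; simp
  have h1 : der 𝓘(ℝ, V) 𝓘(ℝ, V) (fun g : G => Ad g y) 1 x =
      fderiv ℝ (fun a => fderiv ℝ (fun b => c (a, b)) e y) e x := by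
    rw [← (hasFDerivAt_der (mdifferentiableAt_Ad y (1 : G))).fderiv]
    congr 3
    funext a
    rw [Ad, der_eq_fderiv_chart (y := 1) (by simp) (mdifferentiableAt_conj _ _)]
  -- In coordinates, the left invariant vector field of `y` is `a ↦ ∂ₑ m (a, ·) y`.
  have h2 : ∀ y : V, VectorField.mpullbackWithin 𝓘(ℝ, V) 𝓘(ℝ, V) φ.symm
      (mulInvariantVectorField (y : LieAlg V G)) Set.univ =ᶠ[𝓝 e]
      fun a => fderiv ℝ (fun b => m (a, b)) e y := by
    intro y
    filter_upwards [extChartAt_target_mem_nhds (I := 𝓘(ℝ, V)) (1 : G),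
      hS.continuousAt.eventually (extChartAt_source_mem_nhds' (I := 𝓘(ℝ, V)) (x := (1 : G)) (by
        rw [hSe]; exact mem_extChartAt_source _))] with a ha ha'
    have i1 := mfderivWithin_extChartAt_symm_comp_mfderiv_extChartAt ha
    have i2 := mfderiv_extChartAt_comp_mfderivWithin_extChartAt_symm ha
    rw [ModelWithCorners.range_eq_univ] at i1 i2
    have i3 := ContinuousLinearMap.inverse_eq i1 i2
    rw [VectorField.mpullbackWithin_apply, i3]
    have i4 : MDifferentiableAt 𝓘(ℝ, V) 𝓘(ℝ, V) φ (φ.symm a) :=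
      mdifferentiableAt_extChartAt (by rwa [← extChartAt_source 𝓘(ℝ, V)])
    have i5 := der_comp_of_eq (f := fun h => φ.symm a * h) (x := 1) (mul_one _) i4
      (mdifferentiableAt_mul_left _ _) y
    refine i5.symm.trans ?_
    have i6 : MDifferentiableAt 𝓘(ℝ, V) 𝓘(ℝ, V) (fun h => φ (φ.symm a * h)) 1 :=
      MDifferentiableAt.comp (I' := 𝓘(ℝ, V)) (g := φ) (1 : G) (by rw [mul_one]; exact i4)
        (mdifferentiableAt_mul_left _ _)
    rw [← (hasFDerivAt_der i6).fderiv]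
  have h3 : lieBracket V G x y = (der 𝓘(ℝ, V) 𝓘(ℝ, V) φ 1 : V →L[ℝ] V).inverse
      (VectorField.lieBracketWithin ℝ (VectorField.mpullbackWithin 𝓘(ℝ, V) 𝓘(ℝ, V) φ.symm
        (mulInvariantVectorField (x : LieAlg V G)) (Set.range 𝓘(ℝ, V)))
        (VectorField.mpullbackWithin 𝓘(ℝ, V) 𝓘(ℝ, V) φ.symm
        (mulInvariantVectorField (y : LieAlg V G)) (Set.range 𝓘(ℝ, V)))
        (φ.symm ⁻¹' Set.univ ∩ Set.range 𝓘(ℝ, V)) e) := rfl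
  have h4 : der 𝓘(ℝ, V) 𝓘(ℝ, V) φ 1 = ContinuousLinearMap.id ℝ V := mfderiv_extChartAt_self
  rw [h1, key, h3, h4, ContinuousLinearMap.inverse_id, ModelWithCorners.range_eq_univ,
    Set.preimage_univ, Set.univ_inter]
  refine Eq.trans ?_ (congrFun VectorField.lieBracketWithin_univ e).symm
  refine Eq.trans ?_ (Filter.EventuallyEq.lieBracket_vectorField_eq (h2 x) (h2 y)).symm
  rw [VectorField.lieBracket, hmr, hmr]

end Bracket

/-! ### Identities in the Lie algebra of a Lie group -/

open Topology

section LieGroupFacts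

variable {V : Type u} [NormedAddCommGroup V] [NormedSpace ℝ V]
  {G : Type u} [TopologicalSpace G] [ChartedSpace V G] [Group G] [LieGroup 𝓘(ℝ, V) ∞ G]

theorem Ad_mul (g h : G) (y : V) : Ad (g * h) y = Ad g (Ad h y) := by
  have e : (fun k : G => g * h * k * (g * h)⁻¹) = fun k => g * (h * k * h⁻¹) * g⁻¹ := by
    funext k; group
  unfold Ad
  rw [e]
  exact der_comp_of_eq (f := fun k => h * k * h⁻¹) (g := fun k => g * k * g⁻¹) (by simp)
    (mdifferentiableAt_conj g 1) (mdifferentiableAt_conj h 1) y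

theorem Ad_one (y : V) : Ad (1 : G) y = y := by
  have e : (fun k : G => 1 * k * 1⁻¹) = fun k => k := by
    funext k; simp
  unfold Ad
  rw [e]
  exact der_id 1 y

variable (V G) in
/-- The Lie bracket on the model vector space, which avoids mixing the two types `V` and
`LieAlg V G` of the same vectors. -/
def br [FiniteDimensional ℝ V] : V →ₗ[ℝ] V →ₗ[ℝ] V := lieBracket V G

theorem br_skew [FiniteDimensional ℝ V] (x y : V) : br V G x y = -br V G y x :=
  have : CompleteSpace V := FiniteDimensional.complete ℝ V
  (@lie_skew (LieAlg V G) _ x y).symm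

theorem der_Ad_eq_br [FiniteDimensional ℝ V] (x y : V) :
    der 𝓘(ℝ, V) 𝓘(ℝ, V) (fun g : G => Ad g y) 1 x = br V G x y := der_Ad x y

/-- Obtained by differentiating `Ad (g h g⁻¹) (Ad g y) = Ad g (Ad h y)` with respect to `h`. -/
theorem Ad_br [FiniteDimensional ℝ V] (g : G) (x y : V) :
    Ad g (br V G x y) = br V G (Ad g x) (Ad g y) := by
  have e : ∀ h : G, Ad (g * h * g⁻¹) (Ad g y) = Ad g (Ad h y) := fun h => by
    rw [← Ad_mul, ← Ad_mul]; simp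
  have h1 := der_comp_of_eq (I := 𝓘(ℝ, V)) (f := fun h : G => g * h * g⁻¹) (x := 1) (y := 1)
    (by simp) (mdifferentiableAt_Ad (Ad g y) (1 : G)) (mdifferentiableAt_conj g 1) x
  have h2 := der_clm_comp (Ad g) (mdifferentiableAt_Ad y (1 : G)) x
  simp only [e] at h1
  rw [h1, der_Ad_eq_br, der_Ad_eq_br] at h2
  exact h2.symm

theorem mdifferentiableAt_inv (g : G) :
    MDifferentiableAt 𝓘(ℝ, V) 𝓘(ℝ, V) (fun h : G => h⁻¹) g :=
  ((contMDiff_inv 𝓘(ℝ, V) ∞).mdifferentiable (by simp)) g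

/-- Obtained by differentiating `h h⁻¹ = 1`. -/
theorem der_inv_one (x : V) : der 𝓘(ℝ, V) 𝓘(ℝ, V) (fun h : G => h⁻¹) 1 x = -x := by
  have hmul : MDifferentiableAt (𝓘(ℝ, V).prod 𝓘(ℝ, V)) 𝓘(ℝ, V)
      (fun p : G × G => p.1 * p.2) (1, 1) :=
    (contMDiff_mul 𝓘(ℝ, V) ∞).mdifferentiable (by simp) _
  have hf : MDifferentiableAt 𝓘(ℝ, V) (𝓘(ℝ, V).prod 𝓘(ℝ, V)) (fun h : G => (h, h⁻¹)) 1 :=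
    mdifferentiableAt_id.prodMk (mdifferentiableAt_inv 1)
  have h1 := der_comp_of_eq (K := 𝓘(ℝ, V)) (y := ((1 : G), (1 : G))) (by simp) hmul hf x
  have h2 : der 𝓘(ℝ, V) (𝓘(ℝ, V).prod 𝓘(ℝ, V)) (fun h : G => (h, h⁻¹)) 1 x =
      (x, der 𝓘(ℝ, V) 𝓘(ℝ, V) (fun h : G => h⁻¹) 1 x) :=
    (congrArg (fun L : V →L[ℝ] V × V => L x) (mfderiv_prodMk (I := 𝓘(ℝ, V)) (I' := 𝓘(ℝ, V))
      (I'' := 𝓘(ℝ, V)) (mdifferentiableAt_id (x := (1 : G))) (mdifferentiableAt_inv 1))).trans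
      (Prod.ext (der_id (I := 𝓘(ℝ, V)) (1 : G) x) rfl)
  have h3 : ∀ v : V × V, der (𝓘(ℝ, V).prod 𝓘(ℝ, V)) 𝓘(ℝ, V) (fun p : G × G => p.1 * p.2)
      (1, 1) v = der 𝓘(ℝ, V) 𝓘(ℝ, V) (fun h : G => h * 1) 1 v.1 +
        der 𝓘(ℝ, V) 𝓘(ℝ, V) (fun h : G => 1 * h) 1 v.2 := fun v =>
    mfderiv_prod_eq_add_apply (v := v) hmul
  simp only [mul_inv_cancel, der_const] at h1
  rw [h2, h3] at h1
  simp only [mul_one, one_mul, der_id] at h1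
  exact (neg_eq_of_add_eq_zero_right h1.symm).symm

theorem rightDeriv_apply (f : C^∞⟮𝓘(ℝ, V), G; ℝ⟯) (x : V) (g : G) :
    rightDeriv f (x : LieAlg V G) g = der 𝓘(ℝ, V) 𝓘(ℝ, ℝ) (fun h : G => f (h * g)) 1 x := rfl

theorem mdifferentiableAt_translate (f : C^∞⟮𝓘(ℝ, V), G; ℝ⟯) (g h : G) :
    MDifferentiableAt 𝓘(ℝ, V) 𝓘(ℝ, ℝ) (fun h : G => f (h * g)) h :=
  MDifferentiableAt.comp (I' := 𝓘(ℝ, V)) (g := f) h (f.contMDiff.mdifferentiable (by simp) _)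
    (mdifferentiableAt_mul_right g h)

/-- Differentiation in the middle of a product, by `g k h = (g k g⁻¹) (g h)`. -/
theorem der_middle (f : C^∞⟮𝓘(ℝ, V), G; ℝ⟯) (x : V) (g h : G) :
    der 𝓘(ℝ, V) 𝓘(ℝ, ℝ) (fun k : G => f (g * (k * h))) 1 x =
      rightDeriv f (Ad g x : V) (g * h) := by
  have e : (fun k : G => f (g * (k * h))) = fun k => f (g * k * g⁻¹ * (g * h)) := by
    funext k; congr 1; group
  rw [e, rightDeriv_apply]
  exact der_comp_of_eq (f := fun k : G => g * k * g⁻¹) (g := fun k : G => f (k * (g * h)))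
    (by simp) (mdifferentiableAt_translate f _ 1) (mdifferentiableAt_conj g 1) x

theorem rightDeriv_pull_inv (f : C^∞⟮𝓘(ℝ, V), G; ℝ⟯) (x : V) (g : G) :
    rightDeriv (pull (invMap V G) f) x g = -rightDeriv f (Ad g⁻¹ x : V) g⁻¹ := by
  have e : (fun k : G => pull (invMap V G) f (k * g)) = fun k => f (g⁻¹ * (k⁻¹ * 1)) := by
    funext k; exact congrArg f (by simp [invMap])
  rw [rightDeriv_apply, e]
  have hm : MDifferentiableAt 𝓘(ℝ, V) 𝓘(ℝ, ℝ) (fun k : G => f (g⁻¹ * (k * 1))) 1 :=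
    MDifferentiableAt.comp (I' := 𝓘(ℝ, V)) (g := f) (f := fun k => g⁻¹ * (k * 1)) 1
      (f.contMDiff.mdifferentiable (by simp) _)
      (by simpa using mdifferentiableAt_mul_left g⁻¹ (1 : G))
  have h1 := der_comp_of_eq (f := fun k : G => k⁻¹) (g := fun k : G => f (g⁻¹ * (k * 1)))
    (inv_one) hm (mdifferentiableAt_inv 1) x
  rw [h1, der_inv_one, map_neg, der_middle, mul_one]

/-- Every linear form on the Lie algebra is the differential at `1` of a smooth function. -/
theorem exists_rightDeriv_one_eq [T2Space G] [FiniteDimensional ℝ V] (ℓ : V →ₗ[ℝ] ℝ) :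
    ∃ f : C^∞⟮𝓘(ℝ, V), G; ℝ⟯, ∀ x : V, rightDeriv f x 1 = ℓ x := by
  -- The function is `ℓ` in the preferred chart, cut off by a bump function.
  let L : V →L[ℝ] ℝ := LinearMap.toContinuousLinearMap ℓ
  let b : SmoothBumpFunction 𝓘(ℝ, V) (1 : G) := Classical.arbitrary _
  have hφ : ContMDiffOn 𝓘(ℝ, V) 𝓘(ℝ, ℝ) ∞ (fun g : G => L (extChartAt 𝓘(ℝ, V) (1 : G) g))
      (chartAt V (1 : G)).source :=
    L.contMDiff.comp_contMDiffOn contMDiffOn_extChartAt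
  let f : C^∞⟮𝓘(ℝ, V), G; ℝ⟯ := ⟨fun g => b g • L (extChartAt 𝓘(ℝ, V) (1 : G) g),
    b.contMDiff_smul hφ⟩
  refine ⟨f, fun x => ?_⟩
  rw [rightDeriv_apply]
  have h1 : (fun h : G => f (h * 1)) =ᶠ[𝓝 1] fun h => L (extChartAt 𝓘(ℝ, V) (1 : G) h) := by
    filter_upwards [b.eventuallyEq_one] with h hh
    rw [mul_one]
    exact (congrArg (· • L (extChartAt 𝓘(ℝ, V) (1 : G) h)) hh).trans (one_smul ℝ _)
  have h2 : MDifferentiableAt 𝓘(ℝ, V) 𝓘(ℝ, V) (extChartAt 𝓘(ℝ, V) (1 : G)) 1 :=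
    mdifferentiableAt_extChartAt (mem_chart_source V 1)
  have h3 : der 𝓘(ℝ, V) 𝓘(ℝ, V) (extChartAt 𝓘(ℝ, V) (1 : G)) 1 = ContinuousLinearMap.id ℝ V :=
    mfderiv_extChartAt_self
  rw [der_congr h1, der_clm_comp L h2, h3]
  rfl

end LieGroupFacts

/-! ### The crossed module of Lie algebras -/

namespace LieCrossedModule

variable {VE : Type u} [NormedAddCommGroup VE] [NormedSpace ℝ VE]
  {E : Type u} [TopologicalSpace E] [ChartedSpace VE E] [Group E] [LieGroup 𝓘(ℝ, VE) ∞ E]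
  {VG : Type u} [NormedAddCommGroup VG] [NormedSpace ℝ VG]
  {G : Type u} [TopologicalSpace G] [ChartedSpace VG G] [Group G] [LieGroup 𝓘(ℝ, VG) ∞ G]
  (M : LieCrossedModule VE E VG G)

/-- The action of `G` on the model vector space of `E`. -/
def actE (g : G) : VE →L[ℝ] VE := der 𝓘(ℝ, VE) 𝓘(ℝ, VE) (fun e : E => M.μ g e) 1

/-- The derivative of `τ` on the model vector spaces. -/
def tau : VE →L[ℝ] VG := der 𝓘(ℝ, VE) 𝓘(ℝ, VG) M.τ 1

theorem mdifferentiableAt_μ (g : G) (e : E) :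
    MDifferentiableAt 𝓘(ℝ, VE) 𝓘(ℝ, VE) (fun e : E => M.μ g e) e :=
  (M.smooth_μ.comp (contMDiff_const.prodMk contMDiff_id) :
    ContMDiff 𝓘(ℝ, VE) 𝓘(ℝ, VE) ∞ (fun e : E => M.μ g e)).mdifferentiable (by simp) e

theorem mdifferentiableAt_τ (e : E) : MDifferentiableAt 𝓘(ℝ, VE) 𝓘(ℝ, VG) M.τ e :=
  M.smooth_τ.mdifferentiable (by simp) e

theorem actE_mul (g h : G) (X : VE) : M.actE (g * h) X = M.actE g (M.actE h X) := by
  have e : (fun k : E => M.μ (g * h) k) = fun k => M.μ g (M.μ h k) := by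
    funext k; rw [map_mul]; rfl
  unfold actE
  rw [e]
  exact der_comp_of_eq (f := fun k => M.μ h k) (g := fun k => M.μ g k) (map_one _)
    (M.mdifferentiableAt_μ g 1) (M.mdifferentiableAt_μ h 1) X

theorem actE_one (X : VE) : M.actE (1 : G) X = X := by
  have e : (fun k : E => M.μ (1 : G) k) = fun k => k := by
    funext k; rw [map_one]; rfl
  unfold actE
  rw [e]
  exact der_id 1 X

theorem tau_actE (g : G) (X : VE) : M.tau (M.actE g X) = Ad g (M.tau X) := by
  have h1 := der_comp_of_eq (f := fun k : E => M.μ g k) (x := 1) (y := 1) (map_one _)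
    (M.mdifferentiableAt_τ 1) (M.mdifferentiableAt_μ g 1) X
  have h2 := der_comp_of_eq (f := M.τ) (x := 1) (y := (1 : G)) (map_one _)
    (mdifferentiableAt_conj g 1) (M.mdifferentiableAt_τ 1) X
  simp only [M.equivariant] at h1
  exact h1.symm.trans h2

/-- The Peiffer identity, differentiated in its second argument. -/
theorem actE_tau (e : E) (X : VE) : M.actE (M.τ e) X = Ad e X := by
  unfold actE Ad
  simp only [M.peiffer]

variable [FiniteDimensional ℝ VE]

theorem mdifferentiableAt_actE (X : VE) (g : G) :
    MDifferentiableAt 𝓘(ℝ, VG) 𝓘(ℝ, VE) (fun g => M.actE g X) g :=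
  M.mdifferentiableAt_dμAt X g

/-- The action of the Lie algebra of `G` on the model vector space of `E`. -/
def adE : VG →ₗ[ℝ] VE →ₗ[ℝ] VE := M.ddμ

theorem der_actE (x : VG) (X : VE) :
    der 𝓘(ℝ, VG) 𝓘(ℝ, VE) (fun g => M.actE g X) 1 x = M.adE x X := rfl

/-- Obtained by differentiating `μ (g h g⁻¹) (μ g X) = μ g (μ h X)` with respect to `h`. -/
theorem actE_adE (g : G) (x : VG) (X : VE) :
    M.actE g (M.adE x X) = M.adE (Ad g x) (M.actE g X) := by
  have e : ∀ h : G, M.actE (g * h * g⁻¹) (M.actE g X) = M.actE g (M.actE h X) := fun h => by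
    rw [← actE_mul, ← actE_mul]; simp
  have h1 := der_comp_of_eq (I := 𝓘(ℝ, VG)) (f := fun h : G => g * h * g⁻¹) (x := 1) (y := 1)
    (by simp) (M.mdifferentiableAt_actE (M.actE g X) (1 : G)) (mdifferentiableAt_conj g 1) x
  have h2 := der_clm_comp (M.actE g) (M.mdifferentiableAt_actE X (1 : G)) x
  simp only [e] at h1
  rw [h1, der_actE, der_actE] at h2
  exact h2.symm

/-- The infinitesimal Peiffer identity. -/
theorem adE_tau (Y X : VE) : M.adE (M.tau Y) X = br VE E Y X := by
  have h1 := der_comp_of_eq (I := 𝓘(ℝ, VE)) (f := M.τ) (x := 1) (y := (1 : G)) (map_one _)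
    (M.mdifferentiableAt_actE X (1 : G)) (M.mdifferentiableAt_τ 1) Y
  simp only [actE_tau] at h1
  rw [der_Ad_eq_br] at h1
  exact h1.symm

/-- By the Peiffer identity the bracket of `𝔢` is expressed by the action of `𝔤`, so that the
action by automorphisms follows from equivariance. -/
theorem actE_br (g : G) (X Y : VE) :
    M.actE g (br VE E X Y) = br VE E (M.actE g X) (M.actE g Y) := by
  rw [← M.adE_tau, ← M.adE_tau, actE_adE, tau_actE]

variable [FiniteDimensional ℝ VG]

theorem tau_adE (x : VG) (X : VE) : M.tau (M.adE x X) = br VG G x (M.tau X) := by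
  have h1 := der_clm_comp M.tau (M.mdifferentiableAt_actE X (1 : G)) x
  simp only [tau_actE] at h1
  rw [der_Ad_eq_br, der_actE] at h1
  exact h1.symm

/-- Obtained by differentiating `μ g (y · X) = Ad g y · μ g X` with respect to `g`. -/
theorem adE_br_left (x y : VG) (X : VE) :
    M.adE (br VG G x y) X = M.adE x (M.adE y X) - M.adE y (M.adE x X) := by
  have h1 := der_bilin M.adE.toContinuousBilinearMap (mdifferentiableAt_Ad y (1 : G))
    (M.mdifferentiableAt_actE X (1 : G)) x
  simp only [LinearMap.toContinuousBilinearMap_apply, ← actE_adE] at h1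
  rw [der_actE, der_actE, der_Ad_eq_br, Ad_one, actE_one] at h1
  rw [h1]; abel

theorem adE_br_right (x : VG) (X Y : VE) :
    M.adE x (br VE E X Y) = br VE E (M.adE x X) Y + br VE E X (M.adE x Y) := by
  rw [← M.adE_tau, ← M.adE_tau, ← M.adE_tau, tau_adE, adE_br_left]; abel

end LieCrossedModule

/-! ### The action of group valued functions on vector valued functions -/

theorem contMDiffMap_sum_apply {VX HX X : Type*} [NormedAddCommGroup VX] [NormedSpace ℝ VX]
    [TopologicalSpace HX] [TopologicalSpace X] [ChartedSpace HX X] {I : ModelWithCorners ℝ VX HX}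
    {ι : Type*} (s : Finset ι) (f : ι → C^∞⟮I, X; ℝ⟯) (x : X) :
    (∑ i ∈ s, f i) x = ∑ i ∈ s, f i x := by
  classical
  induction s using Finset.induction_on with
  | empty => rfl
  | insert i s hi h => rw [Finset.sum_insert hi, Finset.sum_insert hi, ← h]; rfl

section Actions

variable {V : Type u} [NormedAddCommGroup V] [NormedSpace ℝ V]
  {G : Type u} [TopologicalSpace G] [ChartedSpace V G] [Group G] [LieGroup 𝓘(ℝ, V) ∞ G]
  {A : Type v} [Ring A] [Algebra ℝ A] {𝒜 : ℤ → Submodule ℝ A} [GradedAlgebra 𝒜]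

/-- Functions of degree `0` are central. -/
theorem IsFunctionAlgebra.commute (h𝒜 : IsFunctionAlgebra.{u, v} 𝒜) {a : A} (ha : a ∈ 𝒜 0)
    (b : A) : a * b = b * a := by
  induction b using DirectSum.Decomposition.inductionOn 𝒜 with
  | zero => simp
  | homogeneous b => simpa using h𝒜.graded_comm ha b.2
  | add b b' h h' => rw [mul_add, add_mul, h, h']

variable {W W' U : Type u} [AddCommGroup W] [Module ℝ W] [FiniteDimensional ℝ W]
  [AddCommGroup W'] [Module ℝ W'] [FiniteDimensional ℝ W'] [AddCommGroup U] [Module ℝ U]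
  [FiniteDimensional ℝ U]

/-- A `W`-valued function may be expanded with respect to any finite family of vectors. -/
theorem Point.sum_basis_tmul (Ψ : Point 𝒜 𝓘(ℝ, V) G) {ι : Type*} [Fintype ι]
    (F : Fin (Module.finrank ℝ W) → C^∞⟮𝓘(ℝ, V), G; ℝ⟯) (w : ι → W) (f : ι → C^∞⟮𝓘(ℝ, V), G; ℝ⟯)
    (h : ∀ k g, F k g = (Module.finBasis ℝ W).coord k (∑ i, f i g • w i)) (a : A) :
    ∑ k, Module.finBasis ℝ W k ⊗ₜ[ℝ] (Ψ.1 (F k) * a) = ∑ i, w i ⊗ₜ[ℝ] (Ψ.1 (f i) * a) := by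
  have hF : ∀ k, F k = ∑ i, (Module.finBasis ℝ W).coord k (w i) • f i := by
    intro k
    ext g
    rw [h, map_sum, contMDiffMap_sum_apply]
    refine Finset.sum_congr rfl fun i _ => ?_
    rw [map_smul, smul_eq_mul, mul_comm]
    rfl
  simp only [hF, map_sum, map_smul, Finset.sum_mul, TensorProduct.tmul_sum, smul_mul_assoc]
  rw [Finset.sum_comm]
  refine Finset.sum_congr rfl fun i _ => ?_
  simp only [← TensorProduct.smul_tmul]
  rw [← TensorProduct.sum_tmul]
  congr 1
  exact (Module.finBasis ℝ W).sum_repr (w i)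

/-- In `Point.act_tmul` the chosen basis may be replaced by any finite family of vectors. -/
theorem Point.act_tmul_of_expansion (Ψ : Point 𝒜 𝓘(ℝ, V) G) (ρ : EndMap V G W) {ι : Type*}
    [Fintype ι] (x : W) (a : A) (w : ι → W) (f : ι → C^∞⟮𝓘(ℝ, V), G; ℝ⟯)
    (h : ∀ g, ρ.toFun g x = ∑ i, f i g • w i) :
    Ψ.act ρ (x ⊗ₜ a) = ∑ i, w i ⊗ₜ[ℝ] (Ψ.1 (f i) * a) := by
  rw [Point.act_tmul]
  refine Ψ.sum_basis_tmul _ w f (fun k g => ?_) a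
  rw [← h]
  rfl

theorem EndMap.apply_eq_sum (ρ : EndMap V G W) (g : G) (w : W) :
    ρ.toFun g w = ∑ i, ρ.coeff ((Module.finBasis ℝ W).coord i) w g • Module.finBasis ℝ W i :=
  ((Module.finBasis ℝ W).sum_repr (ρ.toFun g w)).symm

/-- An equivariant bilinear map remains equivariant with coefficients. -/
theorem Point.act_extend (h𝒜 : IsFunctionAlgebra.{u, v} 𝒜) (Ψ : Point 𝒜 𝓘(ℝ, V) G)
    (ρ : EndMap V G W) (ρ' : EndMap V G W') (ρ'' : EndMap V G U) (β : W →ₗ[ℝ] W' →ₗ[ℝ] U)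
    (hβ : ∀ g x y, ρ''.toFun g (β x y) = β (ρ.toFun g x) (ρ'.toFun g y))
    (s : W ⊗[ℝ] A) (t : W' ⊗[ℝ] A) :
    Ψ.act ρ'' (extend A β s t) = extend A β (Ψ.act ρ s) (Ψ.act ρ' t) := by
  induction s using TensorProduct.induction_on with
  | zero => simp
  | add s s' h h' => simp only [map_add, LinearMap.add_apply, h, h']
  | tmul x a =>
    induction t using TensorProduct.induction_on with
    | zero => simp
    | add t t' h h' => simp only [map_add, h, h']
    | tmul y b =>
      rw [extend_tmul, Ψ.act_tmul_of_expansion ρ'' (β x y) (a * b)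
        (fun p : Fin _ × Fin _ => β (Module.finBasis ℝ W p.1) (Module.finBasis ℝ W' p.2))
        (fun p => ρ.coeff ((Module.finBasis ℝ W).coord p.1) x *
          ρ'.coeff ((Module.finBasis ℝ W').coord p.2) y), Point.act_tmul, Point.act_tmul,
        Fintype.sum_prod_type, map_sum (extend A β), LinearMap.sum_apply]
      · refine Finset.sum_congr rfl fun i _ => ?_
        rw [map_sum]
        refine Finset.sum_congr rfl fun j _ => ?_
        rw [extend_tmul, map_mul]
        congr 1
        rw [mul_assoc, mul_assoc, ← mul_assoc _ a, h𝒜.commute (Ψ.2 _) a, mul_assoc a]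
      · intro g
        rw [hβ, ρ.apply_eq_sum, ρ'.apply_eq_sum, Fintype.sum_prod_type, map_sum β,
          LinearMap.sum_apply]
        refine Finset.sum_congr rfl fun i _ => ?_
        rw [map_sum]
        refine Finset.sum_congr rfl fun j _ => ?_
        rw [map_smul, map_smul, LinearMap.smul_apply, smul_smul, mul_comm]
        rfl

/-- An equivariant linear map remains equivariant with coefficients. -/
theorem Point.act_map (Ψ : Point 𝒜 𝓘(ℝ, V) G) (ρ : EndMap V G W) (ρ' : EndMap V G W')
    (L : W →ₗ[ℝ] W') (hL : ∀ g x, L (ρ.toFun g x) = ρ'.toFun g (L x)) (s : W ⊗[ℝ] A) :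
    TensorProduct.map L LinearMap.id (Ψ.act ρ s) =
      Ψ.act ρ' (TensorProduct.map L LinearMap.id s) := by
  induction s using TensorProduct.induction_on with
  | zero => simp
  | add s s' h h' => simp only [map_add, h, h']
  | tmul x a =>
    rw [TensorProduct.map_tmul, Ψ.act_tmul_of_expansion ρ' (L x) _
      (fun i => L (Module.finBasis ℝ W i)) (fun i => ρ.coeff ((Module.finBasis ℝ W).coord i) x),
      Point.act_tmul, map_sum]
    · rfl
    · intro g
      rw [← hL, ρ.apply_eq_sum, map_sum]
      simp only [map_smul]

theorem Point.act_const_one (ρ : EndMap V G W) (hρ : ∀ w, ρ.toFun 1 w = w) (s : W ⊗[ℝ] A) :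
    (Point.const 1 : Point 𝒜 𝓘(ℝ, V) G).act ρ s = s := by
  induction s using TensorProduct.induction_on with
  | zero => simp
  | add s s' h h' => simp only [map_add, h, h']
  | tmul x a =>
    have h : ∀ i, (Point.const 1 : Point 𝒜 𝓘(ℝ, V) G).1
        (ρ.coeff ((Module.finBasis ℝ W).coord i) x) * a = (Module.finBasis ℝ W).coord i x • a := by
      intro i
      rw [Algebra.smul_def]
      exact congrArg (fun w => algebraMap ℝ A ((Module.finBasis ℝ W).coord i w) * a) (hρ x)
    rw [Point.act_tmul]
    simp only [h, ← TensorProduct.smul_tmul]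
    rw [← TensorProduct.sum_tmul]
    congr 1
    exact (Module.finBasis ℝ W).sum_repr x

/-- A derivation acts on `ρ(g) s` by the Leibniz rule, where the derivative of `ρ(g)` is given by
the logarithmic derivative of `g`. -/
theorem Point.onValues_act (h𝒜 : IsFunctionAlgebra.{u, v} 𝒜) (Ψ : Point 𝒜 𝓘(ℝ, V) G)
    (ρ : EndMap V G W) (dρ : LieAlg V G →ₗ[ℝ] W →ₗ[ℝ] W)
    (hρ : ∀ ℓ w x g, rightDeriv (ρ.coeff ℓ w) x g = ℓ (dρ x (ρ.toFun g w)))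
    {p : ℤ} {D : A →ₗ[ℝ] A} (hD : IsGradedDerivation 𝒜 p D) {θ : LieAlg V G ⊗[ℝ] A}
    (hθ : ∀ f, D (Ψ.1 f) = Ψ.fieldOf θ f) (s : W ⊗[ℝ] A) :
    onValues W D (Ψ.act ρ s) = Ψ.act ρ (onValues W D s) + extend A dρ θ (Ψ.act ρ s) := by
  induction s using TensorProduct.induction_on with
  | zero => simp
  | add s s' h h' => simp only [map_add, h, h']; abel
  | tmul w a =>
    have key : ∀ θ : LieAlg V G ⊗[ℝ] A, ∑ k, Module.finBasis ℝ W k ⊗ₜ[ℝ]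
        (Ψ.fieldOf θ (ρ.coeff ((Module.finBasis ℝ W).coord k) w) * a) =
        extend A dρ θ (Ψ.act ρ (w ⊗ₜ a)) := by
      intro θ
      induction θ using TensorProduct.induction_on with
      | zero => simp [Point.fieldOf]
      | add θ θ' h h' =>
        simp only [Point.fieldOf, map_add, LinearMap.add_apply, add_mul, TensorProduct.tmul_add,
          Finset.sum_add_distrib] at h h' ⊢
        rw [h, h']
      | tmul x t =>
        have e : ∀ f, Ψ.fieldOf (x ⊗ₜ t) f * a = Ψ.1 (rightDeriv f x) * (t * a) := fun f => by
          rw [← mul_assoc]; rfl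
        simp only [e]
        rw [Ψ.sum_basis_tmul _ (fun j => dρ x (Module.finBasis ℝ W j))
          (fun j => ρ.coeff ((Module.finBasis ℝ W).coord j) w), Point.act_tmul, map_sum]
        · refine Finset.sum_congr rfl fun j _ => ?_
          rw [extend_tmul, ← mul_assoc, ← mul_assoc, h𝒜.commute (Ψ.2 _) t]
        · intro k g
          rw [hρ, ρ.apply_eq_sum, map_sum]
          simp only [map_smul]
    rw [← key, Point.act_tmul, map_sum]
    have e : onValues W D (w ⊗ₜ[ℝ] a) = w ⊗ₜ D a := rfl
    rw [e, Point.act_tmul, ← Finset.sum_add_distrib]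
    refine Finset.sum_congr rfl fun i _ => ?_
    refine (congrArg (fun c => Module.finBasis ℝ W i ⊗ₜ[ℝ] c) (hD.leibniz a (Ψ.2 _))).trans ?_
    rw [hθ]
    simp [TensorProduct.tmul_add, add_comm]

end Actions

/-! ### The group of group valued functions -/

section GroupLaws

variable {V : Type u} [NormedAddCommGroup V] [NormedSpace ℝ V] [FiniteDimensional ℝ V]
  {G : Type u} [TopologicalSpace G] [ChartedSpace V G] [Group G] [LieGroup 𝓘(ℝ, V) ∞ G]
  [T2Space G] [SecondCountableTopology G]
  {A : Type v} [Ring A] [Algebra ℝ A] {𝒜 : ℤ → Submodule ℝ A} [GradedAlgebra 𝒜]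

theorem Point.exists_prod (h𝒜 : IsFunctionAlgebra.{u, v} 𝒜) (Ψ Φ : Point 𝒜 𝓘(ℝ, V) G) :
    ∃ χ : Point 𝒜 (𝓘(ℝ, V).prod 𝓘(ℝ, V)) (G × G),
      χ.map ContMDiffMap.fst = Ψ ∧ χ.map ContMDiffMap.snd = Φ :=
  (h𝒜.point_prod 𝓘(ℝ, V) 𝓘(ℝ, V) Ψ Φ).exists

/-- The product may be computed by means of any function to `G × G` with the given components. -/
theorem Point.mul_eq (h𝒜 : IsFunctionAlgebra.{u, v} 𝒜) {Ψ Φ : Point 𝒜 𝓘(ℝ, V) G}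
    {χ : Point 𝒜 (𝓘(ℝ, V).prod 𝓘(ℝ, V)) (G × G)} (h₁ : χ.map ContMDiffMap.fst = Ψ)
    (h₂ : χ.map ContMDiffMap.snd = Φ) : Ψ.mul h𝒜 Φ = χ.map (mulMap V G) := by
  have h := h𝒜.point_prod 𝓘(ℝ, V) 𝓘(ℝ, V) Ψ Φ
  exact congrArg (Point.map (mulMap V G))
    (h.unique h.choose_spec.1 ⟨h₁, h₂⟩)

theorem Point.map_const {VX HX X VY HY Y : Type u}
    [NormedAddCommGroup VX] [NormedSpace ℝ VX] [TopologicalSpace HX] [TopologicalSpace X]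
    [ChartedSpace HX X]
    [NormedAddCommGroup VY] [NormedSpace ℝ VY] [TopologicalSpace HY] [TopologicalSpace Y]
    [ChartedSpace HY Y] {I : ModelWithCorners ℝ VX HX} {J : ModelWithCorners ℝ VY HY}
    (Ψ : Point 𝒜 I X) (y : Y) :
    Ψ.map (ContMDiffMap.const y : C^∞⟮I, X; J, Y⟯) = Point.const y := by
  refine Subtype.ext (AlgHom.ext fun f => ?_)
  exact Ψ.1.commutes (f y)

/-- Both products are the image of the same `(G × G) × G`-valued function under the triple
product. -/
theorem Point.mul_assoc (h𝒜 : IsFunctionAlgebra.{u, v} 𝒜) (Ψ Φ Θ : Point 𝒜 𝓘(ℝ, V) G) :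
    (Ψ.mul h𝒜 Φ).mul h𝒜 Θ = Ψ.mul h𝒜 (Φ.mul h𝒜 Θ) := by
  obtain ⟨χ, h1, h2⟩ := Point.exists_prod h𝒜 Ψ Φ
  obtain ⟨ζ, h3, h4⟩ := (h𝒜.point_prod (𝓘(ℝ, V).prod 𝓘(ℝ, V)) 𝓘(ℝ, V) χ Θ).exists
  have e1 : ζ.map (ContMDiffMap.fst.comp ContMDiffMap.fst) = Ψ := by rw [← h1, ← h3]; rfl
  have e2 : ζ.map (ContMDiffMap.snd.comp ContMDiffMap.fst) = Φ := by rw [← h2, ← h3]; rfl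
  let π₁ : C^∞⟮(𝓘(ℝ, V).prod 𝓘(ℝ, V)).prod 𝓘(ℝ, V), (G × G) × G; 𝓘(ℝ, V), G⟯ :=
    ContMDiffMap.fst.comp ContMDiffMap.fst
  let π₂ : C^∞⟮(𝓘(ℝ, V).prod 𝓘(ℝ, V)).prod 𝓘(ℝ, V), (G × G) × G; 𝓘(ℝ, V), G⟯ :=
    ContMDiffMap.snd.comp ContMDiffMap.fst
  let π₃ : C^∞⟮(𝓘(ℝ, V).prod 𝓘(ℝ, V)).prod 𝓘(ℝ, V), (G × G) × G; 𝓘(ℝ, V), G⟯ :=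
    ContMDiffMap.snd
  have e3 : Ψ.mul h𝒜 Φ = ζ.map ((mulMap V G).comp (π₁.prodMk π₂)) := by
    rw [Point.mul_eq h𝒜 h1 h2, ← h3]; rfl
  have e4 : Φ.mul h𝒜 Θ = ζ.map ((mulMap V G).comp (π₂.prodMk π₃)) :=
    Point.mul_eq h𝒜 (χ := ζ.map (π₂.prodMk π₃)) e2 h4
  rw [Point.mul_eq h𝒜 (χ := ζ.map (((mulMap V G).comp (π₁.prodMk π₂)).prodMk π₃)) e3.symm h4,
    Point.mul_eq h𝒜 (χ := ζ.map (π₁.prodMk ((mulMap V G).comp (π₂.prodMk π₃)))) e1 e4.symm]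
  refine Subtype.ext (AlgHom.ext fun f => congrArg ζ.1 ?_)
  ext q
  exact congrArg f (_root_.mul_assoc q.1.1 q.1.2 q.2)

theorem Point.one_mul (h𝒜 : IsFunctionAlgebra.{u, v} 𝒜) (Ψ : Point 𝒜 𝓘(ℝ, V) G) :
    (Point.const 1).mul h𝒜 Ψ = Ψ := by
  rw [Point.mul_eq h𝒜 (χ := Ψ.map ((ContMDiffMap.const 1).prodMk ContMDiffMap.id))
    (Φ := Ψ) (Ψ.map_const 1) rfl]
  refine Subtype.ext (AlgHom.ext fun f => congrArg Ψ.1 ?_)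
  ext g
  exact congrArg f (_root_.one_mul g)

theorem Point.inv_mul (h𝒜 : IsFunctionAlgebra.{u, v} 𝒜) (Ψ : Point 𝒜 𝓘(ℝ, V) G) :
    Ψ.inv.mul h𝒜 Ψ = Point.const 1 := by
  rw [Point.mul_eq h𝒜 (χ := Ψ.map ((invMap V G).prodMk ContMDiffMap.id)) (Ψ := Ψ.inv) (Φ := Ψ)
      rfl rfl,
    ← Ψ.map_const 1]
  refine Subtype.ext (AlgHom.ext fun f => congrArg Ψ.1 ?_)
  ext g
  exact congrArg f (inv_mul_cancel g)

theorem Point.act_mul (h𝒜 : IsFunctionAlgebra.{u, v} 𝒜) (Ψ Φ : Point 𝒜 𝓘(ℝ, V) G)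
    {W : Type u} [AddCommGroup W] [Module ℝ W] [FiniteDimensional ℝ W] (ρ : EndMap V G W)
    (hρ : ∀ g h w, ρ.toFun (g * h) w = ρ.toFun g (ρ.toFun h w)) (s : W ⊗[ℝ] A) :
    (Ψ.mul h𝒜 Φ).act ρ s = Ψ.act ρ (Φ.act ρ s) := by
  obtain ⟨χ, h1, h2⟩ := Point.exists_prod h𝒜 Ψ Φ
  rw [Point.mul_eq h𝒜 h1 h2]
  induction s using TensorProduct.induction_on with
  | zero => simp
  | add s s' h h' => simp only [map_add, h, h']
  | tmul w a =>
    rw [Point.act_tmul, Point.act_tmul, map_sum]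
    simp only [Point.act_tmul]
    rw [Finset.sum_comm]
    refine Finset.sum_congr rfl fun i _ => ?_
    rw [← TensorProduct.tmul_sum]
    congr 1
    simp only [← _root_.mul_assoc]
    rw [← Finset.sum_mul]
    congr 1
    -- The matrix coefficients of a product are those of the product matrix.
    have e : pull (mulMap V G) (ρ.coeff ((Module.finBasis ℝ W).coord i) w) =
        ∑ j, pull ContMDiffMap.fst (ρ.coeff ((Module.finBasis ℝ W).coord i)
          (Module.finBasis ℝ W j)) * pull ContMDiffMap.snd (ρ.coeff
            ((Module.finBasis ℝ W).coord j) w) := by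
      ext q
      rw [contMDiffMap_sum_apply]
      refine (congrArg ((Module.finBasis ℝ W).coord i) ((hρ q.1 q.2 w).trans
        (congrArg (ρ.toFun q.1) (ρ.apply_eq_sum q.2 w)))).trans ?_
      rw [map_sum, map_sum]
      refine Finset.sum_congr rfl fun j _ => ?_
      rw [map_smul, map_smul, smul_eq_mul, mul_comm]
      rfl
    refine (congrArg χ.1 e).trans ?_
    rw [map_sum, ← h1, ← h2]
    refine Finset.sum_congr rfl fun j _ => ?_
    rw [map_mul]
    rfl

end GroupLaws

/-! ### Logarithmic derivatives of group valued functions -/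

section Fields

variable {V : Type u} [NormedAddCommGroup V] [NormedSpace ℝ V]
  {G : Type u} [TopologicalSpace G] [ChartedSpace V G] [Group G] [LieGroup 𝓘(ℝ, V) ∞ G]
  {VX HX X : Type u} [NormedAddCommGroup VX] [NormedSpace ℝ VX] [TopologicalSpace HX]
  [TopologicalSpace X] [ChartedSpace HX X] {I : ModelWithCorners ℝ VX HX} [IsManifold I ∞ X]
  {A : Type v} [Ring A] [Algebra ℝ A] {𝒜 : ℤ → Submodule ℝ A} [GradedAlgebra 𝒜]

theorem mdifferentiableAt_orbit (F : C^∞⟮I, X; ℝ⟯)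
    (a : C^∞⟮I.prod 𝓘(ℝ, V), X × G; I, X⟯) (p : X) (k : G) :
    MDifferentiableAt 𝓘(ℝ, V) 𝓘(ℝ, ℝ) (fun k : G => F (a (p, k))) k :=
  ((F.contMDiff.comp a.contMDiff).comp (contMDiff_const.prodMk contMDiff_id) :
    ContMDiff 𝓘(ℝ, V) 𝓘(ℝ, ℝ) ∞ (fun k : G => F (a (p, k)))).mdifferentiable (by simp) k

/-- The derivative of a smooth function `F` on `X` along the fundamental vector field of `x` for a
smooth family `a p k` of maps `X → X`, `k ∈ G`: its value at `p` is the derivative of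
`k ↦ F (a p k)` at `1` in the direction `x`. -/
def orbitDeriv (a : C^∞⟮I.prod 𝓘(ℝ, V), X × G; I, X⟯) :
    LieAlg V G →ₗ[ℝ] C^∞⟮I, X; ℝ⟯ →ₗ[ℝ] C^∞⟮I, X; ℝ⟯ :=
  LinearMap.mk₂ ℝ
    (fun x F => ⟨fun p => der 𝓘(ℝ, V) 𝓘(ℝ, ℝ) (fun k : G => F (a (p, k))) 1 x,
      contMDiff_partial (I := I) (J := 𝓘(ℝ, V)) (VZ := ℝ) (fun p k => F (a (p, k)))
        (F.contMDiff.comp a.contMDiff) 1 x⟩)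
    (fun x y F => by
      ext p
      exact map_add (der 𝓘(ℝ, V) 𝓘(ℝ, ℝ) (fun k : G => F (a (p, k))) 1) x y)
    (fun c x F => by
      ext p
      exact map_smul (der 𝓘(ℝ, V) 𝓘(ℝ, ℝ) (fun k : G => F (a (p, k))) 1) c x)
    (fun x F F' => by
      ext p
      exact congrArg (fun L : V →L[ℝ] ℝ => L x) ((mdifferentiableAt_orbit F a p 1).hasMFDerivAt.add
        (mdifferentiableAt_orbit F' a p 1).hasMFDerivAt).mfderiv)
    (fun c x F => by
      ext p
      exact congrArg (fun L : V →L[ℝ] ℝ => L x)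
        ((mdifferentiableAt_orbit F a p 1).hasMFDerivAt.const_smul c).mfderiv)

theorem orbitDeriv_mul (a : C^∞⟮I.prod 𝓘(ℝ, V), X × G; I, X⟯) (ha : ∀ p, a (p, 1) = p)
    (x : LieAlg V G) (F F' : C^∞⟮I, X; ℝ⟯) :
    orbitDeriv a x (F * F') = F * orbitDeriv a x F' + F' * orbitDeriv a x F := by
  ext p
  have h := der_bilin (ContinuousLinearMap.mul ℝ ℝ) (mdifferentiableAt_orbit F a p 1)
    (mdifferentiableAt_orbit F' a p 1) x
  refine h.trans ?_
  simp only [ha, ContinuousLinearMap.mul_apply']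
  rw [add_comm]
  exact congrArg (F p * orbitDeriv a x F' p + ·) (mul_comm _ _)

/-- The vector field along `χ` obtained by contracting the fundamental vector fields with `θ`. -/
def Point.orbitField (χ : Point 𝒜 I X) (a : C^∞⟮I.prod 𝓘(ℝ, V), X × G; I, X⟯) :
    LieAlg V G ⊗[ℝ] A →ₗ[ℝ] C^∞⟮I, X; ℝ⟯ →ₗ[ℝ] A :=
  TensorProduct.lift (LinearMap.mk₂ ℝ
    (fun x t => (LinearMap.mulRight ℝ t).comp (χ.1.toLinearMap.comp (orbitDeriv a x)))
    (fun x y t => by ext F; simp [add_mul])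
    (fun c x t => by ext F; simp)
    (fun x s t => by ext F; simp [mul_add])
    (fun c x t => by ext F; simp))

theorem Point.orbitField_tmul (χ : Point 𝒜 I X) (a : C^∞⟮I.prod 𝓘(ℝ, V), X × G; I, X⟯)
    (x : LieAlg V G) (t : A) (F : C^∞⟮I, X; ℝ⟯) :
    χ.orbitField a (x ⊗ₜ t) F = χ.1 (orbitDeriv a x F) * t := rfl

theorem Point.isFieldAlong_orbitField (χ : Point 𝒜 I X) (a : C^∞⟮I.prod 𝓘(ℝ, V), X × G; I, X⟯)
    (ha : ∀ p, a (p, 1) = p) {p : ℤ} {θ : LieAlg V G ⊗[ℝ] A}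
    (hθ : θ ∈ valued (LieAlg V G) (𝒜 p)) :
    IsFieldAlong χ p (χ.orbitField a θ) := by
  refine valued_induction (P := fun θ => IsFieldAlong χ p (χ.orbitField a θ)) ?_ ?_ ?_ hθ
  · exact ⟨fun f => by simp, fun f g => by simp⟩
  · intro x t ht
    refine ⟨fun f => ?_, fun f g => ?_⟩
    · have h := SetLike.mul_mem_graded (χ.2 (orbitDeriv a x f)) ht
      rwa [zero_add] at h
    · simp only [Point.orbitField_tmul]
      rw [orbitDeriv_mul a ha, map_add, map_mul, map_mul, add_mul, _root_.mul_assoc,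
        _root_.mul_assoc]
  · intro θ θ' h h'
    refine ⟨fun f => ?_, fun f g => ?_⟩
    · rw [map_add]; exact add_mem (h.mem f) (h'.mem f)
    · rw [map_add, LinearMap.add_apply, h.leibniz, h'.leibniz]
      simp only [LinearMap.add_apply, mul_add]
      abel

theorem Point.isFieldAlong_derivation (h𝒜 : IsFunctionAlgebra.{u, v} 𝒜) (χ : Point 𝒜 I X) {p : ℤ}
    {D : A →ₗ[ℝ] A} (hD : IsGradedDerivation 𝒜 p D) :
    IsFieldAlong χ p (D.comp χ.1.toLinearMap) := by
  refine ⟨fun f => ?_, fun f g => ?_⟩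
  · have h := hD.mem (χ.2 f)
    rwa [zero_add] at h
  · have h := hD.leibniz (χ.1 g) (χ.2 f)
    rw [mul_zero, Int.negOnePow_zero, one_smul, ← h𝒜.commute (χ.2 g) (D (χ.1 f)), add_comm] at h
    exact (congrArg D (map_mul χ.1 f g)).trans h

theorem Point.fieldOf_tmul (Ψ : Point 𝒜 𝓘(ℝ, V) G) (x : LieAlg V G) (t : A)
    (f : C^∞⟮𝓘(ℝ, V), G; ℝ⟯) : Ψ.fieldOf (x ⊗ₜ t) f = Ψ.1 (rightDeriv f x) * t := rfl

theorem Point.fieldOf_zero (Ψ : Point 𝒜 𝓘(ℝ, V) G) (f : C^∞⟮𝓘(ℝ, V), G; ℝ⟯) :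
    Ψ.fieldOf 0 f = 0 := map_zero _

theorem Point.fieldOf_add (Ψ : Point 𝒜 𝓘(ℝ, V) G) (θ θ' : LieAlg V G ⊗[ℝ] A)
    (f : C^∞⟮𝓘(ℝ, V), G; ℝ⟯) : Ψ.fieldOf (θ + θ') f = Ψ.fieldOf θ f + Ψ.fieldOf θ' f :=
  map_add _ _ _

theorem Point.fieldOf_neg (Ψ : Point 𝒜 𝓘(ℝ, V) G) (θ : LieAlg V G ⊗[ℝ] A)
    (f : C^∞⟮𝓘(ℝ, V), G; ℝ⟯) : Ψ.fieldOf (-θ) f = -Ψ.fieldOf θ f :=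
  map_neg _ _

variable [FiniteDimensional ℝ V] [T2Space G] [SecondCountableTopology G]

/-- A vector field along a `G × G`-valued function is determined by its two components. -/
theorem IsFieldAlong.ext (h𝒜 : IsFunctionAlgebra.{u, v} 𝒜)
    {χ : Point 𝒜 (𝓘(ℝ, V).prod 𝓘(ℝ, V)) (G × G)} {p : ℤ}
    {δ δ' : C^∞⟮𝓘(ℝ, V).prod 𝓘(ℝ, V), G × G; ℝ⟯ →ₗ[ℝ] A} (h : IsFieldAlong χ p δ)
    (h' : IsFieldAlong χ p δ')
    (h₁ : ∀ f, δ (pull ContMDiffMap.fst f) = δ' (pull ContMDiffMap.fst f))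
    (h₂ : ∀ f, δ (pull ContMDiffMap.snd f) = δ' (pull ContMDiffMap.snd f)) : δ = δ' := by
  have e := h𝒜.field_prod 𝓘(ℝ, V) 𝓘(ℝ, V) χ p
    (δ'.comp (pull ContMDiffMap.fst).toLinearMap) (δ'.comp (pull ContMDiffMap.snd).toLinearMap)
    ⟨fun f => h'.mem _, fun f g =>
      (congrArg δ' (map_mul (pull ContMDiffMap.fst) f g)).trans (h'.leibniz _ _)⟩
    ⟨fun f => h'.mem _, fun f g =>
      (congrArg δ' (map_mul (pull ContMDiffMap.snd) f g)).trans (h'.leibniz _ _)⟩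
  exact e.unique ⟨h, h₁, h₂⟩ ⟨h', fun _ => rfl, fun _ => rfl⟩

variable (V G) in
/-- Left translation of the first factor of `G × G`. -/
def translateFst : C^∞⟮(𝓘(ℝ, V).prod 𝓘(ℝ, V)).prod 𝓘(ℝ, V), (G × G) × G;
    𝓘(ℝ, V).prod 𝓘(ℝ, V), G × G⟯ :=
  ⟨fun q => (q.2 * q.1.1, q.1.2),
    (contMDiff_snd.mul (contMDiff_fst.comp contMDiff_fst)).prodMk
      (contMDiff_snd.comp contMDiff_fst)⟩

variable (V G) in
/-- Left translation of the second factor of `G × G`. -/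
def translateSnd : C^∞⟮(𝓘(ℝ, V).prod 𝓘(ℝ, V)).prod 𝓘(ℝ, V), (G × G) × G;
    𝓘(ℝ, V).prod 𝓘(ℝ, V), G × G⟯ :=
  ⟨fun q => (q.1.1, q.2 * q.1.2),
    (contMDiff_fst.comp contMDiff_fst).prodMk
      (contMDiff_snd.mul (contMDiff_snd.comp contMDiff_fst))⟩

theorem orbitDeriv_translateFst_fst (x : LieAlg V G) (f : C^∞⟮𝓘(ℝ, V), G; ℝ⟯) :
    orbitDeriv (translateFst V G) x (pull ContMDiffMap.fst f) =
      pull ContMDiffMap.fst (rightDeriv f x) := rfl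

theorem orbitDeriv_translateFst_snd (x : LieAlg V G) (f : C^∞⟮𝓘(ℝ, V), G; ℝ⟯) :
    orbitDeriv (translateFst V G) x (pull ContMDiffMap.snd f) = 0 := by
  ext p
  exact der_const (I := 𝓘(ℝ, V)) (J := 𝓘(ℝ, ℝ)) (f p.2) (1 : G) x

theorem orbitDeriv_translateFst_mul (x : LieAlg V G) (f : C^∞⟮𝓘(ℝ, V), G; ℝ⟯) :
    orbitDeriv (translateFst V G) x (pull (mulMap V G) f) = pull (mulMap V G) (rightDeriv f x) := by
  ext p
  have e : (fun k : G => pull (mulMap V G) f (translateFst V G (p, k))) =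
      fun k => f (k * (p.1 * p.2)) := by
    funext k
    exact congrArg f (mul_assoc k p.1 p.2)
  exact congrArg (fun F : G → ℝ => (der 𝓘(ℝ, V) 𝓘(ℝ, ℝ) F 1 : V →L[ℝ] ℝ) x) e

theorem orbitDeriv_translateSnd_fst (x : LieAlg V G) (f : C^∞⟮𝓘(ℝ, V), G; ℝ⟯) :
    orbitDeriv (translateSnd V G) x (pull ContMDiffMap.fst f) = 0 := by
  ext p
  exact der_const (I := 𝓘(ℝ, V)) (J := 𝓘(ℝ, ℝ)) (f p.1) (1 : G) x

theorem orbitDeriv_translateSnd_snd (x : LieAlg V G) (f : C^∞⟮𝓘(ℝ, V), G; ℝ⟯) :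
    orbitDeriv (translateSnd V G) x (pull ContMDiffMap.snd f) =
      pull ContMDiffMap.snd (rightDeriv f x) := rfl

/-- The derivative in the direction `Ad g x`, expanded by the matrix coefficients of `Ad g`. -/
theorem rightDeriv_Ad (f : C^∞⟮𝓘(ℝ, V), G; ℝ⟯) (x : V) (g h : G) :
    rightDeriv f (Ad g x : V) h = ∑ i, adjoint.coeff
      ((Module.finBasis ℝ (LieAlg V G)).coord i) (x : LieAlg V G) g *
        rightDeriv f (Module.finBasis ℝ (LieAlg V G) i) h := by
  have e : (Ad g x : V) = ∑ i, adjoint.coeff ((Module.finBasis ℝ (LieAlg V G)).coord i)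
      (x : LieAlg V G) g • Module.finBasis ℝ (LieAlg V G) i :=
    (adjoint (V := V) (G := G)).apply_eq_sum g x
  rw [e]
  refine (congrArg (fun F => F h) (map_sum (rightDeriv f) _ _)).trans ?_
  rw [contMDiffMap_sum_apply]
  refine Finset.sum_congr rfl fun i _ => ?_
  exact congrArg (fun F => F h) (map_smul (rightDeriv f) _ _)

/-- Translation of the second factor by `k` changes the product `g h` into `g k h`, which is the
left translation of `g h` by `g k g⁻¹`. This is the origin of the adjoint action in
`Point.logDeriv_mul`. -/
theorem orbitDeriv_translateSnd_mul (x : LieAlg V G) (f : C^∞⟮𝓘(ℝ, V), G; ℝ⟯) :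
    orbitDeriv (translateSnd V G) x (pull (mulMap V G) f) =
      ∑ i, pull ContMDiffMap.fst (adjoint.coeff ((Module.finBasis ℝ (LieAlg V G)).coord i)
        x) * pull (mulMap V G) (rightDeriv f (Module.finBasis ℝ (LieAlg V G) i)) := by
  ext p
  rw [contMDiffMap_sum_apply]
  exact (der_middle f x p.1 p.2).trans (rightDeriv_Ad f x p.1 (p.1 * p.2))

theorem Point.orbitField_translateFst (χ : Point 𝒜 (𝓘(ℝ, V).prod 𝓘(ℝ, V)) (G × G))
    (θ : LieAlg V G ⊗[ℝ] A) (f : C^∞⟮𝓘(ℝ, V), G; ℝ⟯) :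
    χ.orbitField (translateFst V G) θ (pull ContMDiffMap.fst f) =
        (χ.map ContMDiffMap.fst).fieldOf θ f ∧
      χ.orbitField (translateFst V G) θ (pull ContMDiffMap.snd f) = 0 ∧
      χ.orbitField (translateFst V G) θ (pull (mulMap V G) f) =
        (χ.map (mulMap V G)).fieldOf θ f := by
  induction θ using TensorProduct.induction_on with
  | zero => simp [Point.fieldOf_zero]
  | add θ θ' h h' =>
    simp only [map_add, LinearMap.add_apply, Point.fieldOf_add, h.1, h'.1, h.2.1, h'.2.1, h.2.2,
      h'.2.2, add_zero, and_self]
  | tmul x t =>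
    simp only [Point.orbitField_tmul, Point.fieldOf_tmul]
    rw [orbitDeriv_translateFst_fst, orbitDeriv_translateFst_snd, orbitDeriv_translateFst_mul,
      map_zero, zero_mul]
    exact ⟨rfl, rfl, rfl⟩

theorem Point.orbitField_translateSnd (h𝒜 : IsFunctionAlgebra.{u, v} 𝒜)
    (χ : Point 𝒜 (𝓘(ℝ, V).prod 𝓘(ℝ, V)) (G × G))
    (θ : LieAlg V G ⊗[ℝ] A) (f : C^∞⟮𝓘(ℝ, V), G; ℝ⟯) :
    χ.orbitField (translateSnd V G) θ (pull ContMDiffMap.fst f) = 0 ∧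
      χ.orbitField (translateSnd V G) θ (pull ContMDiffMap.snd f) =
        (χ.map ContMDiffMap.snd).fieldOf θ f ∧
      χ.orbitField (translateSnd V G) θ (pull (mulMap V G) f) =
        (χ.map (mulMap V G)).fieldOf ((χ.map ContMDiffMap.fst).act adjoint θ) f := by
  induction θ using TensorProduct.induction_on with
  | zero => simp [Point.fieldOf_zero]
  | add θ θ' h h' =>
    simp only [map_add, LinearMap.add_apply, Point.fieldOf_add, h.1, h'.1, h.2.1, h'.2.1, h.2.2,
      h'.2.2, add_zero, and_self]
  | tmul x t =>
    simp only [Point.orbitField_tmul, Point.fieldOf_tmul]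
    rw [orbitDeriv_translateSnd_fst, orbitDeriv_translateSnd_snd, orbitDeriv_translateSnd_mul,
      map_zero, zero_mul, Point.act_tmul]
    refine ⟨rfl, rfl, ?_⟩
    have e : ∀ (s : Finset (Fin (Module.finrank ℝ (LieAlg V G))))
        (F : Fin (Module.finrank ℝ (LieAlg V G)) → LieAlg V G ⊗[ℝ] A),
        (χ.map (mulMap V G)).fieldOf (∑ i ∈ s, F i) f =
          ∑ i ∈ s, (χ.map (mulMap V G)).fieldOf (F i) f := fun s F => map_sum _ _ _
    rw [e, map_sum, Finset.sum_mul]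
    refine Finset.sum_congr rfl fun i _ => ?_
    rw [Point.fieldOf_tmul, map_mul, h𝒜.commute (χ.2 _), _root_.mul_assoc]
    rfl

/-- The right logarithmic derivative of a product: `D(g h) (g h)⁻¹ = Dg g⁻¹ + Ad g (Dh h⁻¹)`.
The field `D` along the pair `(g, h)` has the same components as the sum of the fields of the
left translations of the two factors, so the two agree on functions of the product `g h`. -/
theorem Point.logDeriv_mul (h𝒜 : IsFunctionAlgebra.{u, v} 𝒜) {Ψ Φ : Point 𝒜 𝓘(ℝ, V) G} {p : ℤ}
    {D : A →ₗ[ℝ] A} (hD : IsGradedDerivation 𝒜 p D) {θ θ' : LieAlg V G ⊗[ℝ] A}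
    (hθp : θ ∈ valued (LieAlg V G) (𝒜 p)) (hθp' : θ' ∈ valued (LieAlg V G) (𝒜 p))
    (hθ : ∀ f, D (Ψ.1 f) = Ψ.fieldOf θ f) (hθ' : ∀ f, D (Φ.1 f) = Φ.fieldOf θ' f) (f) :
    D ((Ψ.mul h𝒜 Φ).1 f) = (Ψ.mul h𝒜 Φ).fieldOf (θ + Ψ.act adjoint θ') f := by
  obtain ⟨χ, h1, h2⟩ := Point.exists_prod h𝒜 Ψ Φ
  rw [Point.mul_eq h𝒜 h1 h2]
  have i1 := χ.isFieldAlong_orbitField (translateFst V G) (fun p => by simp [translateFst]) hθp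
  have i2 := χ.isFieldAlong_orbitField (translateSnd V G) (fun p => by simp [translateSnd]) hθp'
  have i3 : IsFieldAlong χ p (χ.orbitField (translateFst V G) θ +
      χ.orbitField (translateSnd V G) θ') :=
    ⟨fun f => add_mem (i1.mem f) (i2.mem f), fun f g => by
      rw [LinearMap.add_apply, i1.leibniz, i2.leibniz]
      simp only [LinearMap.add_apply, mul_add]
      abel⟩
  have e := IsFieldAlong.ext h𝒜 (χ.isFieldAlong_derivation h𝒜 hD) i3
    (fun f => by
      rw [LinearMap.add_apply, (χ.orbitField_translateFst θ f).1,
        (χ.orbitField_translateSnd h𝒜 θ' f).1, add_zero, h1, ← hθ, ← h1]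
      rfl)
    (fun f => by
      rw [LinearMap.add_apply, (χ.orbitField_translateFst θ f).2.1,
        (χ.orbitField_translateSnd h𝒜 θ' f).2.1, zero_add, h2, ← hθ', ← h2]
      rfl)
  have e' := congrArg (fun δ => δ (pull (mulMap V G) f)) e
  simp only [LinearMap.add_apply] at e'
  rw [(χ.orbitField_translateFst θ f).2.2, (χ.orbitField_translateSnd h𝒜 θ' f).2.2, h1,
    ← Point.fieldOf_add] at e'
  exact e'

/-- The right logarithmic derivative of the inverse: `D(g⁻¹) g = -Ad g⁻¹ (Dg g⁻¹)`. -/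
theorem Point.logDeriv_inv (h𝒜 : IsFunctionAlgebra.{u, v} 𝒜) {Ψ : Point 𝒜 𝓘(ℝ, V) G}
    {D : A →ₗ[ℝ] A} {θ : LieAlg V G ⊗[ℝ] A}
    (hθ : ∀ f, D (Ψ.1 f) = Ψ.fieldOf θ f) (f) :
    D (Ψ.inv.1 f) = Ψ.inv.fieldOf (-Ψ.inv.act adjoint θ) f := by
  refine (hθ (pull (invMap V G) f)).trans ?_
  rw [Point.fieldOf_neg]
  clear hθ
  induction θ using TensorProduct.induction_on with
  | zero => simp [Point.fieldOf_zero]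
  | add θ θ' h h' => rw [map_add, Point.fieldOf_add, Point.fieldOf_add, h, h', neg_add]
  | tmul x t =>
    have e : rightDeriv (pull (invMap V G) f) x = -∑ i, pull (invMap V G)
        (adjoint.coeff ((Module.finBasis ℝ (LieAlg V G)).coord i) (x : LieAlg V G)) *
        pull (invMap V G) (rightDeriv f (Module.finBasis ℝ (LieAlg V G) i)) := by
      ext g
      refine (rightDeriv_pull_inv f x g).trans (congrArg Neg.neg ?_)
      refine (rightDeriv_Ad f x g⁻¹ g⁻¹).trans ?_
      rw [contMDiffMap_sum_apply]
      rfl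
    have e' : ∀ (s : Finset (Fin (Module.finrank ℝ (LieAlg V G))))
        (F : Fin (Module.finrank ℝ (LieAlg V G)) → LieAlg V G ⊗[ℝ] A),
        Ψ.inv.fieldOf (∑ i ∈ s, F i) f = ∑ i ∈ s, Ψ.inv.fieldOf (F i) f :=
      fun s F => map_sum _ _ _
    rw [Point.fieldOf_tmul, e, Point.act_tmul, e', map_neg, map_sum, neg_mul, Finset.sum_mul]
    congr 1
    refine Finset.sum_congr rfl fun i _ => ?_
    rw [Point.fieldOf_tmul, map_mul, h𝒜.commute (Ψ.2 _), _root_.mul_assoc]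
    rfl

/-- A vector field along a `G`-valued function `g` determines its right trivialisation. The field
of `θ` along the first component of `(g, g⁻¹)` has both components zero, hence vanishes on functions
of the product `g g⁻¹ = 1`, where it is tested on functions with prescribed differential. -/
theorem Point.eq_zero_of_fieldOf_eq_zero (h𝒜 : IsFunctionAlgebra.{u, v} 𝒜)
    {Ψ : Point 𝒜 𝓘(ℝ, V) G} {p : ℤ} {θ : LieAlg V G ⊗[ℝ] A}
    (hθp : θ ∈ valued (LieAlg V G) (𝒜 p)) (hθ : ∀ f, Ψ.fieldOf θ f = 0) : θ = 0 := by
  let χ := Ψ.map (ContMDiffMap.id.prodMk (invMap V G))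
  have hχ : χ.map (mulMap V G) = Point.const 1 := by
    rw [← Ψ.map_const 1]
    refine Subtype.ext (AlgHom.ext fun f => congrArg Ψ.1 ?_)
    ext g
    exact congrArg f (mul_inv_cancel g)
  have h1 : χ.map ContMDiffMap.fst = Ψ := rfl
  have e := IsFieldAlong.ext (δ' := 0) h𝒜
    (χ.isFieldAlong_orbitField (translateFst V G) (fun p => by simp [translateFst]) hθp)
    ⟨fun f => zero_mem _, fun f g => by simp⟩
    (fun f => by rw [(χ.orbitField_translateFst θ f).1, h1, hθ]; rfl)
    (fun f => (χ.orbitField_translateFst θ f).2.1)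
  have e1 : ∀ f, (Point.const 1 : Point 𝒜 𝓘(ℝ, V) G).fieldOf θ f = 0 := fun f => by
    rw [← hχ, ← (χ.orbitField_translateFst θ f).2.2, e]
    rfl
  have e2 : ∀ ℓ : LieAlg V G →ₗ[ℝ] ℝ, TensorProduct.lift ((Algebra.lsmul ℝ ℝ A).toLinearMap.comp ℓ)
      θ = 0 := by
    intro ℓ
    obtain ⟨f, hf⟩ := exists_rightDeriv_one_eq (V := V) (G := G) ℓ
    rw [← e1 f]
    unfold Point.fieldOf
    congr 2
    ext x a
    refine (Algebra.smul_def (ℓ x) a).trans ?_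
    exact congrArg (fun r => algebraMap ℝ A r * a) (hf x).symm
  -- The expansion of `θ` in a basis, with coefficients its contractions with the dual basis.
  have e3 : θ = ∑ i, Module.finBasis ℝ (LieAlg V G) i ⊗ₜ[ℝ] TensorProduct.lift
      ((Algebra.lsmul ℝ ℝ A).toLinearMap.comp ((Module.finBasis ℝ (LieAlg V G)).coord i)) θ := by
    clear hθ hθp e e1 e2
    induction θ using TensorProduct.induction_on with
    | zero => simp
    | add θ θ' h h' =>
      simp only [map_add, TensorProduct.tmul_add, Finset.sum_add_distrib]
      rw [← h, ← h']
    | tmul x a =>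
      have : ∀ i, TensorProduct.lift ((Algebra.lsmul ℝ ℝ A).toLinearMap.comp
          ((Module.finBasis ℝ (LieAlg V G)).coord i)) (x ⊗ₜ[ℝ] a) =
          (Module.finBasis ℝ (LieAlg V G)).coord i x • a := fun i => rfl
      simp only [this, ← TensorProduct.smul_tmul]
      rw [← TensorProduct.sum_tmul]
      congr 1
      exact ((Module.finBasis ℝ (LieAlg V G)).sum_repr x).symm
  rw [e3]
  simp [e2]

end Fields

/-! ### Sign rules for bilinear maps with graded coefficients -/

section Graded

variable {A : Type v} [Ring A] [Algebra ℝ A] {𝒜 : ℤ → Submodule ℝ A}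
  {V W U V' W' : Type u} [AddCommGroup V] [Module ℝ V] [AddCommGroup W] [Module ℝ W]
  [AddCommGroup U] [Module ℝ U] [AddCommGroup V'] [Module ℝ V'] [AddCommGroup W'] [Module ℝ W']

theorem tmul_units_smul (ε : ℤˣ) (x : V) (a : A) : x ⊗ₜ[ℝ] (ε • a) = ε • (x ⊗ₜ[ℝ] a) := by
  rcases Int.units_eq_one_or ε with rfl | rfl
  · simp
  · simp [TensorProduct.tmul_neg]

theorem map_units_smul (f : V →ₗ[ℝ] W) (ε : ℤˣ) (x : V) : f (ε • x) = ε • f x := by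
  rcases Int.units_eq_one_or ε with rfl | rfl <;> simp

theorem map_mem_valued {S : Submodule ℝ A} (L : V →ₗ[ℝ] W) {s : V ⊗[ℝ] A} (hs : s ∈ valued V S) :
    TensorProduct.map L LinearMap.id s ∈ valued W S := by
  refine valued_induction (P := fun s => TensorProduct.map L LinearMap.id s ∈ valued W S)
    ?_ ?_ ?_ hs
  · simp
  · intro x a ha
    exact tmul_mem_valued (L x) ha
  · intro s t h h'
    rw [map_add]
    exact add_mem h h'

theorem extend_mem_valued_add [GradedAlgebra 𝒜] (β : V →ₗ[ℝ] W →ₗ[ℝ] U) {p q : ℤ} {s : V ⊗[ℝ] A}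
    {t : W ⊗[ℝ] A} (hs : s ∈ valued V (𝒜 p)) (ht : t ∈ valued W (𝒜 q)) :
    extend A β s t ∈ valued U (𝒜 (p + q)) :=
  extend_mem_valued β (fun _ ha _ hb => SetLike.mul_mem_graded ha hb) hs ht

/-- A skew bilinear map is graded skew with coefficients. -/
theorem extend_skew (h𝒜 : IsFunctionAlgebra.{u, v} 𝒜) (β : V →ₗ[ℝ] V →ₗ[ℝ] W)
    (hβ : ∀ x y, β x y = -β y x) {p q : ℤ} {s t : V ⊗[ℝ] A} (hs : s ∈ valued V (𝒜 p))
    (ht : t ∈ valued V (𝒜 q)) : extend A β s t = -((p * q).negOnePow • extend A β t s) := by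
  refine valued_induction (P := fun s => extend A β s t = -((p * q).negOnePow • extend A β t s))
    ?_ ?_ ?_ hs
  · simp
  · intro x a ha
    refine valued_induction (P := fun t => extend A β (x ⊗ₜ a) t =
      -((p * q).negOnePow • extend A β t (x ⊗ₜ a))) ?_ ?_ ?_ ht
    · simp
    · intro y b hb
      rw [extend_tmul, extend_tmul, h𝒜.graded_comm ha hb, hβ, TensorProduct.neg_tmul,
        tmul_units_smul]
    · intro t t' h h'
      simp only [map_add, LinearMap.add_apply, h, h', smul_add]
      abel
  · intro s s' h h'
    simp only [map_add, LinearMap.add_apply, h, h', smul_add]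
    abel

/-- If `β (γ x y) = [β x, β y]`, then the same holds with coefficients, for the graded
commutator. -/
theorem extend_rep (h𝒜 : IsFunctionAlgebra.{u, v} 𝒜) (γ : V →ₗ[ℝ] V →ₗ[ℝ] V)
    (β : V →ₗ[ℝ] W →ₗ[ℝ] W) (hβ : ∀ x y w, β (γ x y) w = β x (β y w) - β y (β x w)) {p q : ℤ}
    {s t : V ⊗[ℝ] A} (hs : s ∈ valued V (𝒜 p)) (ht : t ∈ valued V (𝒜 q)) (r : W ⊗[ℝ] A) :
    extend A β (extend A γ s t) r = extend A β s (extend A β t r) -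
      (p * q).negOnePow • extend A β t (extend A β s r) := by
  refine valued_induction (P := fun s => extend A β (extend A γ s t) r =
    extend A β s (extend A β t r) - (p * q).negOnePow • extend A β t (extend A β s r)) ?_ ?_ ?_ hs
  · simp
  · intro x a ha
    refine valued_induction (P := fun t => extend A β (extend A γ (x ⊗ₜ a) t) r =
      extend A β (x ⊗ₜ a) (extend A β t r) - (p * q).negOnePow •
        extend A β t (extend A β (x ⊗ₜ a) r)) ?_ ?_ ?_ ht
    · simp
    · intro y b hb
      induction r using TensorProduct.induction_on with
      | zero => simp
      | add r r' h h' => simp only [map_add, h, h', smul_add]; abel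
      | tmul w c =>
        simp only [extend_tmul]
        rw [hβ, TensorProduct.sub_tmul, ← mul_assoc, ← mul_assoc b, h𝒜.graded_comm hb ha,
          mul_comm q p, smul_mul_assoc, tmul_units_smul, smul_smul, Int.units_mul_self, one_smul]
    · intro t t' h h'
      simp only [map_add, LinearMap.add_apply, h, h', smul_add]
      abel
  · intro s s' h h'
    simp only [map_add, LinearMap.add_apply, h, h', smul_add]
    abel

/-- If every `β x` is a derivation of `γ`, then it is a graded derivation with coefficients. -/
theorem extend_derivation (h𝒜 : IsFunctionAlgebra.{u, v} 𝒜) (γ : W →ₗ[ℝ] W →ₗ[ℝ] W)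
    (β : V →ₗ[ℝ] W →ₗ[ℝ] W) (hβ : ∀ x w w', β x (γ w w') = γ (β x w) w' + γ w (β x w')) {p q : ℤ}
    {s : V ⊗[ℝ] A} {t : W ⊗[ℝ] A} (hs : s ∈ valued V (𝒜 p)) (ht : t ∈ valued W (𝒜 q))
    (r : W ⊗[ℝ] A) :
    extend A β s (extend A γ t r) = extend A γ (extend A β s t) r +
      (p * q).negOnePow • extend A γ t (extend A β s r) := by
  refine valued_induction (P := fun s => extend A β s (extend A γ t r) =
    extend A γ (extend A β s t) r + (p * q).negOnePow • extend A γ t (extend A β s r)) ?_ ?_ ?_ hs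
  · simp
  · intro x a ha
    refine valued_induction (P := fun t => extend A β (x ⊗ₜ a) (extend A γ t r) =
      extend A γ (extend A β (x ⊗ₜ a) t) r + (p * q).negOnePow •
        extend A γ t (extend A β (x ⊗ₜ a) r)) ?_ ?_ ?_ ht
    · simp
    · intro y b hb
      induction r using TensorProduct.induction_on with
      | zero => simp
      | add r r' h h' => simp only [map_add, h, h', smul_add]; abel
      | tmul w c =>
        simp only [extend_tmul]
        rw [hβ, TensorProduct.add_tmul, ← mul_assoc, ← mul_assoc b, h𝒜.graded_comm hb ha,
          mul_comm q p, smul_mul_assoc, tmul_units_smul, smul_smul, Int.units_mul_self, one_smul]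
    · intro t t' h h'
      simp only [map_add, LinearMap.add_apply, h, h', smul_add]
      abel
  · intro s s' h h'
    simp only [map_add, LinearMap.add_apply, h, h', smul_add]
    abel

/-- The Leibniz rule for a bilinear map with coefficients. -/
theorem onValues_extend (β : V →ₗ[ℝ] W →ₗ[ℝ] U) {k p : ℤ} {D : A →ₗ[ℝ] A}
    (hD : IsGradedDerivation 𝒜 k D) {s : V ⊗[ℝ] A} (hs : s ∈ valued V (𝒜 p)) (t : W ⊗[ℝ] A) :
    onValues U D (extend A β s t) = extend A β (onValues V D s) t +
      (k * p).negOnePow • extend A β s (onValues W D t) := by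
  refine valued_induction (P := fun s => onValues U D (extend A β s t) =
    extend A β (onValues V D s) t + (k * p).negOnePow • extend A β s (onValues W D t)) ?_ ?_ ?_ hs
  · simp
  · intro x a ha
    induction t using TensorProduct.induction_on with
    | zero => simp
    | add t t' h h' => simp only [map_add, h, h', smul_add]; abel
    | tmul y b =>
      have e : onValues U D (β x y ⊗ₜ[ℝ] (a * b)) = β x y ⊗ₜ D (a * b) := rfl
      rw [extend_tmul, e, hD.leibniz b ha, TensorProduct.tmul_add, tmul_units_smul]
      rfl
  · intro s s' h h'
    simp only [map_add, LinearMap.add_apply, h, h', smul_add]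
    abel

theorem map_extend (β : V →ₗ[ℝ] W →ₗ[ℝ] U) (β' : V →ₗ[ℝ] W' →ₗ[ℝ] V') (L : W →ₗ[ℝ] W')
    (L' : U →ₗ[ℝ] V') (h : ∀ x y, L' (β x y) = β' x (L y)) (s : V ⊗[ℝ] A) (t : W ⊗[ℝ] A) :
    TensorProduct.map L' LinearMap.id (extend A β s t) =
      extend A β' s (TensorProduct.map L LinearMap.id t) := by
  induction s using TensorProduct.induction_on with
  | zero => simp
  | add s s' hs hs' => simp only [map_add, LinearMap.add_apply, hs, hs']
  | tmul x a =>
    induction t using TensorProduct.induction_on with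
    | zero => simp
    | add t t' ht ht' => simp only [map_add, ht, ht']
    | tmul y b => simp only [extend_tmul, TensorProduct.map_tmul, h]; rfl

theorem extend_map (β : V' →ₗ[ℝ] W →ₗ[ℝ] U) (β' : V →ₗ[ℝ] W →ₗ[ℝ] U) (L : V →ₗ[ℝ] V')
    (h : ∀ x y, β (L x) y = β' x y) (s : V ⊗[ℝ] A) (t : W ⊗[ℝ] A) :
    extend A β (TensorProduct.map L LinearMap.id s) t = extend A β' s t := by
  induction s using TensorProduct.induction_on with
  | zero => simp
  | add s s' hs hs' => simp only [map_add, LinearMap.add_apply, hs, hs']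
  | tmul x a =>
    induction t using TensorProduct.induction_on with
    | zero => simp
    | add t t' ht ht' => simp only [map_add, ht, ht']
    | tmul y b => simp only [extend_tmul, TensorProduct.map_tmul, h]; rfl

end Graded

/-! ### Crossed module identities with graded coefficients -/

theorem exists_continuousLinearMap_eq {V : Type u} [NormedAddCommGroup V] [NormedSpace ℝ V]
    [FiniteDimensional ℝ V] (ℓ : V →ₗ[ℝ] ℝ) : ∃ L : V →L[ℝ] ℝ, ∀ v, L v = ℓ v :=
  ⟨LinearMap.toContinuousLinearMap ℓ, fun _ => rfl⟩

namespace LieCrossedModule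

variable {VE : Type u} [NormedAddCommGroup VE] [NormedSpace ℝ VE] [FiniteDimensional ℝ VE]
  {E : Type u} [TopologicalSpace E] [ChartedSpace VE E] [Group E] [LieGroup 𝓘(ℝ, VE) ∞ E]
  {VG : Type u} [NormedAddCommGroup VG] [NormedSpace ℝ VG] [FiniteDimensional ℝ VG]
  {G : Type u} [TopologicalSpace G] [ChartedSpace VG G] [Group G] [LieGroup 𝓘(ℝ, VG) ∞ G]
  (M : LieCrossedModule VE E VG G)
  {A : Type v} [Ring A] [Algebra ℝ A] {𝒜 : ℤ → Submodule ℝ A} [GradedAlgebra 𝒜]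

theorem lieBracket_skew (x y : LieAlg VG G) : lieBracket VG G x y = -lieBracket VG G y x :=
  br_skew (V := VG) (G := G) x y

theorem act_dμ_ddμ (h𝒜 : IsFunctionAlgebra.{u, v} 𝒜) (g : Point 𝒜 𝓘(ℝ, VG) G)
    (s : LieAlg VG G ⊗[ℝ] A) (X : LieAlg VE E ⊗[ℝ] A) : g.act M.dμ (extend A M.ddμ s X) =
      extend A M.ddμ (g.act adjoint s) (g.act M.dμ X) :=
  g.act_extend h𝒜 adjoint M.dμ M.dμ M.ddμ (fun g x X => M.actE_adE g x X) s X

theorem act_dμ_bracket (h𝒜 : IsFunctionAlgebra.{u, v} 𝒜) (g : Point 𝒜 𝓘(ℝ, VG) G)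
    (X Y : LieAlg VE E ⊗[ℝ] A) : g.act M.dμ (extend A (lieBracket VE E) X Y) =
      extend A (lieBracket VE E) (g.act M.dμ X) (g.act M.dμ Y) :=
  g.act_extend h𝒜 M.dμ M.dμ M.dμ (lieBracket VE E) (fun g X Y => M.actE_br g X Y) X Y

theorem act_adjoint_bracket (h𝒜 : IsFunctionAlgebra.{u, v} 𝒜) (g : Point 𝒜 𝓘(ℝ, VG) G)
    (s t : LieAlg VG G ⊗[ℝ] A) : g.act adjoint (extend A (lieBracket VG G) s t) =
      extend A (lieBracket VG G) (g.act adjoint s) (g.act adjoint t) :=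
  g.act_extend h𝒜 adjoint adjoint adjoint (lieBracket VG G) (fun g x y => Ad_br (V := VG) g x y) s t

theorem onTau_act (g : Point 𝒜 𝓘(ℝ, VG) G) (X : LieAlg VE E ⊗[ℝ] A) :
    M.onTau (g.act M.dμ X) = g.act adjoint (M.onTau X) :=
  g.act_map M.dμ adjoint M.dτ (fun g X => M.tau_actE g X) X

/-- The infinitesimal equivariance of `τ`. -/
theorem onTau_ddμ (s : LieAlg VG G ⊗[ℝ] A) (X : LieAlg VE E ⊗[ℝ] A) :
    M.onTau (extend A M.ddμ s X) = extend A (lieBracket VG G) s (M.onTau X) :=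
  map_extend _ _ _ _ (fun x X => M.tau_adE x X) s X

/-- The infinitesimal Peiffer identity. -/
theorem ddμ_onTau (X Y : LieAlg VE E ⊗[ℝ] A) :
    extend A M.ddμ (M.onTau X) Y = extend A (lieBracket VE E) X Y :=
  extend_map _ _ _ (fun X Y => M.adE_tau X Y) X Y

theorem ddμ_bracket_left (h𝒜 : IsFunctionAlgebra.{u, v} 𝒜) {p q : ℤ} {s t : LieAlg VG G ⊗[ℝ] A}
    (hs : s ∈ valued (LieAlg VG G) (𝒜 p)) (ht : t ∈ valued (LieAlg VG G) (𝒜 q))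
    (X : LieAlg VE E ⊗[ℝ] A) : extend A M.ddμ (extend A (lieBracket VG G) s t) X =
      extend A M.ddμ s (extend A M.ddμ t X) -
        (p * q).negOnePow • extend A M.ddμ t (extend A M.ddμ s X) :=
  extend_rep h𝒜 _ _ (fun x y X => M.adE_br_left x y X) hs ht X

theorem ddμ_bracket_right (h𝒜 : IsFunctionAlgebra.{u, v} 𝒜) {p q : ℤ} {s : LieAlg VG G ⊗[ℝ] A}
    {X : LieAlg VE E ⊗[ℝ] A} (hs : s ∈ valued (LieAlg VG G) (𝒜 p))
    (hX : X ∈ valued (LieAlg VE E) (𝒜 q)) (Y : LieAlg VE E ⊗[ℝ] A) :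
    extend A M.ddμ s (extend A (lieBracket VE E) X Y) =
      extend A (lieBracket VE E) (extend A M.ddμ s X) Y +
        (p * q).negOnePow • extend A (lieBracket VE E) X (extend A M.ddμ s Y) :=
  extend_derivation h𝒜 _ _ (fun x X Y => M.adE_br_right x X Y) hs hX Y

theorem onValues_act_adjoint (h𝒜 : IsFunctionAlgebra.{u, v} 𝒜) (g : Point 𝒜 𝓘(ℝ, VG) G)
    {p : ℤ} {D : A →ₗ[ℝ] A} (hD : IsGradedDerivation 𝒜 p D) {θ : LieAlg VG G ⊗[ℝ] A}
    (hθ : ∀ f, D (g.1 f) = g.fieldOf θ f) (s : LieAlg VG G ⊗[ℝ] A) :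
    onValues _ D (g.act adjoint s) =
      g.act adjoint (onValues _ D s) + extend A (lieBracket VG G) θ (g.act adjoint s) := by
  refine g.onValues_act h𝒜 _ _ (fun ℓ w x h => ?_) hD hθ s
  have key := exists_continuousLinearMap_eq (V := VG)
  obtain ⟨L, hL⟩ := key ℓ
  have e : (fun k : G => adjoint.coeff ℓ w (k * h)) =
      fun k => L (Ad k (Ad h (w : VG))) := by
    funext k
    exact (congrArg ℓ (Ad_mul (V := VG) k h w)).trans (hL _).symm
  refine (congrArg (fun F : G → ℝ => (der 𝓘(ℝ, VG) 𝓘(ℝ, ℝ) F 1 : VG →L[ℝ] ℝ) x) e).trans ?_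
  refine (der_clm_comp L (mdifferentiableAt_Ad (V := VG) _ (1 : G)) _).trans ?_
  exact (hL _).trans (congrArg ℓ (der_Ad (V := VG) (G := G) x (Ad h (w : VG))))

theorem onValues_act_dμ (h𝒜 : IsFunctionAlgebra.{u, v} 𝒜) (g : Point 𝒜 𝓘(ℝ, VG) G)
    {p : ℤ} {D : A →ₗ[ℝ] A} (hD : IsGradedDerivation 𝒜 p D) {θ : LieAlg VG G ⊗[ℝ] A}
    (hθ : ∀ f, D (g.1 f) = g.fieldOf θ f) (X : LieAlg VE E ⊗[ℝ] A) :
    onValues _ D (g.act M.dμ X) =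
      g.act M.dμ (onValues _ D X) + extend A M.ddμ θ (g.act M.dμ X) := by
  refine g.onValues_act h𝒜 _ _ (fun ℓ w x h => ?_) hD hθ X
  have key := exists_continuousLinearMap_eq (V := VE)
  obtain ⟨L, hL⟩ := key ℓ
  have e : (fun k : G => M.dμ.coeff ℓ w (k * h)) = fun k =>
      L (M.actE k (M.actE h (w : VE))) := by
    funext k
    exact (congrArg ℓ (M.actE_mul k h w)).trans (hL _).symm
  refine (congrArg (fun F : G → ℝ => (der 𝓘(ℝ, VG) 𝓘(ℝ, ℝ) F 1 : VG →L[ℝ] ℝ) x) e).trans ?_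
  exact (der_clm_comp L (M.mdifferentiableAt_actE _ (1 : G)) _).trans (hL _)

variable {M}

/-! ### Functions with values in the derived Lie algebra -/

section Linear

variable (p q : ℤ) (S S' T T' : M.DFun A)

theorem bracket_add_left : M.bracket p q (S + S') T = M.bracket p q S T + M.bracket p q S' T := by
  refine Prod.ext ?_ ?_
  · simp [bracket]
  · simp [bracket, smul_add]; abel

theorem bracket_add_right : M.bracket p q S (T + T') = M.bracket p q S T + M.bracket p q S T' := by
  refine Prod.ext ?_ ?_
  · simp [bracket]
  · simp [bracket, smul_add]; abel

theorem bracket_neg_left : M.bracket p q (-S) T = -M.bracket p q S T := by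
  refine Prod.ext ?_ ?_
  · simp [bracket]
  · simp [bracket]; abel

theorem bracket_neg_right : M.bracket p q S (-T) = -M.bracket p q S T := by
  refine Prod.ext ?_ ?_
  · simp [bracket]
  · simp [bracket]; abel

theorem bracket_sub_left : M.bracket p q (S - S') T = M.bracket p q S T - M.bracket p q S' T := by
  rw [sub_eq_add_neg, bracket_add_left, bracket_neg_left, sub_eq_add_neg]

theorem bracket_zero_left : M.bracket p q 0 T = 0 := by
  refine Prod.ext ?_ ?_ <;> simp [bracket]

theorem cobd_add : M.cobd p (S + S') = M.cobd p S + M.cobd p S' := by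
  refine Prod.ext ?_ ?_ <;> simp [cobd, smul_add]

theorem cobd_neg : M.cobd p (-S) = -M.cobd p S := by
  refine Prod.ext ?_ ?_ <;> simp [cobd]

theorem cobd_zero : M.cobd p (0 : M.DFun A) = 0 := by
  refine Prod.ext ?_ ?_ <;> simp [cobd]

theorem onDFun_add (D : A →ₗ[ℝ] A) : M.onDFun D (S + S') = M.onDFun D S + M.onDFun D S' := by
  refine Prod.ext ?_ ?_ <;> simp [onDFun]

theorem onDFun_neg (D : A →ₗ[ℝ] A) : M.onDFun D (-S) = -M.onDFun D S := by
  refine Prod.ext ?_ ?_ <;> simp [onDFun]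

theorem onDFun_zero (D : A →ₗ[ℝ] A) : M.onDFun D 0 = 0 := by
  refine Prod.ext ?_ ?_ <;> simp [onDFun]

end Linear

theorem bracket_one_one_comm (h𝒜 : IsFunctionAlgebra.{u, v} 𝒜) {S T : M.DFun A}
    (hS : S ∈ M.degreePart 𝒜 1) (hT : T ∈ M.degreePart 𝒜 1) :
    M.bracket 1 1 S T = M.bracket 1 1 T S := by
  refine Prod.ext ?_ ?_
  · have h := extend_skew h𝒜 (lieBracket VG G) lieBracket_skew hS.1 hT.1
    simpa [bracket] using h
  · simp [bracket, add_comm]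

theorem constants_le_degreePart (C : Subalgebra ℝ A) : M.constants 𝒜 C ≤ M.degreePart 𝒜 0 := by
  intro Z hZ
  refine ⟨?_, ?_⟩
  · refine valued_induction (P := fun s => s ∈ valued _ (𝒜 0)) (zero_mem _) ?_
      (fun _ _ => add_mem) hZ.1
    exact fun x a ha => tmul_mem_valued x ha.2
  · refine valued_induction (P := fun s => s ∈ valued _ (𝒜 (0 + 1))) (zero_mem _) ?_
      (fun _ _ => add_mem) hZ.2
    exact fun x a ha => tmul_mem_valued x (by simpa using ha.2)

/-! ### Functions with values in the derived Lie group -/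

namespace DPoint

section Linear

variable (Ψ : DPoint 𝒜 M) (S T : M.DFun A)

theorem Ad_add : Ψ.Ad (S + T) = Ψ.Ad S + Ψ.Ad T := by
  refine Prod.ext ?_ ?_
  · simp [Ad]
  · simp [Ad]; abel

theorem Ad_smul (c : ℝ) : Ψ.Ad (c • S) = c • Ψ.Ad S := by
  refine Prod.ext ?_ ?_
  · simp [Ad]
  · simp [Ad, smul_sub]

theorem Ad_neg : Ψ.Ad (-S) = -Ψ.Ad S := by
  simpa using Ad_smul Ψ S (-1)

theorem Ad_sub : Ψ.Ad (S - T) = Ψ.Ad S - Ψ.Ad T := by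
  rw [sub_eq_add_neg, Ad_add, Ad_neg, sub_eq_add_neg]

theorem Ad_zero : Ψ.Ad 0 = 0 := by
  simpa using Ad_smul Ψ (0 : M.DFun A) 0

end Linear

theorem Ad_mem (Ψ : DPoint 𝒜 M) {p : ℤ} {S : M.DFun A} (hS : S ∈ M.degreePart 𝒜 p) :
    Ψ.Ad S ∈ M.degreePart 𝒜 p :=
  ⟨Ψ.g.act_mem_valued _ hS.1, sub_mem (Ψ.g.act_mem_valued _ hS.2)
    (extend_mem_valued_add _ (Ψ.g.act_mem_valued _ hS.1) Ψ.J_mem)⟩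

theorem Ad_bracket (h𝒜 : IsFunctionAlgebra.{u, v} 𝒜) (Ψ : DPoint 𝒜 M) {p q : ℤ}
    {S T : M.DFun A} (hS : S ∈ M.degreePart 𝒜 p) (hT : T ∈ M.degreePart 𝒜 q) :
    Ψ.Ad (M.bracket p q S T) = M.bracket p q (Ψ.Ad S) (Ψ.Ad T) := by
  refine Prod.ext (act_adjoint_bracket h𝒜 _ _ _) ?_
  simp only [Ad, bracket, map_sub, map_units_smul, M.act_dμ_ddμ h𝒜, act_adjoint_bracket h𝒜]
  rw [M.ddμ_bracket_left h𝒜 (Ψ.g.act_mem_valued _ hS.1) (Ψ.g.act_mem_valued _ hT.1)]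
  simp only [smul_sub]
  abel

/-- The Leibniz rule for the adjoint action. -/
theorem onDFun_Ad (h𝒜 : IsFunctionAlgebra.{u, v} 𝒜) {Ψ : DPoint 𝒜 M} {k p : ℤ} {D : A →ₗ[ℝ] A}
    (hD : IsGradedDerivation 𝒜 k D) {L : M.DFun A} (hL : L.1 ∈ valued (LieAlg VG G) (𝒜 k))
    (hΨ : Ψ.HasLogDeriv D L) {S : M.DFun A} (hS : S ∈ M.degreePart 𝒜 p) :
    M.onDFun D (Ψ.Ad S) = Ψ.Ad (M.onDFun D S) + M.bracket k p L (Ψ.Ad S) := by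
  refine Prod.ext (onValues_act_adjoint h𝒜 _ hD hΨ.1 _) ?_
  simp only [onDFun, Ad, bracket, map_sub, Prod.snd_add, hΨ.2]
  rw [M.onValues_act_dμ h𝒜 _ hD hΨ.1,
    onValues_extend M.ddμ hD (Ψ.g.act_mem_valued adjoint hS.1), onValues_act_adjoint h𝒜 _ hD hΨ.1,
    map_add, LinearMap.add_apply, M.ddμ_bracket_left h𝒜 hL (Ψ.g.act_mem_valued _ hS.1)]
  simp only [smul_sub]
  abel

/-- The Leibniz rule for the coboundary of the adjoint action. The second component is an identity
in `𝔢`, where it follows from the Peiffer identity and the action of `𝔤` by derivations. -/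
theorem cobd_Ad (h𝒜 : IsFunctionAlgebra.{u, v} 𝒜) (Ψ : DPoint 𝒜 M) {p : ℤ}
    {S : M.DFun A} (hS : S ∈ M.degreePart 𝒜 p) :
    M.cobd p (Ψ.Ad S) = Ψ.Ad (M.cobd p S) + M.bracket 1 p Ψ.cobdLog (Ψ.Ad S) := by
  have hs := Ψ.g.act_mem_valued adjoint hS.1
  have hX := Ψ.g.act_mem_valued M.dμ hS.2
  have hsJ := extend_mem_valued_add M.ddμ hs Ψ.J_mem
  -- The signs below are those of exchanging arguments of degrees `p`, `p + 1` and `1`.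
  have e1 := extend_skew h𝒜 (lieBracket VG G) lieBracket_skew hs (map_mem_valued M.dτ Ψ.J_mem)
  have e2 := extend_skew h𝒜 (lieBracket VE E) lieBracket_skew hX Ψ.J_mem
  have e3 := extend_skew h𝒜 (lieBracket VE E) lieBracket_skew hsJ Ψ.J_mem
  have e4 := M.ddμ_bracket_right h𝒜 hs Ψ.J_mem Ψ.J
  rw [e3] at e4
  change extend A (lieBracket VG G) _ (M.onTau Ψ.J) =
    -((p * 1).negOnePow • extend A (lieBracket VG G) (M.onTau Ψ.J) _) at e1
  simp only [mul_one, Int.negOnePow_succ] at e1 e2 e4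
  refine Prod.ext ?_ ?_
  · simp only [cobd, Ad, bracket, cobdLog, Prod.fst_add, map_sub, map_units_smul, M.onTau_act,
      M.onTau_ddμ, e1]
    rcases Int.units_eq_one_or p.negOnePow with h | h
    · rw [h]; simp
    · rw [h]; simp; abel
  · simp only [cobd, Ad, bracket, cobdLog, Prod.snd_add, map_sub, map_units_smul, map_zero,
      LinearMap.smul_apply, ← M.onTau_act, M.ddμ_onTau, map_neg, map_smul, e4, one_mul]
    rw [e2]
    rcases Int.units_eq_one_or p.negOnePow with h | h <;> rw [h] <;> simp <;> module

theorem Ad_one (S : M.DFun A) : (DPoint.one M 𝒜).Ad S = S := by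
  have h1 := Point.act_const_one (𝒜 := 𝒜) (adjoint (V := VG) (G := G)) (TwoGauge.Ad_one (V := VG)) S.1
  have h2 := Point.act_const_one (𝒜 := 𝒜) M.dμ M.actE_one S.2
  refine Prod.ext h1 ?_
  simp only [Ad, one, map_zero, sub_zero, h2]

theorem cobdLog_one : (DPoint.one M 𝒜).cobdLog = 0 := by
  refine Prod.ext ?_ ?_ <;> simp [cobdLog, one]

variable [T2Space G] [SecondCountableTopology G]

theorem hasLogDeriv_one {k : ℤ} {D : A →ₗ[ℝ] A} (hD : IsGradedDerivation 𝒜 k D) :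
    (DPoint.one M 𝒜).HasLogDeriv D 0 := by
  have h1 : D 1 = 0 := by
    have h := hD.leibniz (1 : A) (SetLike.one_mem_graded 𝒜)
    simpa using h
  refine ⟨fun f => ?_, by simp [one]⟩
  have h2 : (DPoint.one M 𝒜).g.1 f = (f 1) • (1 : A) := Algebra.algebraMap_eq_smul_one (f 1)
  rw [h2, map_smul, h1, smul_zero]
  exact (Point.fieldOf_zero _ f).symm

theorem HasLogDeriv.inv (h𝒜 : IsFunctionAlgebra.{u, v} 𝒜) {Ψ : DPoint 𝒜 M} {k : ℤ}
    {D : A →ₗ[ℝ] A} (hD : IsGradedDerivation 𝒜 k D) {L : M.DFun A} (hΨ : Ψ.HasLogDeriv D L) :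
    Ψ.inv.HasLogDeriv D (-Ψ.inv.Ad L) := by
  have h1 := Point.logDeriv_inv h𝒜 hΨ.1
  refine ⟨h1, ?_⟩
  simp only [Ad, DPoint.inv, Prod.fst_neg, Prod.snd_neg, hΨ.2, map_neg, map_sub,
    LinearMap.neg_apply]
  rw [M.onValues_act_dμ h𝒜 _ hD h1, M.act_dμ_ddμ h𝒜]
  simp only [map_neg, LinearMap.neg_apply]
  abel

theorem Ad_mul (h𝒜 : IsFunctionAlgebra.{u, v} 𝒜) (Ψ Φ : DPoint 𝒜 M) (S : M.DFun A) :
    (Ψ.mul h𝒜 Φ).Ad S = Ψ.Ad (Φ.Ad S) := by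
  have h1 := Ψ.g.act_mul h𝒜 Φ.g (adjoint (V := VG) (G := G)) (TwoGauge.Ad_mul (V := VG)) S.1
  have h2 := Ψ.g.act_mul h𝒜 Φ.g M.dμ M.actE_mul S.2
  refine Prod.ext h1 ?_
  simp only [Ad, mul, h1, h2, map_add, map_sub, M.act_dμ_ddμ h𝒜]
  abel

theorem cobdLog_mul (h𝒜 : IsFunctionAlgebra.{u, v} 𝒜) (Ψ Φ : DPoint 𝒜 M) :
    (Ψ.mul h𝒜 Φ).cobdLog = Ψ.cobdLog + Ψ.Ad Φ.cobdLog := by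
  refine Prod.ext ?_ ?_
  · simp [cobdLog, mul, Ad, onTau_act]
  · have h := extend_skew h𝒜 (lieBracket VE E) lieBracket_skew Ψ.J_mem
      (Ψ.g.act_mem_valued M.dμ Φ.J_mem)
    simp only [mul_one, Int.negOnePow_one, Units.neg_smul, one_smul, neg_neg] at h
    simp only [cobdLog, mul, Ad, Prod.snd_add, ← M.onTau_act, M.ddμ_onTau, map_add, map_neg,
      map_smul, LinearMap.add_apply, M.act_dμ_bracket h𝒜, h]
    module

theorem HasLogDeriv.mul (h𝒜 : IsFunctionAlgebra.{u, v} 𝒜) {Ψ Φ : DPoint 𝒜 M} {k : ℤ}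
    {D : A →ₗ[ℝ] A} (hD : IsGradedDerivation 𝒜 k D) {L L' : M.DFun A}
    (hL : L.1 ∈ valued (LieAlg VG G) (𝒜 k)) (hL' : L'.1 ∈ valued (LieAlg VG G) (𝒜 k))
    (hΨ : Ψ.HasLogDeriv D L) (hΦ : Φ.HasLogDeriv D L') :
    (Ψ.mul h𝒜 Φ).HasLogDeriv D (L + Ψ.Ad L') := by
  refine ⟨Point.logDeriv_mul h𝒜 hD hL hL' hΨ.1 hΦ.1, ?_⟩
  simp only [Ad, DPoint.mul, Prod.fst_add, Prod.snd_add, hΨ.2, hΦ.2, map_add, map_sub,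
    LinearMap.add_apply]
  rw [M.onValues_act_dμ h𝒜 _ hD hΨ.1, M.act_dμ_ddμ h𝒜]
  abel

theorem mul_assoc (h𝒜 : IsFunctionAlgebra.{u, v} 𝒜) (Ψ Φ Θ : DPoint 𝒜 M) :
    (Ψ.mul h𝒜 Φ).mul h𝒜 Θ = Ψ.mul h𝒜 (Φ.mul h𝒜 Θ) := by
  refine DPoint.ext (Point.mul_assoc h𝒜 _ _ _) ?_
  simp only [mul, Ψ.g.act_mul h𝒜 Φ.g M.dμ M.actE_mul, map_add, add_assoc]

theorem one_mul (h𝒜 : IsFunctionAlgebra.{u, v} 𝒜) (Ψ : DPoint 𝒜 M) :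
    (DPoint.one M 𝒜).mul h𝒜 Ψ = Ψ := by
  refine DPoint.ext (Point.one_mul h𝒜 _) ?_
  simp only [mul, one, zero_add]
  exact Point.act_const_one M.dμ M.actE_one Ψ.J

theorem inv_mul (h𝒜 : IsFunctionAlgebra.{u, v} 𝒜) (Ψ : DPoint 𝒜 M) :
    Ψ.inv.mul h𝒜 Ψ = DPoint.one M 𝒜 := by
  refine DPoint.ext (Point.inv_mul h𝒜 _) ?_
  simp [mul, inv, one]

theorem Ad_inv_Ad (h𝒜 : IsFunctionAlgebra.{u, v} 𝒜) (Ψ : DPoint 𝒜 M) (S : M.DFun A) :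
    Ψ.inv.Ad (Ψ.Ad S) = S := by
  rw [← Ad_mul h𝒜, inv_mul, Ad_one]

theorem cobdLog_inv (h𝒜 : IsFunctionAlgebra.{u, v} 𝒜) (Ψ : DPoint 𝒜 M) :
    Ψ.inv.cobdLog = -Ψ.inv.Ad Ψ.cobdLog := by
  rw [eq_neg_iff_add_eq_zero, ← cobdLog_mul h𝒜, inv_mul, cobdLog_one]

end DPoint

end LieCrossedModule

/-! ### Transforms of 2-connections and products of 1-gauge transformations -/

open LieCrossedModule

variable {VE : Type u} [NormedAddCommGroup VE] [NormedSpace ℝ VE] [FiniteDimensional ℝ VE]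
  {E : Type u} [TopologicalSpace E] [ChartedSpace VE E] [Group E] [LieGroup 𝓘(ℝ, VE) ∞ E]
  {VG : Type u} [NormedAddCommGroup VG] [NormedSpace ℝ VG] [FiniteDimensional ℝ VG]
  {G : Type u} [TopologicalSpace G] [ChartedSpace VG G] [Group G] [LieGroup 𝓘(ℝ, VG) ∞ G]
  {A : Type v} [Ring A] [Algebra ℝ A] {M : LieCrossedModule VE E VG G}
  {𝒜 : ℤ → Submodule ℝ A} [GradedAlgebra 𝒜] {O : Operation M 𝒜}

theorem LieCrossedModule.DPoint.cobdLog_fst_mem (Ψ : M.DPoint 𝒜) :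
    Ψ.cobdLog.1 ∈ valued (LieAlg VG G) (𝒜 1) :=
  map_mem_valued M.dτ Ψ.J_mem

namespace IsOneGauge

variable {Ψ Φ : M.DPoint 𝒜} {Υ Ξ A₁ B₁ B₂ : M.DFun A}

/-- The logarithmic derivative prescribed for the differential has degree `1`. -/
theorem logDeriv_mem (h : IsOneGauge O Ψ Υ) :
    (-Ψ.cobdLog - Υ).1 ∈ valued (LieAlg VG G) (𝒜 1) :=
  sub_mem (neg_mem Ψ.cobdLog_fst_mem) h.shift_mem.1

/-- The logarithmic derivative prescribed for the Lie derivative along `Z` has degree `0`. -/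
theorem lieLogDeriv_mem (Ψ : M.DPoint 𝒜) (Z : M.constants 𝒜 O.const) :
    (-(Z : M.DFun A) + Ψ.Ad Z).1 ∈ valued (LieAlg VG G) (𝒜 0) :=
  have h := constants_le_degreePart O.const Z.2
  add_mem (neg_mem h.1) (Ψ.Ad_mem h).1

/-- The transform of a solution of the first structure equation is a solution. The element `B₁`
is arbitrary, so that the equation also applies to the shift component of another 1-gauge
transformation, with `B₁ = 0`. -/
theorem d_transform (h : IsOneGauge O Ψ Υ) (hA : A₁ ∈ M.degreePart 𝒜 1)
    (hd : M.onDFun O.d A₁ = -((1 / 2 : ℝ) • M.bracket 1 1 A₁ A₁) - M.cobd 1 A₁ + B₁) :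
    M.onDFun O.d (Ψ.Ad A₁ + Υ) = -((1 / 2 : ℝ) • M.bracket 1 1 (Ψ.Ad A₁ + Υ) (Ψ.Ad A₁ + Υ)) -
      M.cobd 1 (Ψ.Ad A₁ + Υ) + Ψ.Ad B₁ := by
  have h𝒜 := O.isFunctionAlgebra
  have hc := bracket_one_one_comm h𝒜 (Ψ.Ad_mem hA) h.shift_mem
  rw [onDFun_add, DPoint.onDFun_Ad h𝒜 O.derivation_d h.logDeriv_mem h.d_trans hA, hd, h.d_shift,
    cobd_add, DPoint.cobd_Ad h𝒜 Ψ hA]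
  simp only [DPoint.Ad_add, DPoint.Ad_sub, DPoint.Ad_neg, DPoint.Ad_smul,
    DPoint.Ad_bracket h𝒜 Ψ hA hA, bracket_add_left, bracket_add_right, bracket_sub_left,
    bracket_neg_left, hc]
  module

theorem isTwoConnection (h : IsOneGauge O Ψ Υ) (hA : IsTwoConnection O A₁ B₁) :
    IsTwoConnection O (Ψ.Ad A₁ + Υ) (Ψ.Ad B₁) where
  conn_mem := add_mem (Ψ.Ad_mem hA.conn_mem) h.shift_mem
  curv_mem := Ψ.Ad_mem hA.curv_mem
  d_conn := h.d_transform hA.conn_mem hA.d_conn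
  d_curv := by
    have h𝒜 := O.isFunctionAlgebra
    rw [DPoint.onDFun_Ad h𝒜 O.derivation_d h.logDeriv_mem h.d_trans hA.curv_mem, hA.d_curv,
      DPoint.cobd_Ad h𝒜 Ψ hA.curv_mem, DPoint.Ad_sub, DPoint.Ad_neg,
      DPoint.Ad_bracket h𝒜 Ψ hA.conn_mem hA.curv_mem, bracket_add_left, bracket_sub_left,
      bracket_neg_left]
    abel
  j_conn Z := by
    rw [onDFun_add, DPoint.onDFun_Ad O.isFunctionAlgebra (O.derivation_j Z) (zero_mem _)
      (h.j_trans Z) hA.conn_mem, hA.j_conn, h.j_shift, bracket_zero_left]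
    abel
  j_curv Z := by
    rw [DPoint.onDFun_Ad O.isFunctionAlgebra (O.derivation_j Z) (zero_mem _) (h.j_trans Z)
      hA.curv_mem, hA.j_curv, DPoint.Ad_zero, bracket_zero_left, add_zero]
  l_conn Z := by
    have h𝒜 := O.isFunctionAlgebra
    rw [onDFun_add, DPoint.onDFun_Ad h𝒜 (O.derivation_l Z) (lieLogDeriv_mem Ψ Z) (h.l_trans Z)
      hA.conn_mem, hA.l_conn, h.l_shift, DPoint.Ad_add, DPoint.Ad_neg,
      DPoint.Ad_bracket h𝒜 Ψ (constants_le_degreePart O.const Z.2) hA.conn_mem,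
      bracket_add_left, bracket_neg_left, bracket_add_right]
    abel
  l_curv Z := by
    have h𝒜 := O.isFunctionAlgebra
    rw [DPoint.onDFun_Ad h𝒜 (O.derivation_l Z) (lieLogDeriv_mem Ψ Z) (h.l_trans Z)
      hA.curv_mem, hA.l_curv, DPoint.Ad_neg,
      DPoint.Ad_bracket h𝒜 Ψ (constants_le_degreePart O.const Z.2) hA.curv_mem,
      bracket_add_left, bracket_neg_left]
    abel

variable [T2Space G] [SecondCountableTopology G]

theorem one (O : Operation M 𝒜) : IsOneGauge O (DPoint.one M 𝒜) 0 where
  shift_mem := zero_mem _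
  d_trans := by
    rw [DPoint.cobdLog_one, neg_zero, sub_zero]
    exact DPoint.hasLogDeriv_one O.derivation_d
  d_shift := by
    rw [onDFun_zero, bracket_zero_left, cobd_zero, smul_zero, neg_zero, sub_zero]
  j_trans Z := DPoint.hasLogDeriv_one (O.derivation_j Z)
  j_shift Z := by rw [onDFun_zero, DPoint.Ad_one, sub_self]
  l_trans Z := by
    rw [DPoint.Ad_one, neg_add_cancel]
    exact DPoint.hasLogDeriv_one (O.derivation_l Z)
  l_shift Z := by
    rw [onDFun_zero, DPoint.Ad_one]
    refine Prod.ext ?_ ?_ <;> simp [bracket]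

theorem mul (hΦ : IsOneGauge O Φ Ξ) (hΨ : IsOneGauge O Ψ Υ) :
    IsOneGauge O (Φ.mul O.isFunctionAlgebra Ψ) (Ξ + Φ.Ad Υ) where
  shift_mem := add_mem hΦ.shift_mem (Φ.Ad_mem hΨ.shift_mem)
  d_trans := by
    convert DPoint.HasLogDeriv.mul O.isFunctionAlgebra O.derivation_d hΦ.logDeriv_mem
      hΨ.logDeriv_mem hΦ.d_trans hΨ.d_trans using 1
    rw [DPoint.cobdLog_mul, DPoint.Ad_sub, DPoint.Ad_neg]
    abel
  d_shift := by
    have h := hΦ.d_transform (B₁ := 0) hΨ.shift_mem (by rw [hΨ.d_shift, add_zero])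
    rwa [DPoint.Ad_zero, add_zero, add_comm (Φ.Ad Υ)] at h
  j_trans Z := by
    convert DPoint.HasLogDeriv.mul O.isFunctionAlgebra (O.derivation_j Z) (zero_mem _)
      (zero_mem _) (hΦ.j_trans Z) (hΨ.j_trans Z) using 1
    rw [DPoint.Ad_zero, add_zero]
  j_shift Z := by
    rw [onDFun_add, DPoint.onDFun_Ad O.isFunctionAlgebra (O.derivation_j Z) (zero_mem _)
      (hΦ.j_trans Z) hΨ.shift_mem, hΦ.j_shift, hΨ.j_shift, bracket_zero_left, DPoint.Ad_mul,
      DPoint.Ad_sub]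
    abel
  l_trans Z := by
    convert DPoint.HasLogDeriv.mul O.isFunctionAlgebra (O.derivation_l Z) (lieLogDeriv_mem Φ Z)
      (lieLogDeriv_mem Ψ Z) (hΦ.l_trans Z) (hΨ.l_trans Z) using 1
    rw [DPoint.Ad_mul, DPoint.Ad_add, DPoint.Ad_neg]
    abel
  l_shift Z := by
    have h𝒜 := O.isFunctionAlgebra
    rw [onDFun_add, DPoint.onDFun_Ad h𝒜 (O.derivation_l Z) (lieLogDeriv_mem Φ Z) (hΦ.l_trans Z)
      hΨ.shift_mem, hΦ.l_shift, hΨ.l_shift, DPoint.Ad_mul, DPoint.Ad_sub, DPoint.Ad_add,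
      DPoint.Ad_neg, DPoint.Ad_bracket h𝒜 Φ (constants_le_degreePart O.const Z.2) hΨ.shift_mem,
      bracket_add_left, bracket_neg_left, bracket_add_right]
    abel

theorem inv (h : IsOneGauge O Ψ Υ) : IsOneGauge O Ψ.inv (-Ψ.inv.Ad Υ) := by
  have h𝒜 := O.isFunctionAlgebra
  have hm := Ψ.inv.Ad_mem h.shift_mem
  have hd : Ψ.inv.HasLogDeriv O.d (-Ψ.inv.cobdLog - -Ψ.inv.Ad Υ) := by
    convert DPoint.HasLogDeriv.inv h𝒜 O.derivation_d h.d_trans using 1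
    rw [DPoint.cobdLog_inv h𝒜, DPoint.Ad_sub, DPoint.Ad_neg]
    abel
  have hl : ∀ Z : M.constants 𝒜 O.const, Ψ.inv.HasLogDeriv (O.l Z) (-Z + Ψ.inv.Ad Z) := by
    intro Z
    convert DPoint.HasLogDeriv.inv h𝒜 (O.derivation_l Z) (h.l_trans Z) using 1
    rw [DPoint.Ad_add, DPoint.Ad_neg, DPoint.Ad_inv_Ad h𝒜]
    abel
  have hj : ∀ Z, Ψ.inv.HasLogDeriv (O.j Z) 0 := by
    intro Z
    convert DPoint.HasLogDeriv.inv h𝒜 (O.derivation_j Z) (h.j_trans Z) using 1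
    rw [DPoint.Ad_zero, neg_zero]
  refine ⟨neg_mem hm, hd, ?_, hj, fun Z => ?_, hl, fun Z => ?_⟩
  · rw [onDFun_neg, DPoint.onDFun_Ad h𝒜 O.derivation_d
      (sub_mem (neg_mem Ψ.inv.cobdLog_fst_mem) (neg_mem hm).1) hd h.shift_mem, h.d_shift,
      cobd_neg, DPoint.cobd_Ad h𝒜 _ h.shift_mem]
    simp only [DPoint.Ad_sub, DPoint.Ad_neg, DPoint.Ad_smul, bracket_sub_left, bracket_neg_left,
      bracket_neg_right, DPoint.Ad_bracket h𝒜 Ψ.inv h.shift_mem h.shift_mem]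
    module
  · rw [onDFun_neg, DPoint.onDFun_Ad h𝒜 (O.derivation_j Z) (zero_mem _) (hj Z) h.shift_mem,
      h.j_shift, bracket_zero_left, DPoint.Ad_sub, DPoint.Ad_inv_Ad h𝒜]
    abel
  · rw [onDFun_neg, DPoint.onDFun_Ad h𝒜 (O.derivation_l Z) (lieLogDeriv_mem _ Z) (hl Z)
      h.shift_mem, h.l_shift]
    simp only [DPoint.Ad_sub, DPoint.Ad_add, DPoint.Ad_neg, bracket_add_left, bracket_neg_left,
      bracket_neg_right, DPoint.Ad_inv_Ad h𝒜,
      DPoint.Ad_bracket h𝒜 Ψ.inv (constants_le_degreePart O.const Z.2) h.shift_mem]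
    abel

/-- The shift component is determined by the logarithmic derivative of the transformation
component. -/
theorem shift_eq (h : IsOneGauge O Ψ Υ) (h' : IsOneGauge O Ψ Ξ) : Υ = Ξ := by
  have key : ((-Ψ.cobdLog - Υ).1 - (-Ψ.cobdLog - Ξ).1) = 0 := by
    refine Point.eq_zero_of_fieldOf_eq_zero O.isFunctionAlgebra
      (sub_mem h.logDeriv_mem h'.logDeriv_mem) (Ψ := Ψ.g) fun f => ?_
    rw [sub_eq_add_neg, Point.fieldOf_add, Point.fieldOf_neg, ← h.d_trans.1, ← h'.d_trans.1,
      add_neg_cancel]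
  have h1 := sub_eq_zero.mp key
  have h2 : (-Ψ.cobdLog - Υ).2 = (-Ψ.cobdLog - Ξ).2 := by
    rw [h.d_trans.2, h'.d_trans.2, h1]
  exact sub_right_injective (Prod.ext h1 h2)

end IsOneGauge

/-! ### The group of 1-gauge transformations and its action -/

variable [T2Space G] [SecondCountableTopology G]

theorem OneGauge.trans_injective :
    Function.Injective (fun Φ : OneGauge O => Φ.trans) := by
  rintro ⟨Ψ, Υ, h⟩ ⟨_, Ξ, h'⟩ rfl
  obtain rfl := h.shift_eq h'
  rfl

variable (O) in
/-- The group of 1-gauge transformations. Its laws are those of the derived Lie group, since a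
1-gauge transformation is determined by its transformation component. -/
abbrev oneGaugeGroup : Group (OneGauge O) :=
  letI : Mul (OneGauge O) := ⟨fun Φ Ψ => ⟨_, _, Φ.isOneGauge.mul Ψ.isOneGauge⟩⟩
  letI : One (OneGauge O) := ⟨⟨_, _, IsOneGauge.one O⟩⟩
  letI : Inv (OneGauge O) := ⟨fun Φ => ⟨_, _, Φ.isOneGauge.inv⟩⟩
  Group.ofLeftAxioms
    (fun _ _ _ => OneGauge.trans_injective (DPoint.mul_assoc O.isFunctionAlgebra _ _ _))
    (fun _ => OneGauge.trans_injective (DPoint.one_mul O.isFunctionAlgebra _))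
    (fun _ => OneGauge.trans_injective (DPoint.inv_mul O.isFunctionAlgebra _))

theorem TwoConnection.ext {B B' : TwoConnection O} (h₁ : B.conn = B'.conn)
    (h₂ : B.curv = B'.curv) : B = B' := by
  cases B; cases B'; cases h₁; cases h₂; rfl

variable (O) in
/-- The action of the group of 1-gauge transformations on the 2-connections. -/
abbrev oneGaugeAction : letI := oneGaugeGroup O; MulAction (OneGauge O) (TwoConnection O) :=
  letI := oneGaugeGroup O
  { smul := fun Φ B => ⟨_, _, Φ.isOneGauge.isTwoConnection B.isTwoConnection⟩
    one_smul := fun B => TwoConnection.ext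
      ((add_zero _).trans (DPoint.Ad_one B.conn)) (DPoint.Ad_one B.curv)
    mul_smul := fun Φ Ψ B => by
      refine TwoConnection.ext ?_ (DPoint.Ad_mul O.isFunctionAlgebra _ _ _)
      change (Φ.trans.mul _ Ψ.trans).Ad B.conn + (Φ.shift + Φ.trans.Ad Ψ.shift) =
        Φ.trans.Ad (Ψ.trans.Ad B.conn + Ψ.shift) + Φ.shift
      rw [DPoint.Ad_mul, DPoint.Ad_add]
      abel }

end TwoGauge
end

open TwoGauge in
theorem mainTheorem1
    {VE : Type u} [NormedAddCommGroup VE] [NormedSpace ℝ VE] [FiniteDimensional ℝ VE]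
    {E : Type u} [TopologicalSpace E] [ChartedSpace VE E] [Group E] [LieGroup 𝓘(ℝ, VE) ∞ E]
    [T2Space E] [SecondCountableTopology E]
    {VG : Type u} [NormedAddCommGroup VG] [NormedSpace ℝ VG] [FiniteDimensional ℝ VG]
    {G : Type u} [TopologicalSpace G] [ChartedSpace VG G] [Group G] [LieGroup 𝓘(ℝ, VG) ∞ G]
    [T2Space G] [SecondCountableTopology G]
    (M : LieCrossedModule VE E VG G)
    {A : Type v} [Ring A] [Algebra ℝ A] (𝒜 : ℤ → Submodule ℝ A) [GradedAlgebra 𝒜]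
    (O : Operation M 𝒜) :
    (∀ (Ψ : M.DPoint 𝒜) (Υ A₁ B₁ : M.DFun A), IsOneGauge O Ψ Υ → IsTwoConnection O A₁ B₁ →
      IsTwoConnection O (Ψ.Ad A₁ + Υ) (Ψ.Ad B₁)) ∧
    ∃ (_ : Group (OneGauge O)) (_ : MulAction (OneGauge O) (TwoConnection O)),
      (∀ Φ Ψ : OneGauge O, (Φ * Ψ).trans = Φ.trans.mul O.isFunctionAlgebra Ψ.trans ∧
        (Φ * Ψ).shift = Φ.shift + Φ.trans.Ad Ψ.shift) ∧
      (1 : OneGauge O).trans = LieCrossedModule.DPoint.one M 𝒜 ∧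
      (∀ Φ : OneGauge O, Φ⁻¹.trans = Φ.trans.inv) ∧
      Function.Injective (fun Φ : OneGauge O => Φ.trans) ∧
      (∀ (Φ : OneGauge O) (B : TwoConnection O),
        (Φ • B).conn = Φ.trans.Ad B.conn + Φ.shift ∧ (Φ • B).curv = Φ.trans.Ad B.curv) ∧
      (∀ (Φ : OneGauge O) (B : TwoConnection O), (Φ • B).IsFlat ↔ B.IsFlat) := by
  refine ⟨fun _ _ _ _ h hA => h.isTwoConnection hA, oneGaugeGroup O, oneGaugeAction O,
    fun _ _ => ⟨rfl, rfl⟩, rfl, fun _ => rfl, OneGauge.trans_injective, fun _ _ => ⟨rfl, rfl⟩,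
    fun Φ B => ⟨fun h => ?_, fun h => ?_⟩⟩
  · change Φ.trans.Ad B.curv = 0 at h
    change B.curv = 0
    rw [← Φ.trans.Ad_inv_Ad O.isFunctionAlgebra B.curv, h, LieCrossedModule.DPoint.Ad_zero]
  · change Φ.trans.Ad B.curv = 0
    rw [show B.curv = 0 from h, LieCrossedModule.DPoint.Ad_zero]
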